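/- Let $\mathbb K$ be a field of characteristic $0$, and let $I=(k_1,\dots,k_r)$, $r\ge 2$, be a tuple of positive integers. Put $J=(k_1,\dots,k_{r-2},k_{r-1}+k_r)$, $I^-=(k_1,\dots,k_{r-1})$ and $P=(k_1,\dots,k_{r-2})$ (so $P=(I^-)^-=J^-$, where ${}^-$ removes the last entry). For a tuple $L=(l_1,\dots,l_s)$ with sum $N$ let $R^L=\mathbb K[x_1,\dots,x_N]^{S_{l_1}\times\cdots\times S_{l_s}}$, graded by $\deg x_i=2$ (with $R^{\emptyset}=\mathbb K$); in particular $R^J\subseteq R^I$ and $R^{L^-}\subseteq R^L$. All bimodules are $\mathbb Z$-graded with $\mathbb K$ acting centrally, and morphisms have degree $0$; the shift is $(\mathbf q^sM)_n=M_{n-s}$. Let $\ell(L)=\sum_i\binom{l_i}{2}$, let $S=R^I\otimes_{R^J}R^J$ be the split bimodule, an $R^I$-$R^J$-bimodule, and let $U=\mathbf q^{\ell(I)-\ell(J)}R^J\otimes_{R^J}R^I$ be the merge bimodule, an $R^J$-$R^I$-bimodule. For a non-empty tuple $L$ with last entry $k$, let $e_1,\dots,e_k\in R^L$ be the elementary symmetric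 polynomials in the last $k$ variables. The colored partial trace $T_L$ sends a complex $M$ of graded $R^L$-bimodules to the complex of graded $R^{L^-}$-bimodules $$T_L(M)=\mathcal{HOM}^\bullet\Big(\bigotimes_{i=1}^{k}\big(\mathbf q^{2i}\,R^L\otimes_{\mathbb K}R^L\xrightarrow{\,e_i\otimes1-1\otimes e_i\,}R^L\otimes_{\mathbb K}R^L\big),\,M\Big)\cong\bigotimes_{i=1}^{k}\Big(M\xrightarrow{\,e_i\otimes1-1\otimes e_i\,}\mathbf q^{-2i}M\Big),$$ with $M$ in cohomological degree $0$ and $\mathbf q^{-2i}M$ in cohomological degree $1$ of each factor (that is, the iterated cocone, shifted cone, of the displayed chain maps); this closes the last strand, colored $k$. Then for every complex $B$ of graded $R^J$-$R^I$-bimodules and every complex $C$ of graded $R^I$-$R^J$-bimodules there are isomorphisms $$T_{I^-}\big(T_I(S\otimes_{R^J}B)\big)\cong\mathbf q^{2k_{r-1}k_r}\,T_J\big(B\otimes_{R^I}S\big),\qquad T_{I^-}\big(T_I(C\otimes_{R^J}U)\big)\cong\mathbf q^{2k_{r-1}k_r}\,T_J\big(U\otimes_{R^I}C\big)$$ in the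 derived category of graded $R^P$-bimodules. -/

import Mathlib

open CategoryTheory Limits
open scoped TensorProduct

universe w u

noncomputable section


/-- Criterion for a family of additive subgroups to be a direct sum decomposition. -/
theorem isInternal_of_proj {M : Type*} [AddCommGroup M] (G : ℤ → AddSubgroup M)
    (p : ℤ → M →+ M) (h1 : ∀ n, ∀ x ∈ G n, p n x = x)
    (h0 : ∀ m n, m ≠ n → ∀ x ∈ G n, p m x = 0) (htop : ⨆ n, G n = ⊤) :
    DirectSum.IsInternal G := by
  constructor
  · rw [injective_iff_map_eq_zero]
    intro f hf
    have key : ∀ (f : DirectSum ℤ fun n => G n) (n : ℤ),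
        p n (DirectSum.coeAddMonoidHom G f) = f n := by
      intro f n
      induction f using DirectSum.induction_on with
      | zero => simp
      | of i x =>
        rw [DirectSum.coeAddMonoidHom_of]
        by_cases h : n = i
        · subst h; simp [h1 _ _ x.2]
        · rw [h0 _ _ h _ x.2, DirectSum.of_eq_of_ne _ _ _ h]; simp
      | add x y hx hy => simp [hx, hy]
    refine DFinsupp.ext fun n => Subtype.ext ?_
    rw [← key f n, hf]; simp
  · intro x
    have : (⨆ n, G n) ≤ (DirectSum.coeAddMonoidHom G).range :=
      iSup_le fun n y hy => ⟨DirectSum.of (fun n => G n) n ⟨y, hy⟩, by simp⟩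
    exact this (htop ▸ AddSubgroup.mem_top x)

/-- A commutative `ℤ`-graded algebra over the field `K`. -/
structure GrAlg (K : Type u) [Field K] where
  /-- the underlying ring -/
  carrier : Type u
  [commRing : CommRing carrier]
  [algebra : Algebra K carrier]
  /-- the graded pieces -/
  deg : ℤ → Submodule K carrier
  [graded : GradedAlgebra deg]

namespace GrAlg
variable {K : Type u} [Field K]
instance : CoeSort (GrAlg K) (Type u) := ⟨GrAlg.carrier⟩
attribute [instance] GrAlg.commRing GrAlg.algebra GrAlg.graded
end GrAlg

/-- `ℤ`-graded `A`-`B`-bimodules (for commutative `A`, `B`, with `K` acting centrally): modules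
over `A ⊗[K] B`, where `(a ⊗ b) • x` is `a x b`, with a compatible grading. -/
structure GrBimod {K : Type u} [Field K] (A B : GrAlg K) where
  /-- the underlying module -/
  carrier : Type u
  [addCommGroup : AddCommGroup carrier]
  [module : Module (A ⊗[K] B) carrier]
  /-- the graded pieces -/
  deg : ℤ → AddSubgroup carrier
  isInternal : DirectSum.IsInternal deg
  smul_mem : ∀ {i j n : ℤ} {a : A} {b : B} {x : carrier}, a ∈ A.deg i → b ∈ B.deg j →
    x ∈ deg n → (a ⊗ₜ[K] b) • x ∈ deg (i + j + n)

namespace GrBimod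

variable {K : Type u} [Field K] {A B C : GrAlg K}

instance : CoeSort (GrBimod A B) (Type u) := ⟨GrBimod.carrier⟩
attribute [instance] GrBimod.addCommGroup GrBimod.module

theorem iSup_deg (M : GrBimod A B) : ⨆ n, M.deg n = ⊤ := by
  rw [eq_top_iff]
  intro x _
  obtain ⟨f, rfl⟩ := M.isInternal.2 x
  induction f using DirectSum.induction_on with
  | zero => simp
  | of i x =>
    rw [DirectSum.coeAddMonoidHom_of]
    exact AddSubgroup.mem_iSup_of_mem i x.2
  | add x y hx hy => rw [map_add]; exact add_mem (hx trivial) (hy trivial)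

/-- The homogeneous elements span. -/
theorem hom_induction (M : GrBimod A B) {P : M → Prop} (hom : ∀ n, ∀ x ∈ M.deg n, P x)
    (add : ∀ x y, P x → P y → P (x + y)) (x : M) : P x := by
  have hx : x ∈ ⨆ n, M.deg n := by rw [M.iSup_deg]; trivial
  exact AddSubgroup.iSup_induction M.deg (C := P) hx hom (hom 0 0 (zero_mem _)) add

/-- The projection to the graded piece of degree `n`. -/
def proj (M : GrBimod A B) (n : ℤ) : M →+ M :=
  letI := M.isInternal.chooseDecomposition
  (M.deg n).subtype.comp ((DFinsupp.evalAddMonoidHom n).comp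
    (DirectSum.decomposeAddEquiv M.deg).toAddMonoidHom)

theorem proj_same (M : GrBimod A B) {n : ℤ} {x : M} (hx : x ∈ M.deg n) : M.proj n x = x :=
  letI := M.isInternal.chooseDecomposition
  DirectSum.decompose_of_mem_same M.deg hx

theorem proj_ne (M : GrBimod A B) {m n : ℤ} (h : m ≠ n) {x : M} (hx : x ∈ M.deg n) :
    M.proj m x = 0 :=
  letI := M.isInternal.chooseDecomposition
  DirectSum.decompose_of_mem_ne M.deg hx h.symm

theorem proj_mem (M : GrBimod A B) (n : ℤ) (x : M) : M.proj n x ∈ M.deg n :=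
  SetLike.coe_mem _

theorem mem_iff_proj (M : GrBimod A B) (n : ℤ) (x : M) : x ∈ M.deg n ↔ M.proj n x = x :=
  ⟨M.proj_same, fun h => h ▸ M.proj_mem n x⟩

/-- Morphisms of graded bimodules: bimodule maps of degree `0`. -/
@[ext]
structure Hom (M N : GrBimod A B) where
  /-- the underlying bimodule map -/
  lin : M →ₗ[A ⊗[K] B] N
  map_deg : ∀ {n : ℤ} {x : M}, x ∈ M.deg n → lin x ∈ N.deg n

instance : Category (GrBimod A B) where
  Hom := Hom
  id M := ⟨LinearMap.id, id⟩
  comp f g := ⟨g.lin.comp f.lin, fun h => g.map_deg (f.map_deg h)⟩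

@[ext]
theorem hom_ext {M N : GrBimod A B} {f g : M ⟶ N} (h : ∀ x, f.lin x = g.lin x) : f = g :=
  Hom.ext (LinearMap.ext h)

@[simp] theorem id_lin (M : GrBimod A B) (x : M) : Hom.lin (𝟙 M) x = x := rfl
@[simp] theorem comp_lin {M N P : GrBimod A B} (f : M ⟶ N) (g : N ⟶ P) (x : M) :
    (f ≫ g).lin x = g.lin (f.lin x) := rfl

theorem map_proj {M N : GrBimod A B} (f : M ⟶ N) (n : ℤ) (x : M) :
    f.lin (M.proj n x) = N.proj n (f.lin x) := by
  induction x using M.hom_induction with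
  | hom i x hx =>
    by_cases h : n = i
    · subst h; rw [proj_same _ hx, proj_same _ (f.map_deg hx)]
    · rw [proj_ne _ h hx, proj_ne _ h (f.map_deg hx), map_zero]
  | add x y hx hy => simp [hx, hy]

section Preadditive
variable {M N : GrBimod A B}

instance : Zero (M ⟶ N) := ⟨⟨0, fun _ => zero_mem _⟩⟩
instance : Add (M ⟶ N) :=
  ⟨fun f g => ⟨f.lin + g.lin, fun h => add_mem (f.map_deg h) (g.map_deg h)⟩⟩
instance : Neg (M ⟶ N) := ⟨fun f => ⟨-f.lin, fun h => neg_mem (f.map_deg h)⟩⟩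
instance : Sub (M ⟶ N) :=
  ⟨fun f g => ⟨f.lin - g.lin, fun h => sub_mem (f.map_deg h) (g.map_deg h)⟩⟩
instance : SMul ℕ (M ⟶ N) :=
  ⟨fun k f => ⟨k • f.lin, fun h => AddSubgroup.nsmul_mem _ (f.map_deg h) k⟩⟩
instance : SMul ℤ (M ⟶ N) :=
  ⟨fun k f => ⟨k • f.lin, fun h => AddSubgroup.zsmul_mem _ (f.map_deg h) k⟩⟩

instance : AddCommGroup (M ⟶ N) :=
  Function.Injective.addCommGroup (fun f : M ⟶ N => f.lin) (fun _ _ h => Hom.ext h)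
    rfl (fun _ _ => rfl) (fun _ => rfl) (fun _ _ => rfl) (fun _ _ => rfl) (fun _ _ => rfl)

@[simp] theorem zero_lin (x : M) : Hom.lin (0 : M ⟶ N) x = 0 := rfl
@[simp] theorem add_lin (f g : M ⟶ N) (x : M) : (f + g).lin x = f.lin x + g.lin x := rfl

end Preadditive

instance : Preadditive (GrBimod A B) where
  add_comp _ _ _ f f' g := by ext x; simp
  comp_add _ _ _ f g g' := by ext x; simp

/-- The zero bimodule. -/
def zeroObj : GrBimod A B where
  carrier := PUnit
  deg _ := ⊤
  isInternal := isInternal_of_proj _ (fun _ => 0) (fun _ _ _ => rfl) (fun _ _ _ _ _ => rfl)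
    (Subsingleton.elim _ _)
  smul_mem _ _ _ := trivial

instance : HasZeroObject (GrBimod A B) :=
  ⟨zeroObj, (IsZero.iff_id_eq_zero _).2 (by ext x; rfl)⟩

/-- The direct sum of two graded bimodules. -/
def prod (M N : GrBimod A B) : GrBimod A B where
  carrier := M × N
  deg n := (M.deg n).prod (N.deg n)
  isInternal := by
    refine isInternal_of_proj _ (fun n => (M.proj n).prodMap (N.proj n)) ?_ ?_ ?_
    · rintro n ⟨x, y⟩ ⟨hx, hy⟩
      exact Prod.ext (M.proj_same hx) (N.proj_same hy)
    · rintro m n h ⟨x, y⟩ ⟨hx, hy⟩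
      exact Prod.ext (M.proj_ne h hx) (N.proj_ne h hy)
    · rw [eq_top_iff]
      rintro ⟨x, y⟩ -
      have hx : ∀ x : M, ((x, 0) : M × N) ∈ ⨆ n, (M.deg n).prod (N.deg n) := fun x => by
        induction x using M.hom_induction with
        | hom i x hx => exact AddSubgroup.mem_iSup_of_mem i ⟨hx, zero_mem _⟩
        | add x y hx hy => simpa using add_mem hx hy
      have hy : ∀ y : N, ((0, y) : M × N) ∈ ⨆ n, (M.deg n).prod (N.deg n) := fun x => by
        induction x using N.hom_induction with
        | hom i x hx => exact AddSubgroup.mem_iSup_of_mem i ⟨zero_mem _, hx⟩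
        | add x y hx hy => simpa using add_mem hx hy
      simpa using add_mem (hx x) (hy y)
  smul_mem ha hb hx := ⟨M.smul_mem ha hb hx.1, N.smul_mem ha hb hx.2⟩

instance : HasBinaryBiproducts (GrBimod A B) where
  has_binary_biproduct M N := hasBinaryBiproduct_of_total
    { pt := prod M N
      fst := ⟨LinearMap.fst _ M N, fun h => h.1⟩
      snd := ⟨LinearMap.snd _ M N, fun h => h.2⟩
      inl := ⟨LinearMap.inl _ M N, fun h => ⟨h, zero_mem _⟩⟩
      inr := ⟨LinearMap.inr _ M N, fun h => ⟨zero_mem _, h⟩⟩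
      inl_fst := rfl
      inl_snd := rfl
      inr_fst := rfl
      inr_snd := rfl }
    (by
      ext x
      exact Prod.ext (add_zero _) (zero_add _))

instance : HasFiniteProducts (GrBimod A B) :=
  hasFiniteProducts_of_has_binary_and_terminal

section Kernels
variable {M N : GrBimod A B} (f : M ⟶ N)

/-- The kernel of a morphism. -/
def ker : GrBimod A B where
  carrier := LinearMap.ker f.lin
  deg n := (M.deg n).comap (LinearMap.ker f.lin).toAddSubgroup.subtype
  isInternal := by
    have hp : ∀ n, ∀ x : LinearMap.ker f.lin, M.proj n x ∈ LinearMap.ker f.lin := by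
      intro n x
      rw [LinearMap.mem_ker, map_proj, x.2, map_zero]
    refine isInternal_of_proj _ (fun n => AddMonoidHom.codRestrict
      ((M.proj n).comp (LinearMap.ker f.lin).toAddSubgroup.subtype) _ (hp n)) ?_ ?_ ?_
    · intro n x hx
      exact Subtype.ext (M.proj_same hx)
    · intro m n h x hx
      exact Subtype.ext (M.proj_ne h hx)
    · rw [eq_top_iff]
      rintro x -
      classical
      let _ := M.isInternal.chooseDecomposition
      have hx : x = ∑ i ∈ (DirectSum.decompose M.deg x.1).support,
          (⟨M.proj i x, hp i x⟩ : LinearMap.ker f.lin) := by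
        refine Subtype.ext ?_
        rw [AddSubmonoidClass.coe_finsetSum]
        exact (DirectSum.sum_support_decompose M.deg x.1).symm
      rw [hx]
      exact sum_mem fun i _ => AddSubgroup.mem_iSup_of_mem i (M.proj_mem i x)
  smul_mem ha hb hx := M.smul_mem ha hb hx

/-- The inclusion of the kernel. -/
def kerι : ker f ⟶ M := ⟨(LinearMap.ker f.lin).subtype, id⟩

theorem kerι_comp : kerι f ≫ f = 0 := by
  ext x; exact x.2

/-- The kernel is a limit. -/
def kerIsLimit : IsLimit (KernelFork.ofι (kerι f) (kerι_comp f)) :=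
  KernelFork.IsLimit.ofι _ _
    (fun g hg => ⟨g.lin.codRestrict _ fun x => congrArg (fun h => Hom.lin h x) hg, g.map_deg⟩)
    (fun _ _ => rfl)
    (fun g hg m hm => by
      subst hm
      rfl)

instance : HasKernels (GrBimod A B) := ⟨fun f => ⟨_, kerIsLimit f⟩⟩

/-- The cokernel of a morphism. -/
def coker : GrBimod A B where
  carrier := N ⧸ LinearMap.range f.lin
  deg n := (N.deg n).map (LinearMap.range f.lin).mkQ.toAddMonoidHom
  isInternal := by
    refine isInternal_of_proj _ (fun n => QuotientAddGroup.map _ _ (N.proj n) ?_) ?_ ?_ ?_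
    · rintro _ ⟨x, rfl⟩
      exact ⟨M.proj n x, map_proj f n x⟩
    · rintro n _ ⟨x, hx, rfl⟩
      exact congrArg (LinearMap.range f.lin).mkQ (N.proj_same hx)
    · rintro m n h _ ⟨x, hx, rfl⟩
      exact congrArg (LinearMap.range f.lin).mkQ (N.proj_ne h hx)
    · rw [← AddSubgroup.map_iSup, N.iSup_deg, ← AddMonoidHom.range_eq_map,
        AddMonoidHom.range_eq_top]
      exact Submodule.mkQ_surjective _
  smul_mem := by
    rintro i j n a b _ ha hb ⟨x, hx, rfl⟩
    exact ⟨_, N.smul_mem ha hb hx, map_smul (LinearMap.range f.lin).mkQ _ x⟩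

/-- The projection to the cokernel. -/
def cokerπ : N ⟶ coker f := ⟨(LinearMap.range f.lin).mkQ, fun h => ⟨_, h, rfl⟩⟩

theorem comp_cokerπ : f ≫ cokerπ f = 0 := by
  ext x
  exact (Submodule.Quotient.mk_eq_zero _).2 ⟨x, rfl⟩

/-- The cokernel is a colimit. -/
def cokerIsColimit : IsColimit (CokernelCofork.ofπ (cokerπ f) (comp_cokerπ f)) :=
  CokernelCofork.IsColimit.ofπ _ _
    (fun g hg => ⟨(LinearMap.range f.lin).liftQ g.lin (by
        rintro _ ⟨x, rfl⟩
        exact congrArg (fun h => Hom.lin h x) hg), by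
      rintro n _ ⟨x, hx, rfl⟩
      exact g.map_deg hx⟩)
    (fun _ _ => rfl)
    (fun g hg m hm => by
      subst hm
      ext x
      obtain ⟨x, rfl⟩ := Submodule.mkQ_surjective _ x
      rfl)

instance : HasCokernels (GrBimod A B) := ⟨fun f => ⟨_, cokerIsColimit f⟩⟩

theorem injective_of_mono [Mono f] : Function.Injective f.lin := by
  rw [← LinearMap.ker_eq_bot, eq_bot_iff]
  intro x hx
  have h : kerι f = 0 := by rw [← cancel_mono f, kerι_comp, zero_comp]
  exact congrArg (fun h : ker f ⟶ M => h.lin ⟨x, hx⟩) h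

theorem surjective_of_epi [Epi f] : Function.Surjective f.lin := by
  rw [← LinearMap.range_eq_top, eq_top_iff]
  intro x _
  have h : cokerπ f = 0 := by rw [← cancel_epi f, comp_cokerπ, comp_zero]
  exact (Submodule.Quotient.mk_eq_zero _).1 (congrArg (fun h : N ⟶ coker f => h.lin x) h)

theorem exists_lift [Mono f] {X : GrBimod A B} (g : X ⟶ N) (hg : g ≫ cokerπ f = 0) :
    ∃ h : X ⟶ M, h ≫ f = g := by
  have hr : ∀ x, g.lin x ∈ LinearMap.range f.lin := fun x =>
    (Submodule.Quotient.mk_eq_zero _).1 (congrArg (fun h : X ⟶ coker f => h.lin x) hg)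
  let e := LinearEquiv.ofInjective f.lin (injective_of_mono f)
  have he : ∀ x, f.lin (e.symm (g.lin.codRestrict _ hr x)) = g.lin x := fun x =>
    congrArg Subtype.val (e.apply_symm_apply (g.lin.codRestrict _ hr x))
  refine ⟨⟨e.symm.toLinearMap.comp (g.lin.codRestrict _ hr), ?_⟩, hom_ext he⟩
  intro n x hx
  rw [mem_iff_proj]
  apply injective_of_mono f
  have := he x
  rw [map_proj]
  exact N.proj_same (this ▸ g.map_deg hx)

theorem exists_desc [Epi f] {X : GrBimod A B} (g : M ⟶ X) (hg : kerι f ≫ g = 0) :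
    ∃ h : N ⟶ X, f ≫ h = g := by
  have hk : LinearMap.ker f.lin ≤ LinearMap.ker g.lin := fun x hx =>
    congrArg (fun h : ker f ⟶ X => h.lin ⟨x, hx⟩) hg
  let e := f.lin.quotKerEquivOfSurjective (surjective_of_epi f)
  have he : ∀ x, (LinearMap.ker f.lin).liftQ g.lin hk (e.symm (f.lin x)) = g.lin x := fun x =>
    congrArg ((LinearMap.ker f.lin).liftQ g.lin hk)
      (e.symm_apply_apply ((LinearMap.ker f.lin).mkQ x))
  refine ⟨⟨((LinearMap.ker f.lin).liftQ g.lin hk).comp e.symm.toLinearMap, ?_⟩, hom_ext he⟩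
  intro n y hy
  obtain ⟨x, rfl⟩ := surjective_of_epi f y
  have h : (LinearMap.ker f.lin).liftQ g.lin hk (e.symm (f.lin x)) = g.lin (M.proj n x) := by
    rw [← he, map_proj, N.proj_same hy]
  exact h ▸ g.map_deg (M.proj_mem n x)

end Kernels

instance : Abelian (GrBimod A B) where
  normalMonoOfMono f _ := ⟨
    { Z := coker f
      g := cokerπ f
      w := comp_cokerπ f
      isLimit := KernelFork.IsLimit.ofι _ _ (fun g hg => (exists_lift f g hg).choose)
        (fun g hg => (exists_lift f g hg).choose_spec)
        (fun g hg m hm => by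
          rw [← cancel_mono f, hm]
          exact (exists_lift f g hg).choose_spec.symm) }⟩
  normalEpiOfEpi f _ := ⟨
    { W := ker f
      g := kerι f
      w := kerι_comp f
      isColimit := CokernelCofork.IsColimit.ofπ _ _ (fun g hg => (exists_desc f g hg).choose)
        (fun g hg => (exists_desc f g hg).choose_spec)
        (fun g hg m hm => by
          rw [← cancel_epi f, hm]
          exact (exists_desc f g hg).choose_spec.symm) }⟩

end GrBimod

namespace GrBimod
variable {K : Type u} [Field K] {A B C A' B' : GrAlg K}

/-- The grading shift `q ^ s`: `(q ^ s M)_n = M_(n - s)`. -/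
def qShiftObj (s : ℤ) (M : GrBimod A B) : GrBimod A B where
  carrier := M
  deg n := M.deg (n - s)
  isInternal := isInternal_of_proj _ (fun n => M.proj (n - s)) (fun _ _ hx => M.proj_same hx)
    (fun _ _ h _ hx => M.proj_ne (by omega) hx) (by
      rw [← M.iSup_deg]
      exact (Equiv.subRight s).iSup_comp (g := M.deg))
  smul_mem {i j n _ _ _} ha hb hx := by
    have := M.smul_mem ha hb hx
    rwa [show i + j + n - s = i + j + (n - s) by ring]

/-- The grading shift functor `q ^ s`. -/
def qShift (A B : GrAlg K) (s : ℤ) : GrBimod A B ⥤ GrBimod A B where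
  obj := qShiftObj s
  map f := ⟨f.lin, f.map_deg⟩

instance (s : ℤ) : (qShift A B s).Additive where

/-- For `r` of degree `d` in `A`, the degree `0` bimodule map `r ⊗ 1 - 1 ⊗ r : M ⟶ q ^ (-d) M`. -/
def commutatorMap {r : A} {d : ℤ} (hr : r ∈ A.deg d) (M : GrBimod A A) :
    M ⟶ (qShift A A (-d)).obj M where
  lin := LinearMap.lsmul (A ⊗[K] A) M (r ⊗ₜ[K] 1 - 1 ⊗ₜ[K] r)
  map_deg {n x} hx := by
    have h1 : (r ⊗ₜ[K] (1 : A)) • x ∈ M.deg (n - -d) := by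
      have := M.smul_mem hr SetLike.GradedOne.one_mem hx
      rwa [show d + 0 + n = n - -d by ring] at this
    have h2 : ((1 : A) ⊗ₜ[K] r) • x ∈ M.deg (n - -d) := by
      have := M.smul_mem SetLike.GradedOne.one_mem hr hx
      rwa [show 0 + d + n = n - -d by ring] at this
    have := sub_mem h1 h2
    rwa [← sub_smul] at this

theorem commutatorMap_naturality {r : A} {d : ℤ} (hr : r ∈ A.deg d) {M N : GrBimod A A}
    (f : M ⟶ N) : f ≫ commutatorMap hr N = commutatorMap hr M ≫ (qShift A A (-d)).map f := by
  ext x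
  exact (f.lin.map_smul _ x).symm

/-- The map `r ⊗ 1 - 1 ⊗ r` on a complex of bimodules. -/
def commutatorChainMap {r : A} {d : ℤ} (hr : r ∈ A.deg d) (M : CochainComplex (GrBimod A A) ℤ) :
    M ⟶ ((qShift A A (-d)).mapHomologicalComplex (ComplexShape.up ℤ)).obj M where
  f i := commutatorMap hr (M.X i)
  comm' _ _ _ := (commutatorMap_naturality hr _).symm

end GrBimod

/-- Homomorphisms of graded algebras. -/
structure GrAlg.Hom {K : Type u} [Field K] (A B : GrAlg K) where
  /-- the underlying algebra homomorphism -/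
  toAlgHom : A →ₐ[K] B
  map_deg : ∀ {n : ℤ} {x : A}, x ∈ A.deg n → toAlgHom x ∈ B.deg n

/-- The identity. -/
def GrAlg.Hom.id {K : Type u} [Field K] (A : GrAlg K) : GrAlg.Hom A A := ⟨AlgHom.id K A, _root_.id⟩

namespace GrBimod
variable {K : Type u} [Field K] {A B C A' B' : GrAlg K}

/-- Restriction of a bimodule along homomorphisms of graded algebras. -/
def restrictObj (f : GrAlg.Hom A' A) (g : GrAlg.Hom B' B) (M : GrBimod A B) : GrBimod A' B' where
  carrier := M
  module := Module.compHom M (Algebra.TensorProduct.map f.toAlgHom g.toAlgHom).toRingHom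
  deg := M.deg
  isInternal := M.isInternal
  smul_mem ha hb hx := M.smul_mem (f.map_deg ha) (g.map_deg hb) hx

/-- Restriction of scalars as a functor. -/
def restrict (f : GrAlg.Hom A' A) (g : GrAlg.Hom B' B) : GrBimod A B ⥤ GrBimod A' B' where
  obj := restrictObj f g
  map {M N} h := 
    { lin :=
      { toFun := h.lin
        map_add' := h.lin.map_add
        map_smul' := fun c x => h.lin.map_smul (Algebra.TensorProduct.map f.toAlgHom g.toAlgHom c) x }
      map_deg := h.map_deg }

instance (f : GrAlg.Hom A' A) (g : GrAlg.Hom B' B) : (restrict f g).Additive where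

/-- The diagonal bimodule: `A` with `(a ⊗ b) • x = a x b`. -/
def diag (A : GrAlg K) : GrBimod A A where
  carrier := A
  module := Module.compHom A (Algebra.TensorProduct.lmul' K (S := A)).toRingHom
  deg n := (A.deg n).toAddSubgroup
  isInternal := DirectSum.Decomposition.isInternal A.deg
  smul_mem {i j n a b x} ha hb hx := by
    change Algebra.TensorProduct.lmul' K (a ⊗ₜ[K] b) * x ∈ A.deg (i + j + n)
    rw [Algebra.TensorProduct.lmul'_apply_tmul]
    exact SetLike.GradedMul.mul_mem (SetLike.GradedMul.mul_mem ha hb) hx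

end GrBimod

namespace GrBimod
variable {K : Type u} [Field K] {A B C : GrAlg K}

/-- The underlying right module of a bimodule. -/
def RightMod (M : GrBimod A B) : Type u := M.carrier

/-- The underlying left module of a bimodule. -/
def LeftMod (M : GrBimod A B) : Type u := M.carrier

namespace RightMod
variable (M : GrBimod A B)
instance : AddCommGroup M.RightMod := M.addCommGroup
instance : Module (A ⊗[K] B) M.RightMod := M.module
instance : Module B M.RightMod :=
  Module.compHom M (Algebra.TensorProduct.includeRight : B →ₐ[K] A ⊗[K] B).toRingHom
instance : Module K M.RightMod := Module.compHom M (algebraMap K (A ⊗[K] B))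
theorem smul_def (b : B) (x : M.RightMod) :
    b • x = (((1 : A) ⊗ₜ[K] b) • x) := rfl
theorem ksmul_def (k : K) (x : M.RightMod) :
    k • x = (algebraMap K (A ⊗[K] B) k • x) := rfl
instance : IsScalarTower K B M.RightMod where
  smul_assoc k b x := by
    rw [smul_def, smul_def, ksmul_def, smul_smul, TensorProduct.tmul_smul, Algebra.smul_def]
/-- The left action, by right module endomorphisms. -/
def actL : A →ₐ[K] Module.End B M.RightMod where
  toFun a :=
    { toFun := fun x => ((a ⊗ₜ[K] (1 : B)) • x)
      map_add' := fun x y => smul_add _ x y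
      map_smul' := fun b x => smul_comm (a ⊗ₜ[K] (1 : B)) ((1 : A) ⊗ₜ[K] b) x }
  map_one' := LinearMap.ext fun x => one_smul (A ⊗[K] B) x
  map_mul' a a' := LinearMap.ext fun x => by
    change ((a * a') ⊗ₜ[K] (1 : B)) • x =
      (a ⊗ₜ[K] (1 : B)) • (a' ⊗ₜ[K] (1 : B)) • x
    rw [smul_smul, Algebra.TensorProduct.tmul_mul_tmul, one_mul]
  map_zero' := LinearMap.ext fun x => by
    change ((0 : A) ⊗ₜ[K] (1 : B)) • x = 0
    rw [TensorProduct.zero_tmul, zero_smul]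
  map_add' a a' := LinearMap.ext fun x => by
    change ((a + a') ⊗ₜ[K] (1 : B)) • x =
      (a ⊗ₜ[K] (1 : B)) • x + (a' ⊗ₜ[K] (1 : B)) • x
    rw [TensorProduct.add_tmul, add_smul]
  commutes' k := rfl
end RightMod

namespace LeftMod
variable (M : GrBimod A B)
instance : AddCommGroup M.LeftMod := M.addCommGroup
instance : Module (A ⊗[K] B) M.LeftMod := M.module
instance : Module A M.LeftMod :=
  Module.compHom M (Algebra.TensorProduct.includeLeft : A →ₐ[K] A ⊗[K] B).toRingHom
instance : Module K M.LeftMod := Module.compHom M (algebraMap K (A ⊗[K] B))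
theorem smul_def (a : A) (x : M.LeftMod) :
    a • x = ((a ⊗ₜ[K] (1 : B)) • x) := rfl
theorem ksmul_def (k : K) (x : M.LeftMod) :
    k • x = (algebraMap K (A ⊗[K] B) k • x) := rfl
instance : IsScalarTower K A M.LeftMod where
  smul_assoc k b x := by
    rw [smul_def, smul_def, ksmul_def, smul_smul, ← TensorProduct.smul_tmul', Algebra.smul_def]
/-- The right action, by left module endomorphisms. -/
def actR : B →ₐ[K] Module.End A M.LeftMod where
  toFun b :=
    { toFun := fun x => (((1 : A) ⊗ₜ[K] b) • x)
      map_add' := fun x y => smul_add _ x y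
      map_smul' := fun a x => smul_comm ((1 : A) ⊗ₜ[K] b) (a ⊗ₜ[K] (1 : B)) x }
  map_one' := LinearMap.ext fun x => one_smul (A ⊗[K] B) x
  map_mul' b b' := LinearMap.ext fun x => by
    change ((1 : A) ⊗ₜ[K] (b * b')) • x =
      ((1 : A) ⊗ₜ[K] b) • ((1 : A) ⊗ₜ[K] b') • x
    rw [smul_smul, Algebra.TensorProduct.tmul_mul_tmul, one_mul]
  map_zero' := LinearMap.ext fun x => by
    change ((1 : A) ⊗ₜ[K] (0 : B)) • x = 0
    rw [TensorProduct.tmul_zero, zero_smul]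
  map_add' b b' := LinearMap.ext fun x => by
    change ((1 : A) ⊗ₜ[K] (b + b')) • x =
      ((1 : A) ⊗ₜ[K] b) • x + ((1 : A) ⊗ₜ[K] b') • x
    rw [TensorProduct.tmul_add, add_smul]
  commutes' k := LinearMap.ext fun x => by
    change ((1 : A) ⊗ₜ[K] algebraMap K B k) • x =
      algebraMap K (A ⊗[K] B) k • x
    rw [← Algebra.TensorProduct.algebraMap_apply']
end LeftMod

variable (M : GrBimod A B) (N : GrBimod B C)

/-- The underlying abelian group of `M ⊗_B N`. -/
abbrev TensorCarrier : Type u := M.RightMod ⊗[B] N.LeftMod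

/-- The action of `A ⊗[K] C` on `M ⊗_B N`: `(a ⊗ c) • (x ⊗ y) = (a x) ⊗ (y c)`. -/
def tensorAct : A ⊗[K] C →ₐ[K] Module.End B (TensorCarrier M N) :=
  Algebra.TensorProduct.lift
    (((Module.End.rTensorAlgHom B M.RightMod N.LeftMod).restrictScalars K).comp
      (RightMod.actL M))
    (((Module.End.lTensorAlgHom B N.LeftMod M.RightMod).restrictScalars K).comp
      (LeftMod.actR N))
    (fun _ _ => TensorProduct.ext' fun _ _ => rfl)

/-- `M ⊗_B N` as a module over `A ⊗[K] C`. -/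
abbrev tensorModule : Module (A ⊗[K] C) (TensorCarrier M N) :=
  Module.compHom _ (tensorAct M N).toRingHom

/-- The degree `n` part of `M ⊗_B N`, spanned by all `x ⊗ y` with `deg x + deg y = n`. -/
def tensorDeg (n : ℤ) : AddSubgroup (TensorCarrier M N) :=
  AddSubgroup.closure {t | ∃ (i j : ℤ) (x : M) (y : N), x ∈ M.deg i ∧ y ∈ N.deg j ∧ i + j = n ∧
    t = (show M.RightMod from x) ⊗ₜ[B] (show N.LeftMod from y)}

variable {M N} in
theorem tmul_mem_tensorDeg {i j n : ℤ} {x : M} {y : N} (hx : x ∈ M.deg i) (hy : y ∈ N.deg j)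
    (h : i + j = n) :
    (show M.RightMod from x) ⊗ₜ[B] (show N.LeftMod from y) ∈ tensorDeg M N n :=
  AddSubgroup.subset_closure ⟨i, j, x, y, hx, hy, h, rfl⟩

/-- The biadditive map `(x, y) ↦ x ⊗ y`. -/
def tmulHom : M.RightMod →+ N.LeftMod →+ TensorCarrier M N where
  toFun x := (TensorProduct.mk B M.RightMod N.LeftMod x).toAddMonoidHom
  map_zero' := by ext; simp
  map_add' _ _ := by ext; simp

/-- The biadditive map `(x, y) ↦ ∑ i, x_i ⊗ y_(n - i)`. -/
def tensorProjAux (n : ℤ) : M.RightMod →+ N.LeftMod →+ TensorCarrier M N :=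
  letI := M.isInternal.chooseDecomposition
  (DirectSum.toAddMonoid fun i =>
    ((tmulHom M N).comp (M.deg i).subtype).compl₂ (N.proj (n - i))).comp
      (DirectSum.decomposeAddEquiv M.deg).toAddMonoidHom

variable {M N} in
theorem tensorProjAux_left {n i : ℤ} {x : M} {y : N} (hx : x ∈ M.deg i) :
    tensorProjAux M N n x y =
      (show M.RightMod from x) ⊗ₜ[B] (show N.LeftMod from N.proj (n - i) y) := by
  let _ := M.isInternal.chooseDecomposition
  change (DirectSum.toAddMonoid (fun i =>
    ((tmulHom M N).comp (M.deg i).subtype).compl₂ (N.proj (n - i)))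
      (DirectSum.decompose M.deg x)) y = _
  rw [DirectSum.decompose_of_mem M.deg hx, DirectSum.toAddMonoid_of]
  rfl

variable {M N} in
theorem tensorProjAux_same {n i j : ℤ} {x : M} {y : N} (hx : x ∈ M.deg i) (hy : y ∈ N.deg j)
    (h : i + j = n) : tensorProjAux M N n x y =
      (show M.RightMod from x) ⊗ₜ[B] (show N.LeftMod from y) := by
  rw [tensorProjAux_left hx, proj_same N (by rwa [show n - i = j by omega])]

variable {M N} in
theorem tensorProjAux_ne {n i j : ℤ} {x : M} {y : N} (hx : x ∈ M.deg i) (hy : y ∈ N.deg j)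
    (h : i + j ≠ n) : tensorProjAux M N n x y = 0 := by
  rw [tensorProjAux_left hx, proj_ne N (show n - i ≠ j by omega) hy]
  exact TensorProduct.tmul_zero _ _

theorem RightMod.smul_mem {i j : ℤ} {b : B} {x : M.RightMod} (hb : b ∈ B.deg i)
    (hx : x ∈ M.deg j) : b • x ∈ M.deg (i + j) := by
  have := M.smul_mem SetLike.GradedOne.one_mem hb hx
  rwa [zero_add] at this

theorem LeftMod.smul_mem {i j : ℤ} {b : B} {y : N.LeftMod} (hb : b ∈ B.deg i)
    (hy : y ∈ N.deg j) : b • y ∈ N.deg (i + j) := by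
  have := N.smul_mem hb SetLike.GradedOne.one_mem hy
  rwa [add_zero] at this

theorem tensorProjAux_balanced (n : ℤ) (b : B) (x : M.RightMod) (y : N.LeftMod) :
    tensorProjAux M N n (b • x) y = tensorProjAux M N n x (b • y) := by
  induction b using DirectSum.Decomposition.inductionOn B.deg with
  | zero => simp
  | add b b' hb hb' => rw [add_smul, add_smul, map_add, map_add, AddMonoidHom.add_apply, hb, hb']
  | @homogeneous l b =>
    induction x using M.hom_induction with
    | add x x' hx hx' =>
      have : b.1 • (show M.RightMod from x + x') = b.1 • (show M.RightMod from x) +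
        b.1 • (show M.RightMod from x') := smul_add _ _ _
      refine (congrArg (fun z => tensorProjAux M N n z y) this).trans ?_
      rw [map_add, AddMonoidHom.add_apply, hx, hx']
      exact (congrArg (fun z => z (b.1 • y)) (map_add (tensorProjAux M N n) _ _)).symm
    | hom i x hx =>
      induction y using N.hom_induction with
      | add y y' hy hy' =>
        have : b.1 • (show N.LeftMod from y + y') = b.1 • (show N.LeftMod from y) +
          b.1 • (show N.LeftMod from y') := smul_add _ _ _
        refine (map_add (tensorProjAux M N n _) _ _).trans ?_
        rw [hy, hy']
        exact ((congrArg (tensorProjAux M N n x) this).trans (map_add _ _ _)).symm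
      | hom j y hy =>
        by_cases h : l + i + j = n
        · refine (tensorProjAux_same (RightMod.smul_mem M b.2 hx) hy h).trans ?_
          refine Eq.trans ?_
            (tensorProjAux_same hx (LeftMod.smul_mem N b.2 hy) (by omega)).symm
          exact TensorProduct.smul_tmul b.1 (show M.RightMod from x) (show N.LeftMod from y)
        · refine (tensorProjAux_ne (RightMod.smul_mem M b.2 hx) hy h).trans ?_
          exact (tensorProjAux_ne hx (LeftMod.smul_mem N b.2 hy) (by omega)).symm

/-- The projection of `M ⊗_B N` to its degree `n` part. -/
def tensorProj (n : ℤ) : TensorCarrier M N →+ TensorCarrier M N :=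
  TensorProduct.liftAddHom (tensorProjAux M N n) (tensorProjAux_balanced M N n)

/-- The tensor product `M ⊗_B N` of graded bimodules. -/
def tensorObj : GrBimod A C where
  carrier := TensorCarrier M N
  module := tensorModule M N
  deg := tensorDeg M N
  isInternal := by
    refine isInternal_of_proj _ (tensorProj M N) ?_ ?_ ?_
    · intro n t ht
      induction ht using AddSubgroup.closure_induction with
      | mem t ht =>
        obtain ⟨i, j, x, y, hx, hy, h, rfl⟩ := ht
        exact tensorProjAux_same hx hy h
      | zero => simp
      | add s t _ _ hs ht => rw [map_add, hs, ht]
      | neg t _ ht => rw [map_neg, ht]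
    · intro m n hmn t ht
      induction ht using AddSubgroup.closure_induction with
      | mem t ht =>
        obtain ⟨i, j, x, y, hx, hy, h, rfl⟩ := ht
        exact tensorProjAux_ne hx hy (by omega)
      | zero => simp
      | add s t _ _ hs ht => rw [map_add, hs, ht, add_zero]
      | neg t _ ht => rw [map_neg, ht, neg_zero]
    · rw [eq_top_iff]
      rintro t -
      induction t using TensorProduct.induction_on with
      | zero => exact zero_mem _
      | add s t hs ht => exact add_mem hs ht
      | tmul x y =>
        induction x using M.hom_induction with
        | add x x' hx hx' =>
          exact (TensorProduct.add_tmul (R := B) (show M.RightMod from x) x' y) ▸ add_mem hx hx'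
        | hom i x hx =>
          induction y using N.hom_induction with
          | add y y' hy hy' =>
            exact (TensorProduct.tmul_add (R := B) (show M.RightMod from x)
              (show N.LeftMod from y) y') ▸ add_mem hy hy'
          | hom j y hy =>
            exact AddSubgroup.mem_iSup_of_mem (i + j) (tmul_mem_tensorDeg hx hy rfl)
  smul_mem := by
    intro i j n a c t ha hc ht
    change tensorAct M N (a ⊗ₜ[K] c) t ∈ tensorDeg M N (i + j + n)
    induction ht using AddSubgroup.closure_induction with
    | mem t ht =>
      obtain ⟨k, l, x, y, hx, hy, h, rfl⟩ := ht
      have h1 := M.smul_mem ha SetLike.GradedOne.one_mem hx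
      have h2 := N.smul_mem SetLike.GradedOne.one_mem hc hy
      exact tmul_mem_tensorDeg h1 h2 (by omega)
    | zero => rw [map_zero]; exact zero_mem _
    | add s t _ _ hs ht => rw [map_add]; exact add_mem hs ht
    | neg t _ ht => rw [map_neg]; exact neg_mem ht

variable {M N}

/-- A bimodule map, as a map of right modules. -/
def RightMod.lin {M M' : GrBimod A B} (f : M ⟶ M') : M.RightMod →ₗ[B] M'.RightMod where
  toFun := f.lin
  map_add' := f.lin.map_add
  map_smul' _ x := f.lin.map_smul _ x

/-- A bimodule map, as a map of left modules. -/
def LeftMod.lin {N N' : GrBimod B C} (g : N ⟶ N') : N.LeftMod →ₗ[B] N'.LeftMod where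
  toFun := g.lin
  map_add' := g.lin.map_add
  map_smul' _ y := g.lin.map_smul _ y

theorem map_tensorAct {M M' : GrBimod A B} {N N' : GrBimod B C} (f : M ⟶ M') (g : N ⟶ N')
    (e : A ⊗[K] C) (t : TensorCarrier M N) :
    TensorProduct.map (RightMod.lin f) (LeftMod.lin g) (tensorAct M N e t) =
      tensorAct M' N' e (TensorProduct.map (RightMod.lin f) (LeftMod.lin g) t) := by
  induction e using TensorProduct.induction_on with
  | zero => simp
  | add e e' he he' =>
    rw [map_add, map_add, LinearMap.add_apply, LinearMap.add_apply, map_add, he, he']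
  | tmul a c =>
    induction t using TensorProduct.induction_on with
    | zero => simp
    | add s t hs ht => simp only [map_add, hs, ht]
    | tmul x y =>
      exact congrArg₂ (fun (x : M'.RightMod) (y : N'.LeftMod) => x ⊗ₜ[B] y)
        (f.lin.map_smul (a ⊗ₜ[K] 1) x) (g.lin.map_smul (1 ⊗ₜ[K] c) y)

theorem map_mem_tensorDeg {M M' : GrBimod A B} {N N' : GrBimod B C} (f : M ⟶ M') (g : N ⟶ N')
    {n : ℤ} {t : TensorCarrier M N} (ht : t ∈ tensorDeg M N n) :
    TensorProduct.map (RightMod.lin f) (LeftMod.lin g) t ∈ tensorDeg M' N' n := by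
  induction ht using AddSubgroup.closure_induction with
  | mem t ht =>
    obtain ⟨k, l, x, y, hx, hy, h, rfl⟩ := ht
    exact tmul_mem_tensorDeg (f.map_deg hx) (g.map_deg hy) h
  | zero => rw [map_zero]; exact zero_mem _
  | add s t _ _ hs ht => rw [map_add]; exact add_mem hs ht
  | neg t _ ht => rw [map_neg]; exact neg_mem ht

/-- The functoriality of `M ⊗_B N` in both arguments. -/
def tensorMap {M M' : GrBimod A B} {N N' : GrBimod B C} (f : M ⟶ M') (g : N ⟶ N') :
    tensorObj M N ⟶ tensorObj M' N' where
  lin :=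
    { toFun := TensorProduct.map (RightMod.lin f) (LeftMod.lin g)
      map_add' := map_add _
      map_smul' := fun e t => map_tensorAct f g e t }
  map_deg ht := map_mem_tensorDeg f g ht

theorem tensor_hom_ext {P : GrBimod A C} {f g : tensorObj M N ⟶ P}
    (h : ∀ (x : M.RightMod) (y : N.LeftMod), f.lin (x ⊗ₜ[B] y) = g.lin (x ⊗ₜ[B] y)) : f = g := by
  refine hom_ext fun t => ?_
  induction t using TensorProduct.induction_on with
  | zero => exact (map_zero f.lin).trans (map_zero g.lin).symm
  | add s t hs ht => exact (map_add f.lin s t).trans ((congrArg₂ _ hs ht).trans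
      (map_add g.lin s t).symm)
  | tmul x y => exact h x y

/-- The functor `M ⊗_B -`. -/
def tensorLeft (M : GrBimod A B) : GrBimod B C ⥤ GrBimod A C where
  obj N := tensorObj M N
  map g := tensorMap (𝟙 M) g
  map_id _ := tensor_hom_ext fun _ _ => rfl
  map_comp {_ _ _} _ _ := tensor_hom_ext (f := _) (g := _) fun _ _ => rfl

/-- The functor `- ⊗_B N`. -/
def tensorRight (N : GrBimod B C) : GrBimod A B ⥤ GrBimod A C where
  obj M := tensorObj M N
  map f := tensorMap f (𝟙 N)
  map_id _ := tensor_hom_ext fun _ _ => rfl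
  map_comp {_ _ _} _ _ := tensor_hom_ext (f := _) (g := _) fun _ _ => rfl

instance (M : GrBimod A B) : (tensorLeft (C := C) M).Additive where
  map_add {_ _ _ _} := tensor_hom_ext fun _ _ => TensorProduct.tmul_add _ _ _

instance (N : GrBimod B C) : (tensorRight (A := A) N).Additive where
  map_add {_ _ _ _} := tensor_hom_ext fun _ _ => TensorProduct.add_tmul _ _ _

end GrBimod

namespace Web

open MvPolynomial

/-- The parabolic (Young) subgroup `S_{k_1} × ⋯ × S_{k_r}` of the symmetric group on
`{0, …, N - 1}`, `N = k_1 + ⋯ + k_r`, attached to the tuple `I = [k_1, …, k_r]`: the permutations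
preserving each initial segment `{x | x < k_1 + ⋯ + k_i}` (equivalently, each of the `r`
consecutive blocks), and fixing all `x ≥ N`. -/
def parabolic (I : List ℕ) : Subgroup (Equiv.Perm ℕ) where
  carrier := {σ | (∀ i x, σ x < (I.take i).sum ↔ x < (I.take i).sum) ∧ ∀ x, I.sum ≤ x → σ x = x}
  one_mem' := ⟨fun _ _ => Iff.rfl, fun _ _ => rfl⟩
  mul_mem' {σ τ} hσ hτ := ⟨fun i x => (hσ.1 i (τ x)).trans (hτ.1 i x), fun x hx => by
    rw [Equiv.Perm.mul_apply, hτ.2 x hx, hσ.2 x hx]⟩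
  inv_mem' {σ} hσ := ⟨fun i x => by
    have := hσ.1 i (σ⁻¹ x)
    rw [← Equiv.Perm.mul_apply, mul_inv_cancel] at this
    exact this.symm,
    fun x hx => by rw [Equiv.Perm.inv_eq_iff_eq, hσ.2 x hx]⟩

variable (K : Type u) [Field K]

/-- The ring of invariants of the parabolic subgroup of `I` in `K[x_0, …, x_{N-1}]`,
realized inside the polynomial ring in variables `x_j`, `j ∈ ℕ`. -/
def invariants (I : List ℕ) : Subalgebra K (MvPolynomial ℕ K) where
  carrier := {f | f ∈ supported K {j | j < I.sum} ∧ ∀ σ ∈ parabolic I, rename σ f = f}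
  mul_mem' hf hg := ⟨mul_mem hf.1 hg.1, fun σ hσ => by rw [map_mul, hf.2 σ hσ, hg.2 σ hσ]⟩
  add_mem' hf hg := ⟨add_mem hf.1 hg.1, fun σ hσ => by rw [map_add, hf.2 σ hσ, hg.2 σ hσ]⟩
  algebraMap_mem' k := ⟨Subalgebra.algebraMap_mem _ k, fun σ _ => AlgHom.commutes _ k⟩

variable {K}

/-- All variables have degree `2`. -/
abbrev degTwo : ℕ → ℤ := fun _ => 2

theorem weight_mapDomain (σ : ℕ → ℕ) (d : ℕ →₀ ℕ) :
    Finsupp.weight degTwo (d.mapDomain σ) = Finsupp.weight degTwo d := by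
  rw [Finsupp.weight_apply, Finsupp.weight_apply, Finsupp.sum_mapDomain_index] <;> simp [add_mul]

theorem rename_component (σ : ℕ → ℕ) (n : ℤ) (f : MvPolynomial ℕ K) :
    rename σ (weightedHomogeneousComponent degTwo n f) =
      weightedHomogeneousComponent degTwo n (rename σ f) := by
  induction f using MvPolynomial.induction_on' with
  | add f g hf hg => simp only [map_add, hf, hg]
  | monomial d c =>
    rw [rename_monomial, weightedHomogeneousComponent_of_mem
        (isWeightedHomogeneous_monomial degTwo d c rfl),
      weightedHomogeneousComponent_of_mem
        (isWeightedHomogeneous_monomial degTwo (d.mapDomain σ) c (weight_mapDomain σ d))]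
    split_ifs
    · rw [rename_monomial]
    · rw [map_zero]

theorem component_mem_invariants {I : List ℕ} (n : ℤ) {f : MvPolynomial ℕ K}
    (hf : f ∈ invariants K I) : weightedHomogeneousComponent degTwo n f ∈ invariants K I := by
  refine ⟨?_, fun σ hσ => by rw [rename_component, hf.2 σ hσ]⟩
  have h := mem_supported.1 hf.1
  refine mem_supported.2 fun j hj => h ?_
  obtain ⟨d, hd, hj⟩ := (mem_vars_iff_mem_support j).1 hj
  rw [support_weightedHomogeneousComponent] at hd
  exact (mem_vars_iff_mem_support j).2 ⟨d, (Finset.mem_filter.1 hd).1, hj⟩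

variable (K)

/-- The degree `n` part of the ring of invariants, where `deg x_j = 2`. -/
def invariantsDeg (I : List ℕ) (n : ℤ) : Submodule K (invariants K I) :=
  (weightedHomogeneousSubmodule K degTwo n).comap (invariants K I).val.toLinearMap

theorem invariantsDeg_isInternal (I : List ℕ) : DirectSum.IsInternal (invariantsDeg K I) := by
  refine isInternal_of_proj (fun n => (invariantsDeg K I n).toAddSubgroup)
    (fun n => AddMonoidHom.codRestrict
      ((weightedHomogeneousComponent degTwo n).toAddMonoidHom.comp
        (invariants K I).val.toLinearMap.toAddMonoidHom) (invariants K I)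
      (fun f => component_mem_invariants n f.2)) ?_ ?_ ?_
  · intro n f hf
    exact Subtype.ext (IsWeightedHomogeneous.weightedHomogeneousComponent_same hf)
  · intro m n h f hf
    exact Subtype.ext (IsWeightedHomogeneous.weightedHomogeneousComponent_ne m hf h)
  · rw [eq_top_iff]
    rintro f -
    have hfin := weightedHomogeneousComponent_finsupp (w := degTwo) f.1
    have hf : f = ∑ n ∈ hfin.toFinset, (⟨weightedHomogeneousComponent degTwo n f.1,
        component_mem_invariants n f.2⟩ : invariants K I) := by
      refine Subtype.ext ?_
      rw [AddSubmonoidClass.coe_finsetSum]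
      exact (sum_weightedHomogeneousComponent degTwo f.1).symm.trans
        (finsum_eq_sum _ hfin)
    rw [hf]
    exact sum_mem fun n _ => AddSubgroup.mem_iSup_of_mem n
      (weightedHomogeneousComponent_isWeightedHomogeneous n f.1)

/-- The graded ring `R^I` of invariants. -/
def invRing (I : List ℕ) : GrAlg K where
  carrier := invariants K I
  deg := invariantsDeg K I
  graded :=
    { one_mem := isWeightedHomogeneous_one K degTwo
      mul_mem := fun _ _ _ _ hf hg => IsWeightedHomogeneous.mul hf hg
      toDecomposition := (invariantsDeg_isInternal K I).chooseDecomposition }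

variable {K}

theorem mem_invariantsDeg {I : List ℕ} {n : ℤ} (x : invariants K I) :
    x ∈ invariantsDeg K I n ↔ IsWeightedHomogeneous degTwo (x : MvPolynomial ℕ K) n := Iff.rfl

theorem inclusion_mem_deg {I J : List ℕ} (h : invariants K J ≤ invariants K I) {n : ℤ}
    {x : invariants K J} (hx : x ∈ invariantsDeg K J n) :
    Subalgebra.inclusion h x ∈ invariantsDeg K I n := by
  rw [mem_invariantsDeg] at hx ⊢
  rwa [Subalgebra.coe_inclusion]

/-- An inclusion of rings of invariants is a homomorphism of graded rings. -/
def inclHom {I J : List ℕ} (h : invariants K J ≤ invariants K I) :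
    GrAlg.Hom (invRing K J) (invRing K I) where
  toAlgHom := Subalgebra.inclusion h
  map_deg hx := inclusion_mem_deg h hx

/-- `I ⊆ J`: both tuples have the same sum, and there is an inclusion of parabolic subgroups. -/
def Refines (I J : List ℕ) : Prop := I.sum = J.sum ∧ parabolic I ≤ parabolic J

theorem Refines.invariants_le {I J : List ℕ} (h : Refines I J) :
    invariants K J ≤ invariants K I := fun f hf =>
  ⟨by rw [h.1]; exact hf.1, fun σ hσ => hf.2 σ (h.2 hσ)⟩

theorem refines_concat (p : List ℕ) (a b : ℕ) : Refines (p ++ [a] ++ [b]) (p ++ [a + b]) := by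
  have hs : (p ++ [a] ++ [b]).sum = (p ++ [a + b]).sum := by simp
  refine ⟨hs, fun σ hσ => ⟨fun i x => ?_, fun x hx => hσ.2 x (hs ▸ hx)⟩⟩
  by_cases hi : i ≤ p.length
  · have := hσ.1 i x
    rw [List.append_assoc, List.take_append_of_le_length hi] at this
    rw [List.take_append_of_le_length hi]
    exact this
  · have := hσ.1 (p.length + 2) x
    rw [List.take_of_length_le (by simp), hs] at this
    rwa [List.take_of_length_le (by simp; omega)]

theorem invariants_le_concat (p : List ℕ) (k : ℕ) :
    invariants K p ≤ invariants K (p ++ [k]) := by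
  intro f hf
  refine ⟨supported_mono (fun j (hj : j < p.sum) => ?_) hf.1, fun σ hσ => ?_⟩
  · simp only [Set.mem_ofPred_eq, List.sum_append]; omega
  · have hlt : ∀ x, σ x < p.sum ↔ x < p.sum := fun x => by
      have := hσ.1 p.length x
      rwa [List.take_left'  rfl] at this
    let τ : Equiv.Perm ℕ := Equiv.Perm.ofSubtype (σ.subtypePerm (p := fun x => x < p.sum) hlt)
    have hτ1 : ∀ x, x < p.sum → τ x = σ x := fun x hx => by
      exact Equiv.Perm.ofSubtype_apply_of_mem (σ.subtypePerm (p := fun x => x < p.sum) hlt) hx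
    have hτ2 : ∀ x, p.sum ≤ x → τ x = x := fun x hx =>
      Equiv.Perm.ofSubtype_apply_of_not_mem _ (by simpa using hx)
    have hτ : τ ∈ parabolic p := by
      refine ⟨fun i x => ?_, hτ2⟩
      by_cases hx : x < p.sum
      · rw [hτ1 x hx]
        by_cases hi : i ≤ p.length
        · have := hσ.1 i x
          rwa [List.take_append_of_le_length hi] at this
        · rw [List.take_of_length_le (by omega)]
          exact hlt x
      · rw [hτ2 x (by omega)]
    have hf2 := hf.2 τ hτ
    have hs := hf.1
    rw [supported_eq_range_rename] at hs
    obtain ⟨g, rfl⟩ := hs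
    have hc : (σ ∘ ((↑) : {j | j < p.sum} → ℕ)) = τ ∘ (↑) :=
      funext fun x => (hτ1 x x.2).symm
    refine Eq.trans ?_ hf2
    exact (rename_rename _ _ g).trans
      ((congrArg (fun u => rename u g) hc).trans (rename_rename _ _ g).symm)

/-- The elementary symmetric polynomial `e_i` in the alphabet `{x_j | j ∈ s}`. -/
def elemSymm (s : Finset ℕ) (i : ℕ) : MvPolynomial ℕ K :=
  ∑ t ∈ s.powersetCard i, ∏ j ∈ t, X j

theorem rename_elemSymm (s : Finset ℕ) (i : ℕ) (σ : Equiv.Perm ℕ)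
    (hs : s.map σ.toEmbedding = s) : rename σ (elemSymm (K := K) s i) = elemSymm s i := by
  conv_rhs => rw [← hs]
  simp [elemSymm, Finset.powersetCard_map]

/-- The alphabet of the last block of `p ++ [k]`. -/
def lastBlock (p : List ℕ) (k : ℕ) : Finset ℕ := Finset.Ico p.sum (p.sum + k)

theorem elemSymm_mem_invariants (p : List ℕ) (k i : ℕ) :
    elemSymm (lastBlock p k) i ∈ invariants K (p ++ [k]) := by
  have hsum : (p ++ [k]).sum = p.sum + k := by simp
  refine ⟨?_, fun σ hσ => rename_elemSymm _ _ σ ?_⟩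
  · refine sum_mem fun t ht => prod_mem fun j hj => ?_
    have := (Finset.mem_powersetCard.1 ht).1 hj
    rw [lastBlock, Finset.mem_Ico] at this
    exact X_mem_supported.2 (by rw [Set.mem_ofPred_eq, hsum]; exact this.2)
  · refine Finset.eq_of_subset_of_card_le (fun y hy => ?_) (by simp)
    obtain ⟨x, hx, rfl⟩ := Finset.mem_map.1 hy
    have h1 := hσ.1 p.length x
    have h2 := hσ.1 (p.length + 1) x
    rw [List.take_left' rfl] at h1
    rw [List.take_of_length_le (by simp), hsum] at h2
    rw [lastBlock, Finset.mem_Ico] at hx ⊢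
    change p.sum ≤ σ x ∧ σ x < p.sum + k
    omega

/-- `e_i` of the last alphabet, as an element of the ring of invariants. -/
def lastElem (p : List ℕ) (k i : ℕ) : invRing K (p ++ [k]) :=
  (⟨elemSymm (lastBlock p k) i, elemSymm_mem_invariants p k i⟩ : invariants K (p ++ [k]))

theorem lastElem_mem (p : List ℕ) (k i : ℕ) :
    lastElem p k i ∈ (invRing K (p ++ [k])).deg (2 * (i : ℤ)) := by
  change IsWeightedHomogeneous degTwo (elemSymm (K := K) (lastBlock p k) i) (2 * (i : ℤ))
  refine IsWeightedHomogeneous.sum _ _ _ fun t ht => ?_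
  have := IsWeightedHomogeneous.prod (w := degTwo) t (fun j => (X j : MvPolynomial ℕ K))
    (fun _ => 2) (fun j _ => isWeightedHomogeneous_X K degTwo j)
  rwa [Finset.sum_const, (Finset.mem_powersetCard.1 ht).2, nsmul_eq_mul, mul_comm] at this

/-- The length of the longest element of the parabolic subgroup of `I`: `∑ k_i (k_i - 1) / 2`. -/
def ell (I : List ℕ) : ℤ := (I.map fun k => (k.choose 2 : ℤ)).sum

/-- The split bimodule `R^I ⊗_{R^J} R^J`, i.e. `R^I` as an `R^I`-`R^J`-bimodule, for `I ⊆ J`.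
It is free over both rings, so tensoring with it needs no deriving; likewise for `merge`. -/
def split {I J : List ℕ} (h : Refines I J) : GrBimod (invRing K I) (invRing K J) :=
  (GrBimod.restrict (GrAlg.Hom.id _) (inclHom h.invariants_le)).obj (GrBimod.diag (invRing K I))

/-- The merge bimodule `q ^ (ℓ(I) - ℓ(J)) R^J ⊗_{R^J} R^I`, i.e. a shift of `R^I` as an
`R^J`-`R^I`-bimodule, for `I ⊆ J`. -/
def merge {I J : List ℕ} (h : Refines I J) : GrBimod (invRing K J) (invRing K I) :=
  (GrBimod.qShift _ _ (ell I - ell J)).obj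
    ((GrBimod.restrict (inclHom h.invariants_le) (GrAlg.Hom.id _)).obj
      (GrBimod.diag (invRing K I)))

/-- The colored partial Hochschild trace, closing the last strand, of color `k`:
`HOM(𝒦, M)` for the Koszul complex `𝒦` of the elements `e_i ⊗ 1 - 1 ⊗ e_i`, where `e_1, …, e_k` are
the elementary symmetric polynomials in the last alphabet, i.e. the iterated
cocone of the maps `e_i ⊗ 1 - 1 ⊗ e_i : M ⟶ q ^ (-2 i) M`, regarded as a complex of bimodules over
the ring of invariants of the tuple with the last entry removed. As `𝒦` is a free resolution, this
represents `RHom` out of the bimodule `(A ⊗ A) / (e_i ⊗ 1 - 1 ⊗ e_i)`, `A` being the ring of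
invariants of `p ++ [k]`. -/
def partialTrace (p : List ℕ) (k : ℕ)
    (M : CochainComplex (GrBimod (invRing K (p ++ [k])) (invRing K (p ++ [k]))) ℤ) :
    CochainComplex (GrBimod (invRing K p) (invRing K p)) ℤ :=
  ((GrBimod.restrict (inclHom (invariants_le_concat p k))
      (inclHom (invariants_le_concat p k))).mapHomologicalComplex (ComplexShape.up ℤ)).obj
    ((List.range k).foldr (fun i N =>
      CochainComplex.mappingCocone (GrBimod.commutatorChainMap (lastElem_mem p k (i + 1)) N)) M)

/-- Tensoring a complex of bimodules with a bimodule on the left. -/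
abbrev tensorLeftC {K : Type u} [Field K] {A B C : GrAlg K} (M : GrBimod A B)
    (N : CochainComplex (GrBimod B C) ℤ) : CochainComplex (GrBimod A C) ℤ :=
  ((GrBimod.tensorLeft M).mapHomologicalComplex (ComplexShape.up ℤ)).obj N

/-- Tensoring a complex of bimodules with a bimodule on the right. -/
abbrev tensorRightC {K : Type u} [Field K] {A B C : GrAlg K}
    (M : CochainComplex (GrBimod A B) ℤ) (N : GrBimod B C) : CochainComplex (GrBimod A C) ℤ :=
  ((GrBimod.tensorRight N).mapHomologicalComplex (ComplexShape.up ℤ)).obj M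

/-- The grading shift `q ^ s` of a complex of bimodules. -/
abbrev qShiftC {K : Type u} [Field K] {A B : GrAlg K} (s : ℤ)
    (M : CochainComplex (GrBimod A B) ℤ) : CochainComplex (GrBimod A B) ℤ :=
  ((GrBimod.qShift A B s).mapHomologicalComplex (ComplexShape.up ℤ)).obj M

end Web

end

/-! Write `D` for the ring of the merged tuple, `A` for the ring of the refined tuple and `f : D →
A` for the inclusion. By the fundamental theorem on symmetric functions, `A` is a polynomial ring
over the invariants of `p` in the elementary symmetric polynomials `t_i` of its last two blocks, and
`D` is one in the elementary symmetric polynomials `c_k` of the merged block. Since `∏ (T + x_j)`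
over the merged block is the product of the polynomials of the two blocks, `A = D[t] / (x)`, where
`x_k` is the coefficient of `T ^ k` in the product of two generic monic polynomials, minus its
prescribed value in `D` (`ker_eval₂Hom_twoBlockElem`).

For a `D`-`A`-bimodule `B`, the `D[t]`-`A`-bimodule `D[t] ⊗_D B` carries two families of commuting
operators: `X_i ⊗ 1 - 1 ⊗ t_i` and `x_k ⊗ 1`. Each family is a weakly regular sequence. Dividing by
the first gives `B`, on which `X_i` acts as right multiplication by `t_i`; dividing by the second
gives `A ⊗_D B`. An iterated cone over a weakly regular sequence is the quotient up to
quasi-isomorphism and grading shift (`coneList_qEquiv_of_isWeaklyRegular`), and cones over different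
operators commute (`Op.cone_cone`). Hence the cone over the first family on `A ⊗_D B` agrees, up to
a shift, with the cone over the second family on `B` (`coneList_leftReg_qEquiv`). The former is the
double trace of the split bimodule tensored with `B`. In the latter `x_k ⊗ 1` acts as `1 ⊗ f(c_k) -
c_k ⊗ 1`, the negative of the operator closing the merged strand, so the result is the trace of `B`
tensored with the split bimodule. Both families have `a + b` members, so the cohomological shifts
agree; the degrees of the relations exceed those of the variables by `2ab` in total.

Regularity of the first family is formal. That of the second holds for every coefficient module
because it is pulled back, along a flat map, from the regular sequence `s_k - c_k`
(`isWeaklyRegular_coeffMul_sub`). The flatness is that of the universal factorization of a monic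
polynomial into two monic factors, which is a module retract of a splitting algebra, and the latter
is free (`Polynomial.flat_of_universal_factorization`).

The statement for the merge bimodule follows by interchanging left and right actions: this turns
merge into split, up to a shift, and changes only the sign of the closing operators. -/

noncomputable section

/-! ### Homogeneous elements acting on bimodules, their cones, and restriction of scalars -/

namespace GrBimod
variable {K : Type u} [Field K] {A B C A' B' A'' B'' : GrAlg K}

/-- The degree `n` part of `A ⊗[K] B`. -/
def actDeg (A B : GrAlg K) (n : ℤ) : AddSubgroup (A ⊗[K] B) :=
  AddSubgroup.closure {t | ∃ (i j : ℤ) (a : A) (b : B), a ∈ A.deg i ∧ b ∈ B.deg j ∧ i + j = n ∧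
    t = a ⊗ₜ[K] b}

theorem tmul_mem_actDeg {i j n : ℤ} {a : A} {b : B} (ha : a ∈ A.deg i) (hb : b ∈ B.deg j)
    (h : i + j = n) : a ⊗ₜ[K] b ∈ actDeg A B n :=
  AddSubgroup.subset_closure ⟨i, j, a, b, ha, hb, h, rfl⟩

theorem actDeg_smul_mem (M : GrBimod A B) {d n : ℤ} {z : A ⊗[K] B} (hz : z ∈ actDeg A B d) {x : M}
    (hx : x ∈ M.deg n) : z • x ∈ M.deg (d + n) := by
  induction hz using AddSubgroup.closure_induction with
  | mem t ht =>
    obtain ⟨i, j, a, b, ha, hb, rfl, rfl⟩ := ht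
    exact M.smul_mem ha hb hx
  | zero => rw [zero_smul]; exact zero_mem _
  | add s t _ _ hs ht => rw [add_smul]; exact add_mem hs ht
  | neg t _ ht => rw [neg_smul]; exact neg_mem ht

theorem mul_mem_actDeg {i j : ℤ} {s t : A ⊗[K] B} (hs : s ∈ actDeg A B i)
    (ht : t ∈ actDeg A B j) : s * t ∈ actDeg A B (i + j) := by
  induction hs using AddSubgroup.closure_induction with
  | mem s hs =>
    obtain ⟨k, l, a, b, ha, hb, rfl, rfl⟩ := hs
    induction ht using AddSubgroup.closure_induction with
    | mem t ht =>
      obtain ⟨k', l', a', b', ha', hb', rfl, rfl⟩ := ht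
      rw [Algebra.TensorProduct.tmul_mul_tmul]
      exact tmul_mem_actDeg (SetLike.GradedMul.mul_mem ha ha')
        (SetLike.GradedMul.mul_mem hb hb') (by ring)
    | zero => rw [mul_zero]; exact zero_mem _
    | add s t _ _ hs ht => rw [mul_add]; exact add_mem hs ht
    | neg t _ ht => rw [mul_neg]; exact neg_mem ht
  | zero => rw [zero_mul]; exact zero_mem _
  | add s t _ _ hs ht => rw [add_mul]; exact add_mem hs ht
  | neg t _ ht => rw [neg_mul]; exact neg_mem ht

theorem one_mem_actDeg : (1 : A ⊗[K] B) ∈ actDeg A B 0 :=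
  tmul_mem_actDeg SetLike.GradedOne.one_mem SetLike.GradedOne.one_mem (add_zero 0)

variable (A B) in
/-- A homogeneous element of `A ⊗[K] B`, which acts on all graded bimodules. -/
structure Op where
  /-- the element -/
  elt : A ⊗[K] B
  /-- the degree -/
  deg : ℤ
  mem : elt ∈ actDeg A B deg

/-- The action of a homogeneous element. -/
def Op.map (z : Op A B) (M : GrBimod A B) : M ⟶ (qShift A B (-z.deg)).obj M where
  lin := LinearMap.lsmul (A ⊗[K] B) M z.elt
  map_deg {n x} hx := by
    have := M.actDeg_smul_mem z.mem hx
    rwa [show z.deg + n = n - -z.deg by ring] at this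

theorem Op.map_naturality (z : Op A B) {M N : GrBimod A B} (f : M ⟶ N) :
    f ≫ z.map N = z.map M ≫ (qShift A B (-z.deg)).map f := by
  ext x
  exact (f.lin.map_smul _ x).symm

variable (A B) in
/-- The grading shift of complexes. -/
abbrev qC (s : ℤ) : CochainComplex (GrBimod A B) ℤ ⥤ CochainComplex (GrBimod A B) ℤ :=
  (qShift A B s).mapHomologicalComplex (ComplexShape.up ℤ)

/-- The action of a homogeneous element on complexes. -/
def Op.chainMap (z : Op A B) (X : CochainComplex (GrBimod A B) ℤ) :
    X ⟶ (qC A B (-z.deg)).obj X where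
  f i := z.map (X.X i)
  comm' _ _ _ := (z.map_naturality _).symm

theorem Op.chainMap_naturality (z : Op A B) {X Y : CochainComplex (GrBimod A B) ℤ} (f : X ⟶ Y) :
    z.chainMap X ≫ (qC A B (-z.deg)).map f = f ≫ z.chainMap Y := by
  ext1 i
  exact (z.map_naturality _).symm

/-- The mapping cone of the action of a homogeneous element. -/
abbrev Op.cone (z : Op A B) (X : CochainComplex (GrBimod A B) ℤ) :
    CochainComplex (GrBimod A B) ℤ := CochainComplex.mappingCone (z.chainMap X)

/-- The functoriality of the cone. -/
abbrev Op.coneMap (z : Op A B) {X Y : CochainComplex (GrBimod A B) ℤ} (f : X ⟶ Y) :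
    z.cone X ⟶ z.cone Y :=
  CochainComplex.mappingCone.map _ _ f ((qC A B (-z.deg)).map f) (z.chainMap_naturality f)

variable (A B A' B') in
/-- A homomorphism of graded algebras `A' ⊗[K] B' → A ⊗[K] B`. -/
structure ActHom where
  /-- the underlying algebra homomorphism -/
  toAlgHom : A' ⊗[K] B' →ₐ[K] A ⊗[K] B
  tmul_mem {i j : ℤ} {a : A'} {b : B'} : a ∈ A'.deg i → b ∈ B'.deg j →
    toAlgHom (a ⊗ₜ[K] b) ∈ actDeg A B (i + j)

theorem ActHom.map_mem (ψ : ActHom A B A' B') {n : ℤ} {t : A' ⊗[K] B'} (ht : t ∈ actDeg A' B' n) :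
    ψ.toAlgHom t ∈ actDeg A B n := by
  induction ht using AddSubgroup.closure_induction with
  | mem t ht =>
    obtain ⟨k, l, a, b, ha, hb, rfl, rfl⟩ := ht
    exact ψ.tmul_mem ha hb
  | zero => rw [map_zero]; exact zero_mem _
  | add s t _ _ hs ht => rw [map_add]; exact add_mem hs ht
  | neg t _ ht => rw [map_neg]; exact neg_mem ht

/-- Restriction of scalars along a homomorphism of graded algebras. -/
def pullObj (ψ : ActHom A B A' B') (M : GrBimod A B) : GrBimod A' B' where
  carrier := M
  module := Module.compHom M ψ.toAlgHom.toRingHom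
  deg := M.deg
  isInternal := M.isInternal
  smul_mem ha hb hx := M.actDeg_smul_mem (ψ.tmul_mem ha hb) hx

/-- Restriction of scalars along a homomorphism of graded algebras, as a functor. -/
def pull (ψ : ActHom A B A' B') : GrBimod A B ⥤ GrBimod A' B' where
  obj := pullObj ψ
  map {M N} h :=
    { lin :=
      { toFun := h.lin
        map_add' := h.lin.map_add
        map_smul' := fun c x => h.lin.map_smul (ψ.toAlgHom c) x }
      map_deg := h.map_deg }

instance (ψ : ActHom A B A' B') : (pull ψ).Additive where

/-- Restriction of complexes. -/
abbrev pullC (ψ : ActHom A B A' B') :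
    CochainComplex (GrBimod A B) ℤ ⥤ CochainComplex (GrBimod A' B') ℤ :=
  (pull ψ).mapHomologicalComplex (ComplexShape.up ℤ)

/-- The homomorphism attached to a pair of homomorphisms. -/
def ActHom.ofHoms (f : GrAlg.Hom A' A) (g : GrAlg.Hom B' B) : ActHom A B A' B' where
  toAlgHom := Algebra.TensorProduct.map f.toAlgHom g.toAlgHom
  tmul_mem ha hb := tmul_mem_actDeg (f.map_deg ha) (g.map_deg hb) rfl

/-- Composition. -/
def ActHom.comp (ψ : ActHom A B A' B') (φ : ActHom A' B' A'' B'') : ActHom A B A'' B'' where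
  toAlgHom := ψ.toAlgHom.comp φ.toAlgHom
  tmul_mem ha hb := ψ.map_mem (φ.tmul_mem ha hb)

/-- The flip. -/
def ActHom.flip (A B : GrAlg K) : ActHom A B B A where
  toAlgHom := (Algebra.TensorProduct.comm K B A).toAlgHom
  tmul_mem {i j} _ _ ha hb := tmul_mem_actDeg hb ha (add_comm j i)

/-- The image of a homogeneous element. -/
def Op.push (ψ : ActHom A B A' B') (z : Op A' B') : Op A B := ⟨ψ.toAlgHom z.elt, z.deg,
    ψ.map_mem z.mem⟩

/-- The homogeneous element `r ⊗ 1 - 1 ⊗ r`. -/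
def Op.comm {r : A} {d : ℤ} (hr : r ∈ A.deg d) : Op A A where
  elt := r ⊗ₜ[K] 1 - 1 ⊗ₜ[K] r
  deg := d
  mem := sub_mem (tmul_mem_actDeg hr SetLike.GradedOne.one_mem (add_zero d))
    (tmul_mem_actDeg SetLike.GradedOne.one_mem hr (zero_add d))

/-! ### Exactness -/

theorem mono_of_injective {M N : GrBimod A B} (f : M ⟶ N) (h : Function.Injective f.lin) :
    Mono f := by
  rw [Preadditive.mono_iff_cancel_zero]
  intro P g hg
  ext x
  apply h
  rw [zero_lin, map_zero, ← comp_lin, hg, zero_lin]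

theorem epi_of_surjective {M N : GrBimod A B} (f : M ⟶ N) (h : Function.Surjective f.lin) :
    Epi f := by
  rw [Preadditive.epi_iff_cancel_zero]
  intro P g hg
  ext x
  obtain ⟨x, rfl⟩ := h x
  rw [← comp_lin, hg, zero_lin, zero_lin]

theorem isIso_of_bijective {M N : GrBimod A B} (f : M ⟶ N) (h : Function.Bijective f.lin) :
    IsIso f := by
  have := mono_of_injective f h.1
  have := epi_of_surjective f h.2
  exact isIso_of_mono_of_epi f

/-- The kernels and cokernels of graded bimodules are the module-theoretic ones with induced
gradings, so the explicit left homology data reduces exactness to surjectivity onto the kernel. -/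
theorem exact_iff (S : ShortComplex (GrBimod A B)) :
    S.Exact ↔ Function.Exact S.f.lin S.g.lin := by
  let l : S.X₁ ⟶ ker S.g := (kerIsLimit S.g).lift (KernelFork.ofι S.f S.zero)
  let h : S.LeftHomologyData :=
    { K := ker S.g
      H := coker l
      i := kerι S.g
      π := cokerπ l
      wi := kerι_comp S.g
      hi := kerIsLimit S.g
      wπ := comp_cokerπ l
      hπ := cokerIsColimit l }
  have hl : ∀ x, (l.lin x : ker S.g).1 = S.f.lin x := fun x => rfl
  rw [h.exact_iff_epi_f']
  constructor
  · intro he y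
    constructor
    · intro hy
      obtain ⟨x, hx⟩ := @surjective_of_epi _ _ _ _ _ _ l he (⟨y, hy⟩ : LinearMap.ker S.g.lin)
      exact ⟨x, congrArg Subtype.val hx⟩
    · rintro ⟨x, rfl⟩
      rw [← comp_lin, S.zero, zero_lin]
  · intro he
    refine epi_of_surjective l fun y => ?_
    obtain ⟨x, hx⟩ := (he y.1).1 y.2
    exact ⟨x, Subtype.ext hx⟩

theorem shortExact_of_function {S : ShortComplex (GrBimod A B)} (hf : Function.Injective S.f.lin)
    (hg : Function.Surjective S.g.lin) (h : Function.Exact S.f.lin S.g.lin) : S.ShortExact where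
  exact := (exact_iff S).2 h
  mono_f := mono_of_injective _ hf
  epi_g := epi_of_surjective _ hg

/-- Restriction leaves the underlying maps unchanged, and exactness is seen on those maps. This is
what lets zigzags of quasi-isomorphisms be restricted. -/
instance (ψ : ActHom A B A' B') : (pull ψ).PreservesHomology :=
  Functor.preservesHomology_of_map_exact _ fun S hS =>
    (exact_iff (S.map (pull ψ))).2 ((exact_iff S).1 hS)

instance (s : ℤ) : (qShift A B s).PreservesHomology :=
  Functor.preservesHomology_of_map_exact _ fun S hS =>
    (exact_iff (S.map (qShift A B s))).2 ((exact_iff S).1 hS)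

/-- An isomorphism of graded bimodules from a bijective bimodule map. -/
def isoOfBijective {M N : GrBimod A B} (f : M ⟶ N) (h : Function.Bijective f.lin) : M ≅ N :=
  letI := isIso_of_bijective f h
  asIso f

end GrBimod

/-! ### Mapping cones of commutative squares -/

namespace CochainComplex.mappingCone

open HomComplex

variable {C : Type*} [Category* C] [Preadditive C] [HasBinaryBiproducts C]
  {K L K' L' : CochainComplex C ℤ} (φ : K ⟶ L) (φ' : K' ⟶ L') (a : K ⟶ K') (b : L ⟶ L')
  (comm : φ ≫ b = a ≫ φ')

theorem inl_v_map_f (p q : ℤ) (h : p + -1 = q) :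
    (inl φ).v p q h ≫ (map φ φ' a b comm).f q = a.f p ≫ (inl φ').v p q h := by
  simp [map]

theorem inr_f_map_f (p : ℤ) :
    (inr φ).f p ≫ (map φ φ' a b comm).f p = b.f p ≫ (inr φ').f p := by
  simp [map]

theorem inl_v_map_f_assoc (p q : ℤ) (h : p + -1 = q) {Z : C} (g : (mappingCone φ').X q ⟶ Z) :
    (inl φ).v p q h ≫ (map φ φ' a b comm).f q ≫ g = a.f p ≫ (inl φ').v p q h ≫ g := by
  rw [← Category.assoc, inl_v_map_f, Category.assoc]

theorem inr_f_map_f_assoc (p : ℤ) {Z : C} (g : (mappingCone φ').X p ⟶ Z) :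
    (inr φ).f p ≫ (map φ φ' a b comm).f p ≫ g = b.f p ≫ (inr φ').f p ≫ g := by
  rw [← Category.assoc, inr_f_map_f, Category.assoc]

/-- The component in degree `n` of the exchange morphism of the double mapping cone. -/
def exchangeX (n m l : ℤ) (h : n + 1 = m) (h' : m + 1 = l) :
    (mappingCone (map φ φ' a b comm)).X n ⟶ (mappingCone (map a b φ φ' comm.symm)).X n :=
  -- The sign falls on the summand `K`, in degree `n + 2`, the only one moved by both cone
  -- constructions: exchanging two shifts of odd degree costs a sign.
  -((fst (map φ φ' a b comm)).1.v n m h ≫ (fst φ).1.v m l h' ≫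
      (inl a).v l m (by lia) ≫ (inl (map a b φ φ' comm.symm)).v m n (by lia)) +
    (fst (map φ φ' a b comm)).1.v n m h ≫ (snd φ).v m m (add_zero _) ≫
      (inl b).v m n (by lia) ≫ (inr (map a b φ φ' comm.symm)).f n +
    (snd (map φ φ' a b comm)).v n n (add_zero n) ≫ (fst φ').1.v n m h ≫
      (inr a).f m ≫ (inl (map a b φ φ' comm.symm)).v m n (by lia) +
    (snd (map φ φ' a b comm)).v n n (add_zero n) ≫ (snd φ').v n n (add_zero n) ≫
      (inr b).f n ≫ (inr (map a b φ φ' comm.symm)).f n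

theorem exchangeX_exchangeX (n m l : ℤ) (h : n + 1 = m) (h' : m + 1 = l) :
    exchangeX φ φ' a b comm n m l h h' ≫ exchangeX a b φ φ' comm.symm n m l h h' = 𝟙 _ := by
  simp [exchangeX, ext_from_iff _ m n h, ext_from_iff _ l m h']

theorem exchangeX_comm (n m l k : ℤ) (h : n + 1 = m) (h' : m + 1 = l) (h'' : l + 1 = k) :
    exchangeX φ φ' a b comm n m l h h' ≫ (mappingCone (map a b φ φ' comm.symm)).d n m =
      (mappingCone (map φ φ' a b comm)).d n m ≫ exchangeX φ φ' a b comm m l k h' h'' := by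
  have h1 : m + -1 = n := by lia
  have h2 : l + -1 = m := by lia
  have h3 : k + -1 = l := by lia
  -- The double cone has the four corners of the square as summands, and compatibility with the
  -- differentials is checked on each.
  rw [ext_from_iff _ m n h, ext_from_iff φ l m h', ext_from_iff φ' m n h]
  refine ⟨⟨?_, ?_⟩, ?_, ?_⟩
  all_goals
    simp [exchangeX, inl_v_map_f_assoc, inr_f_map_f_assoc,
      inl_v_d_assoc _ m n l h1 h2, inl_v_d_assoc _ l m k h2 h3, inl_v_d _ m n l h1 h2]
  all_goals abel

/-- The two iterated mapping cones of a commutative square are isomorphic. -/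
def exchange : mappingCone (map φ φ' a b comm) ≅ mappingCone (map a b φ φ' comm.symm) :=
  HomologicalComplex.Hom.isoOfComponents
    (fun n => ⟨exchangeX φ φ' a b comm n _ _ rfl rfl, exchangeX a b φ φ' comm.symm n _ _ rfl rfl,
      exchangeX_exchangeX _ _ _ _ _ _ _ _ _ _, exchangeX_exchangeX _ _ _ _ _ _ _ _ _ _⟩)
    (by rintro i _ rfl; exact exchangeX_comm _ _ _ _ _ _ _ _ _ _ _ _)

/-- Isomorphic morphisms have isomorphic mapping cones. -/
def mapIso {K L K' L' : CochainComplex C ℤ} (φ : K ⟶ L) (φ' : K' ⟶ L') (a : K ≅ K') (b : L ≅ L')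
    (comm : φ ≫ b.hom = a.hom ≫ φ') : mappingCone φ ≅ mappingCone φ' where
  hom := map φ φ' a.hom b.hom comm
  inv := map φ' φ a.inv b.inv (by rw [Iso.comp_inv_eq, Category.assoc, Iso.eq_inv_comp, comm])
  hom_inv_id := by
    rw [← map_comp]
    simp only [Iso.hom_inv_id]
    exact map_id φ
  inv_hom_id := by
    rw [← map_comp]
    simp only [Iso.inv_hom_id]
    exact map_id φ'

end CochainComplex.mappingCone

namespace CochainComplex.mappingCone
variable {C : Type*} [Category* C] [Abelian C]

/-- In the derived category this is the third component of a morphism of distinguished triangles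
whose other two components are isomorphisms. -/
theorem quasiIso_map {K L K' L' : CochainComplex C ℤ} (φ : K ⟶ L) (φ' : K' ⟶ L') (a : K ⟶ K')
    (b : L ⟶ L') (comm : φ ≫ b = a ≫ φ') [QuasiIso a] [QuasiIso b] :
    QuasiIso (map φ φ' a b comm) := by
  let := HasDerivedCategory.standard C
  rw [← DerivedCategory.isIso_Q_map_iff_quasiIso]
  exact Pretriangulated.isIso₃_of_isIso₁₂
    (DerivedCategory.Q.mapTriangle.map (triangleMap φ φ' a b comm))
    (DerivedCategory.mappingCone_triangle_distinguished φ)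
    (DerivedCategory.mappingCone_triangle_distinguished φ')
    (inferInstanceAs (IsIso (DerivedCategory.Q.map a)))
    (inferInstanceAs (IsIso (DerivedCategory.Q.map b)))

end CochainComplex.mappingCone

/-- Two complexes are related by a zigzag of quasi-isomorphisms. -/
def QEquiv {C : Type*} [Category* C] [Abelian C] (X Y : CochainComplex C ℤ) : Prop :=
  Relation.EqvGen (fun X Y => ∃ f : X ⟶ Y, QuasiIso f) X Y

/-! ### Zigzags of quasi-isomorphisms -/

namespace QEquiv
variable {C D : Type*} [Category* C] [Abelian C] [Category* D] [Abelian D]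
  {X Y Z : CochainComplex C ℤ}

theorem refl (X : CochainComplex C ℤ) : QEquiv X X := Relation.EqvGen.refl _
theorem symm (h : QEquiv X Y) : QEquiv Y X := Relation.EqvGen.symm _ _ h
theorem trans (h : QEquiv X Y) (h' : QEquiv Y Z) : QEquiv X Z := Relation.EqvGen.trans _ _ _ h h'
theorem of_quasiIso (f : X ⟶ Y) [hf : QuasiIso f] : QEquiv X Y := Relation.EqvGen.rel _ _ ⟨f, hf⟩
theorem of_iso (e : X ≅ Y) : QEquiv X Y := of_quasiIso e.hom
theorem of_nonempty_iso (h : Nonempty (X ≅ Y)) : QEquiv X Y := of_iso h.some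

/-- Only a function on objects is asked for, so an operation on complexes passes through zigzags
without being made into a functor on derived categories. -/
theorem lift (F : CochainComplex C ℤ → CochainComplex D ℤ)
    (hF : ∀ (X Y : CochainComplex C ℤ) (f : X ⟶ Y), QuasiIso f → QEquiv (F X) (F Y))
    (h : QEquiv X Y) : QEquiv (F X) (F Y) := by
  induction h with
  | rel x y h => obtain ⟨f, hf⟩ := h; exact hF _ _ f hf
  | refl x => exact refl _
  | symm x y _ ih => exact ih.symm
  | trans x y z _ _ ih ih' => exact ih.trans ih'

theorem map (F : C ⥤ D) [F.Additive] [F.PreservesHomology] (h : QEquiv X Y) :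
    QEquiv ((F.mapHomologicalComplex (ComplexShape.up ℤ)).obj X)
      ((F.mapHomologicalComplex (ComplexShape.up ℤ)).obj Y) :=
  lift _ (fun _ _ f _ => of_quasiIso ((F.mapHomologicalComplex (ComplexShape.up ℤ)).map f)) h

theorem shift (n : ℤ) (h : QEquiv X Y) : QEquiv (X⟦n⟧) (Y⟦n⟧) :=
  lift (fun X => X⟦n⟧) (fun _ _ f _ => of_quasiIso (f⟦n⟧')) h

theorem nonempty_iso [HasDerivedCategory.{w} C] (h : QEquiv X Y) :
    Nonempty (DerivedCategory.Q.obj X ≅ DerivedCategory.Q.obj Y) := by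
  induction h with
  | rel x y h => obtain ⟨f, hf⟩ := h; exact ⟨asIso (DerivedCategory.Q.map f)⟩
  | refl x => exact ⟨Iso.refl _⟩
  | symm x y _ ih => exact ⟨ih.some.symm⟩
  | trans x y z _ _ ih ih' => exact ⟨ih.some ≪≫ ih'.some⟩

end QEquiv

/-! ### Iterated cones and functors compatible with the operators -/

namespace GrBimod
variable {K : Type u} [Field K] {A B C A' B' A'' B'' : GrAlg K}

theorem Op.cone_qEquiv (z : Op A B) {X Y : CochainComplex (GrBimod A B) ℤ} (h : QEquiv X Y) :
    QEquiv (z.cone X) (z.cone Y) := by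
  refine QEquiv.lift (fun X => z.cone X) (fun X Y f _ => ?_) h
  have : QuasiIso (z.coneMap f) := CochainComplex.mappingCone.quasiIso_map _ _ _ _ _
  exact QEquiv.of_quasiIso (z.coneMap f)

/-- The iterated mapping cone; the head of the list is the innermost one. -/
def coneList (zs : List (Op A B)) (X : CochainComplex (GrBimod A B) ℤ) :
    CochainComplex (GrBimod A B) ℤ := zs.foldl (fun Y z => z.cone Y) X

theorem coneList_qEquiv (zs : List (Op A B)) {X Y : CochainComplex (GrBimod A B) ℤ}
    (h : QEquiv X Y) : QEquiv (coneList zs X) (coneList zs Y) := by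
  induction zs generalizing X Y with
  | nil => exact h
  | cons z zs ih => exact ih (z.cone_qEquiv h)

/-- Isomorphic complexes have isomorphic cones. -/
def Op.coneIso (z : Op A B) {X Y : CochainComplex (GrBimod A B) ℤ} (e : X ≅ Y) :
    z.cone X ≅ z.cone Y :=
  CochainComplex.mappingCone.mapIso _ _ e ((qC A B (-z.deg)).mapIso e) (z.chainMap_naturality e.hom)

theorem coneList_iso (zs : List (Op A B)) {X Y : CochainComplex (GrBimod A B) ℤ}
    (h : Nonempty (X ≅ Y)) : Nonempty (coneList zs X ≅ coneList zs Y) := by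
  induction zs generalizing X Y with
  | nil => exact h
  | cons z zs ih => exact ih ⟨z.coneIso h.some⟩

/-- A functor is compatible with the actions of two homogeneous elements. -/
def Intertwines (F : GrBimod A B ⥤ GrBimod A' B') (z : Op A B) (z' : Op A' B') : Prop :=
  ∃ θ : qShift A B (-z.deg) ⋙ F ≅ F ⋙ qShift A' B' (-z'.deg),
    ∀ M, F.map (z.map M) ≫ θ.hom.app M = z'.map (F.obj M)

/-- An additive functor commutes with mapping cones, and `θ` identifies the image of the action of
`z` with the action of `z'`, shifted target included. -/
theorem Intertwines.cone {F : GrBimod A B ⥤ GrBimod A' B'} [F.Additive] {z : Op A B}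
    {z' : Op A' B'} (h : Intertwines F z z') (X : CochainComplex (GrBimod A B) ℤ) :
    Nonempty ((F.mapHomologicalComplex (ComplexShape.up ℤ)).obj (z.cone X) ≅
      z'.cone ((F.mapHomologicalComplex (ComplexShape.up ℤ)).obj X)) := by
  obtain ⟨θ, hθ⟩ := h
  refine ⟨CochainComplex.mappingCone.mapHomologicalComplexIso _ F ≪≫
    CochainComplex.mappingCone.mapIso _ _ (Iso.refl _)
      ((NatIso.mapHomologicalComplex θ (ComplexShape.up ℤ)).app X) ?_⟩
  ext1 i
  exact (hθ (X.X i)).trans (Category.id_comp _).symm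

theorem Intertwines.coneList {F : GrBimod A B ⥤ GrBimod A' B'} [F.Additive] {zs : List (Op A B)}
    {zs' : List (Op A' B')} (h : List.Forall₂ (Intertwines F) zs zs')
    (X : CochainComplex (GrBimod A B) ℤ) :
    Nonempty ((F.mapHomologicalComplex (ComplexShape.up ℤ)).obj (coneList zs X) ≅
      coneList zs' ((F.mapHomologicalComplex (ComplexShape.up ℤ)).obj X)) := by
  induction h generalizing X with
  | nil => exact ⟨Iso.refl _⟩
  | @cons z z' zs zs' h _ ih =>
    exact ⟨(ih (z.cone X)).some ≪≫ (coneList_iso zs' (h.cone X)).some⟩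

/-- Two shifts with the same total degree agree. -/
def qShiftIso {s t s' t' : ℤ} (h : s + t = s' + t') :
    qShift A B s ⋙ qShift A B t ≅ qShift A B s' ⋙ qShift A B t' :=
  have h1 {M : GrBimod A B} {n : ℤ} {x : M} : x ∈ M.deg (n - t - s) ↔ x ∈ M.deg (n - t' - s') := by
    rw [show n - t - s = n - t' - s' by lia]
  NatIso.ofComponents (fun M =>
    { hom := ⟨LinearMap.id, h1.1⟩
      inv := ⟨LinearMap.id, h1.2⟩
      hom_inv_id := rfl
      inv_hom_id := rfl }) (fun _ => rfl)

/-- Composition of shifts. -/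
def qShiftAdd {s t r : ℤ} (h : s + t = r) : qShift A B s ⋙ qShift A B t ≅ qShift A B r :=
  have h1 {M : GrBimod A B} {n : ℤ} {x : M} : x ∈ M.deg (n - t - s) ↔ x ∈ M.deg (n - r) := by
    rw [show n - t - s = n - r by lia]
  NatIso.ofComponents (fun M =>
    { hom := ⟨LinearMap.id, h1.1⟩
      inv := ⟨LinearMap.id, h1.2⟩
      hom_inv_id := rfl
      inv_hom_id := rfl }) (fun _ => rfl)

/-- The shift by zero. -/
def qShiftZero : qShift A B 0 ≅ 𝟭 _ :=
  have h1 {M : GrBimod A B} {n : ℤ} {x : M} : x ∈ M.deg (n - 0) ↔ x ∈ M.deg n := by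
    rw [sub_zero]
  NatIso.ofComponents (fun M =>
    { hom := ⟨LinearMap.id, h1.1⟩
      inv := ⟨LinearMap.id, h1.2⟩
      hom_inv_id := rfl
      inv_hom_id := rfl }) (fun _ => rfl)

theorem intertwines_qShift (s : ℤ) (z : Op A B) : Intertwines (qShift A B s) z z :=
  ⟨qShiftIso (add_comm _ _), fun _ => rfl⟩

theorem intertwines_pull (ψ : ActHom A B A' B') (z : Op A' B') :
    Intertwines (pull ψ) (z.push ψ) z :=
  ⟨Iso.refl _, fun _ => rfl⟩

/-- Multiplication by `-1` on the target is an isomorphism, so a sign in the operator does not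
affect the cone. Commutators `r ⊗ 1 - 1 ⊗ r` will appear with their two terms interchanged. -/
theorem intertwines_pull_of_eq_neg (ψ : ActHom A B A' B') (z : Op A' B') (z' : Op A B)
    (h : ψ.toAlgHom z.elt = -z'.elt) (hd : z.deg = z'.deg) : Intertwines (pull ψ) z' z := by
  let e : ∀ M : GrBimod A B, (pull ψ).obj ((qShift A B (-z'.deg)).obj M) ≅
      (qShift A' B' (-z.deg)).obj ((pull ψ).obj M) := fun M =>
    have h1 {n : ℤ} {x : M} (hx : x ∈ M.deg (n - -z'.deg)) : -x ∈ M.deg (n - -z.deg) := by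
      rw [hd]; exact neg_mem hx
    have h2 {n : ℤ} {x : M} (hx : x ∈ M.deg (n - -z.deg)) : -x ∈ M.deg (n - -z'.deg) := by
      rw [← hd]; exact neg_mem hx
    { hom := ⟨-LinearMap.id, h1⟩
      inv := ⟨-LinearMap.id, h2⟩
      hom_inv_id := hom_ext fun x => neg_neg (x : M)
      inv_hom_id := hom_ext fun x => neg_neg (x : M) }
  refine ⟨NatIso.ofComponents e (fun {M N} f => hom_ext fun x => ?_), fun M => hom_ext fun x => ?_⟩
  · exact (map_neg f.lin (x : M)).symm
  · have (y : M) : -(z'.elt • y) = ψ.toAlgHom z.elt • y := by rw [h, neg_smul]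
    exact this x

end GrBimod

theorem CochainComplex.mappingCone.inl_v_mapHomologicalComplexIso {C D : Type*} [Category* C]
    [Category* D] [Preadditive C] [Preadditive D] [HasBinaryBiproducts C] [HasBinaryBiproducts D]
    {X Y : CochainComplex C ℤ} (φ : X ⟶ Y) (H : C ⥤ D) [H.Additive] (m n : ℤ) (h : m + -1 = n) :
    H.map ((inl φ).v m n h) ≫ (mapHomologicalComplexIso φ H).hom.f n =
      (inl ((H.mapHomologicalComplex (ComplexShape.up ℤ)).map φ)).v m n h := by
  have e : (mapHomologicalComplexIso φ H).hom.f n =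
    (mapHomologicalComplexXIso' φ H n m (by lia)).hom :=
    congrArg Iso.hom (mapHomologicalComplexXIso_eq φ H n m (by lia))
  have h1 : H.map ((inl φ).v m n h) ≫ H.map ((fst φ).1.v n m (by lia)) = 𝟙 _ := by
    rw [← H.map_comp, inl_v_fst_v, H.map_id]
  have h2 : H.map ((inl φ).v m n h) ≫ H.map ((snd φ).v n n (add_zero n)) = 0 := by
    rw [← H.map_comp, inl_v_snd_v, H.map_zero]
  rw [e, mapHomologicalComplexXIso'_hom]
  refine (Preadditive.comp_add _ _ _ _ _ _).trans ((congrArg₂ (· + ·)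
    ((Category.assoc _ _ _).symm.trans (congrArg (· ≫ _) h1))
    ((Category.assoc _ _ _).symm.trans (congrArg (· ≫ _) h2))).trans ?_)
  exact (congrArg₂ (· + ·) (Category.id_comp _) Limits.zero_comp).trans (add_zero _)

theorem CochainComplex.mappingCone.map_congr {C : Type*} [Category* C] [Preadditive C]
    [HasBinaryBiproducts C] {K L K' L' : CochainComplex C ℤ} {φ : K ⟶ L} {φ' : K' ⟶ L'}
    {a a' : K ⟶ K'} {b b' : L ⟶ L'} (ha : a = a') (hb : b = b') (h : φ ≫ b = a ≫ φ')
    (h' : φ ≫ b' = a' ≫ φ') : map φ φ' a b h = map φ φ' a' b' h' := by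
  subst ha hb
  rfl

namespace GrBimod
variable {K : Type u} [Field K] {A B C A' B' A'' B'' : GrAlg K}

/-! ### Commuting cones -/

open CochainComplex CochainComplex.mappingCone in
-- The action of `z` is natural in the bimodule, in particular for the inclusions of the two
-- summands of the cone. Thus acting on a cone is the same as acting on its source and target, which
-- turns an iterated cone into the cone of a square.
theorem Op.cone_chainMap (z : Op A B) {X Y : CochainComplex (GrBimod A B) ℤ} (φ : X ⟶ Y) :
    z.chainMap (mappingCone φ) ≫ (mapHomologicalComplexIso φ (qShift A B (-z.deg))).hom =
      CochainComplex.mappingCone.map φ ((qC A B (-z.deg)).map φ) (z.chainMap X) (z.chainMap Y)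
        (z.chainMap_naturality φ).symm := by
  ext1 n
  rw [ext_from_iff _ (n + 1) n rfl]
  constructor
  · rw [inl_v_map_f, HomologicalComplex.comp_f]
    have h := z.map_naturality ((inl φ).v (n + 1) n (by lia))
    refine ((Category.assoc _ _ _).symm.trans (congrArg (· ≫ _) h)).trans ?_
    refine (Category.assoc _ _ _).trans (congrArg (_ ≫ ·) ?_)
    exact inl_v_mapHomologicalComplexIso φ (qShift A B (-z.deg)) (n + 1) n (by lia)
  · rw [inr_f_map_f, HomologicalComplex.comp_f]
    have h := z.map_naturality ((inr φ).f n)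
    refine ((Category.assoc _ _ _).symm.trans (congrArg (· ≫ _) h)).trans ?_
    refine (Category.assoc _ _ _).trans (congrArg (_ ≫ ·) ?_)
    exact congrArg (fun f => HomologicalComplex.Hom.f f n) (map_inr φ (qShift A B (-z.deg)))

open CochainComplex CochainComplex.mappingCone in
/-- Cones of homogeneous elements commute. -/
theorem Op.cone_cone (z w : Op A B) (X : CochainComplex (GrBimod A B) ℤ) :
    Nonempty (z.cone (w.cone X) ≅ w.cone (z.cone X)) := by
  -- Either iterated cone is the double cone of a square with edges given by `z` and `w`; it remains
  -- to transpose that square.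
  have e1 : ∀ z w : Op A B, Nonempty (z.cone (w.cone X) ≅ mappingCone
      (CochainComplex.mappingCone.map (w.chainMap X) _ (z.chainMap X) (z.chainMap _)
        (z.chainMap_naturality (w.chainMap X)).symm)) := fun z w =>
    ⟨mapIso _ _ (Iso.refl _) (mapHomologicalComplexIso _ _)
      ((z.cone_chainMap _).trans (Category.id_comp _).symm)⟩
  -- The two squares have the same underlying maps; their last corners differ only by the order of
  -- the two grading shifts.
  let τ := (NatIso.mapHomologicalComplex (qShiftIso (A := A) (B := B)
    (add_comm (-w.deg) (-z.deg))) (ComplexShape.up ℤ)).app X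
  have hτ1 : z.chainMap ((qC A B (-w.deg)).obj X) ≫ τ.hom = (qC A B (-w.deg)).map (z.chainMap X) :=
    rfl
  have hτ2 : (qC A B (-z.deg)).map (w.chainMap X) ≫ τ.hom = w.chainMap ((qC A B (-z.deg)).obj X) :=
    rfl
  refine ⟨(e1 z w).some ≪≫ exchange _ _ _ _ _ ≪≫ mapIso _ _ (Iso.refl _)
    (mapIso _ _ (Iso.refl _) τ (hτ1.trans (Category.id_comp _).symm)) ?_ ≪≫ (e1 w z).some.symm⟩
  refine Eq.trans ?_ (Category.id_comp _).symm
  exact (map_comp _ _ _ _ _ _ _ _ (hτ1.trans (Category.id_comp _).symm)).symm.trans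
    (map_congr (Category.comp_id _) hτ2 _ _)

theorem Op.cone_coneList (z : Op A B) (zs : List (Op A B)) (X : CochainComplex (GrBimod A B) ℤ) :
    Nonempty (coneList zs (z.cone X) ≅ z.cone (coneList zs X)) := by
  induction zs generalizing X with
  | nil => exact ⟨Iso.refl _⟩
  | cons w zs ih =>
    exact ⟨(coneList_iso zs (w.cone_cone z X)).some ≪≫ (ih (w.cone X)).some⟩

theorem coneList_coneList (zs ws : List (Op A B)) (X : CochainComplex (GrBimod A B) ℤ) :
    Nonempty (coneList zs (coneList ws X) ≅ coneList ws (coneList zs X)) := by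
  induction zs generalizing X with
  | nil => exact ⟨Iso.refl _⟩
  | cons z zs ih =>
    exact ⟨(coneList_iso zs (z.cone_coneList ws X)).some.symm ≪≫ (ih (z.cone X)).some⟩

/-! ### Cones and the translation functor -/

theorem Op.cone_shift (z : Op A B) (X : CochainComplex (GrBimod A B) ℤ) (n : ℤ) :
    Nonempty (z.cone (X⟦n⟧) ≅ (z.cone X)⟦n⟧) :=
  ⟨CochainComplex.mappingCone.mapIso _ _ (Iso.refl _)
    (((qC A B (-z.deg)).commShiftIso n).app X) (by
      ext1 i
      exact (Category.comp_id _).trans (Category.id_comp _).symm) ≪≫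
    (CochainComplex.mappingCone.shiftIso _ n).symm⟩

theorem coneList_shift (zs : List (Op A B)) (X : CochainComplex (GrBimod A B) ℤ) (n : ℤ) :
    Nonempty (coneList zs (X⟦n⟧) ≅ (coneList zs X)⟦n⟧) := by
  induction zs generalizing X with
  | nil => exact ⟨Iso.refl _⟩
  | cons z zs ih => exact ⟨(coneList_iso zs (z.cone_shift X n)).some ≪≫ (ih _).some⟩

/-- The iterated mapping cocone is a shift of the iterated mapping cone. -/
theorem foldr_mappingCocone (zs : List (Op A B)) (X : CochainComplex (GrBimod A B) ℤ) :
    Nonempty (zs.foldr (fun z Y => CochainComplex.mappingCocone (z.chainMap Y)) X ≅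
      (coneList zs.reverse X)⟦-(zs.length : ℤ)⟧) := by
  induction zs with
  | nil => exact ⟨(shiftFunctorZero' _ _ (by simp)).symm.app X⟩
  | cons z zs ih =>
    -- The head of the list is outermost in the right fold but innermost in `coneList`, hence the
    -- reversal.
    have e : coneList (z :: zs).reverse X = z.cone (coneList zs.reverse X) := by
      simp [coneList]
    rw [e]
    exact ⟨(shiftFunctor _ (-1 : ℤ)).mapIso (z.coneIso ih.some ≪≫
      (z.cone_shift (coneList zs.reverse X) (-(zs.length : ℤ))).some) ≪≫
      (shiftFunctorAdd' _ (-(zs.length : ℤ)) (-1) (-((z :: zs).length : ℤ))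
        (by simp; ring)).symm.app _⟩

end GrBimod

/-! ### Cones over weakly regular sequences are quotients -/

namespace GrBimod
variable {K : Type u} [Field K] {A B C A' B' A'' B'' : GrAlg K}

open scoped Pointwise

section
variable {R M N : Type*} [CommRing R] [AddCommGroup M] [Module R M] [AddCommGroup N] [Module R N]

theorem range_lsmul (r : R) : LinearMap.range (LinearMap.lsmul R M r) = r • ⊤ := by
  ext x
  rw [Submodule.mem_smul_pointwise_iff_exists]
  exact ⟨fun ⟨y, hy⟩ => ⟨y, trivial, hy⟩, fun ⟨y, _, hy⟩ => ⟨y, hy⟩⟩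

theorem isWeaklyRegular_quotient_range_lsmul {r : R} {rs : List R}
    (h : RingTheory.Sequence.IsWeaklyRegular (QuotSMulTop r M) rs) :
    RingTheory.Sequence.IsWeaklyRegular (M ⧸ LinearMap.range (LinearMap.lsmul R M r)) rs :=
  (LinearEquiv.isWeaklyRegular_congr (Submodule.quotEquivOfEq _ _ (range_lsmul r)) rs).2 h

/-- This is the inductive step for kernels: once the first element of the sequence has been divided
out, the remaining ones generate what is left. -/
theorem ker_liftQ_range_lsmul {r : R} {rs : List R} (f : M →ₗ[R] N)
    (h : LinearMap.range (LinearMap.lsmul R M r) ≤ LinearMap.ker f)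
    (hf : LinearMap.ker f = Ideal.ofList (r :: rs) • ⊤) :
    LinearMap.ker ((LinearMap.range (LinearMap.lsmul R M r)).liftQ f h) =
      Ideal.ofList rs • ⊤ := by
  rw [Submodule.ker_liftQ, hf, Ideal.ofList_cons_smul, Submodule.map_sup, ← range_lsmul,
    Submodule.mkQ_map_self, bot_sup_eq, Submodule.map_smul'', Submodule.map_top,
    Submodule.range_mkQ]
end

/-- The functor `M ↦ q ^ (-d) (M / z M)`. -/
def Op.quot (z : Op A B) : GrBimod A B ⥤ GrBimod A B where
  obj M := coker (z.map M)
  map {M N} f :=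
    (cokerIsColimit (z.map M)).desc (CokernelCofork.ofπ ((qShift A B (-z.deg)).map f ≫
      cokerπ (z.map N)) (by
        rw [← Category.assoc, ← z.map_naturality, Category.assoc, comp_cokerπ, comp_zero]))
  map_id M := hom_ext fun x => by
    obtain ⟨x, rfl⟩ := Submodule.mkQ_surjective _ x
    rfl
  map_comp f g := hom_ext fun x => by
    obtain ⟨x, rfl⟩ := Submodule.mkQ_surjective _ x
    rfl

instance (z : Op A B) : z.quot.Additive where
  map_add {M N f g} := hom_ext fun x => by
    obtain ⟨x, rfl⟩ := Submodule.mkQ_surjective _ x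
    exact map_add (LinearMap.range (z.map N).lin).mkQ _ _

/-- The quotient of a complex by the action of a homogeneous element. -/
abbrev Op.quotC (z : Op A B) (X : CochainComplex (GrBimod A B) ℤ) :
    CochainComplex (GrBimod A B) ℤ := (z.quot.mapHomologicalComplex (ComplexShape.up ℤ)).obj X

/-- The projection to the quotient. -/
def Op.quotπ (z : Op A B) (X : CochainComplex (GrBimod A B) ℤ) :
    (qC A B (-z.deg)).obj X ⟶ z.quotC X where
  f i := cokerπ (z.map (X.X i))
  comm' _ _ _ := rfl

/-- If `z` acts injectively in each degree, `X`, its shift and the quotient form a short exact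
sequence of complexes, and the cone of a monomorphism is quasi-isomorphic to its cokernel. -/
theorem Op.cone_qEquiv_quot (z : Op A B) (X : CochainComplex (GrBimod A B) ℤ)
    (h : ∀ i, IsSMulRegular (X.X i) z.elt) : QEquiv (z.cone X) (z.quotC X) := by
  let S : ShortComplex (CochainComplex (GrBimod A B) ℤ) :=
    ShortComplex.mk (z.chainMap X) (z.quotπ X) (by ext1 i; exact comp_cokerπ (z.map (X.X i)))
  have hS : S.ShortExact := HomologicalComplex.shortExact_of_degreewise_shortExact S fun i =>
    shortExact_of_function (S := S.map (HomologicalComplex.eval _ _ i)) (h i)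
      (Submodule.mkQ_surjective _) fun x => (Submodule.Quotient.mk_eq_zero _)
  have := CochainComplex.mappingCone.quasiIso_descShortComplex hS
  exact QEquiv.of_quasiIso (CochainComplex.mappingCone.descShortComplex S)

/-- A map out of the quotient. -/
def Op.quotDesc (z : Op A B) {X Y : CochainComplex (GrBimod A B) ℤ} (π : X ⟶ Y)
    (h : ∀ i x, (π.f i).lin (z.elt • (x : X.X i)) = 0) :
    z.quotC X ⟶ (qC A B (-z.deg)).obj Y where
  f i := (cokerIsColimit (z.map (X.X i))).desc
    (CokernelCofork.ofπ ((qShift A B (-z.deg)).map (π.f i)) (hom_ext fun x => h i x))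
  comm' i j _ := hom_ext fun x => by
    obtain ⟨x, rfl⟩ := Submodule.mkQ_surjective _ x
    exact congrArg (fun f : X.X i ⟶ Y.X j => f.lin x) (π.comm i j)

/-- The quotient of a complex by a weakly regular sequence computes the iterated cone. -/
theorem coneList_qEquiv_of_isWeaklyRegular (zs : List (Op A B))
    {X Y : CochainComplex (GrBimod A B) ℤ} (π : X ⟶ Y)
    (hreg : ∀ i, RingTheory.Sequence.IsWeaklyRegular (X.X i) (zs.map Op.elt))
    (hsurj : ∀ i, Function.Surjective (π.f i).lin)
    (hker : ∀ i, LinearMap.ker (π.f i).lin = Ideal.ofList (zs.map Op.elt) • ⊤) :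
    QEquiv (coneList zs X) ((qC A B (-(zs.map Op.deg).sum)).obj Y) := by
  induction zs generalizing X Y with
  | nil =>
    have : ∀ i, IsIso (π.f i) := fun i => isIso_of_bijective _
      ⟨LinearMap.ker_eq_bot.1 (by rw [hker]; simp), hsurj i⟩
    have : IsIso π := HomologicalComplex.Hom.isIso_of_components π
    exact QEquiv.of_iso (@asIso _ _ _ _ π this ≪≫
      (NatIso.mapHomologicalComplex (qShiftZero (A := A) (B := B)) (ComplexShape.up ℤ)).symm.app Y)
  | cons z zs ih =>
    have hz : ∀ i (x : X.X i), (π.f i).lin (z.elt • x) = 0 := fun i x => by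
      rw [← LinearMap.mem_ker, hker]
      refine Submodule.smul_mem_smul ?_ trivial
      exact Ideal.subset_span (by simp)
    simp only [List.map_cons, RingTheory.Sequence.isWeaklyRegular_cons_iff] at hreg
    -- The innermost cone is replaced by the quotient by `z`, and induction is applied to the map
    -- that `π` induces on this quotient. Its target is `Y` shifted by `-z.deg`, so the shifts
    -- accumulate to the sum of the degrees.
    refine (coneList_qEquiv zs (z.cone_qEquiv_quot X fun i => (hreg i).1)).trans
      ((ih (z.quotDesc π hz) (fun i => ?_) (fun i => ?_) fun i => ?_).trans (QEquiv.of_iso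
        ((NatIso.mapHomologicalComplex (qShiftAdd (A := A) (B := B) (by simp; ring))
          (ComplexShape.up ℤ)).app Y)))
    · exact isWeaklyRegular_quotient_range_lsmul (hreg i).2
    · intro y
      obtain ⟨x, rfl⟩ := hsurj i y
      exact ⟨Submodule.mkQ _ x, rfl⟩
    · exact ker_liftQ_range_lsmul (π.f i).lin _ (hker i)

end GrBimod

namespace MvPolynomial

/-! ### Regular sequences `t_i - y_i` on modules of polynomials -/

variable {σ R N : Type*} [CommRing R] [AddCommGroup N] [Module (MvPolynomial σ R) N]

/-- Multiplication by a variable, on polynomials with coefficients in a module. -/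
def coeffShift (N : Type*) [AddCommGroup N] (i : σ) : ((σ →₀ ℕ) →₀ N) →+ ((σ →₀ ℕ) →₀ N) :=
  Finsupp.mapDomain.addMonoidHom (· + Finsupp.single i 1)

variable (R N) in
/-- The action of a variable on the coefficients. -/
def coeffAct (i : σ) : ((σ →₀ ℕ) →₀ N) →+ ((σ →₀ ℕ) →₀ N) :=
  Finsupp.mapRange.addMonoidHom (DistribSMul.toAddMonoidHom N (X i : MvPolynomial σ R))

@[simp] theorem coeffShift_single (i : σ) (α : σ →₀ ℕ) (n : N) :
    coeffShift N i (Finsupp.single α n) = Finsupp.single (α + Finsupp.single i 1) n :=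
  Finsupp.mapDomain_single

@[simp] theorem coeffAct_single (i : σ) (α : σ →₀ ℕ) (n : N) :
    coeffAct R N i (Finsupp.single α n) = Finsupp.single α ((X i : MvPolynomial σ R) • n) :=
  Finsupp.mapRange_single (hf := smul_zero _)

variable (R N) in
/-- Replacing the variables in `J` by their actions on the coefficients. -/
def evalPart (J : Set σ) [DecidablePred (· ∈ J)] : ((σ →₀ ℕ) →₀ N) →+ ((σ →₀ ℕ) →₀ N) :=
  Finsupp.liftAddHom fun α => (Finsupp.singleAddHom (α.filter (· ∉ J))).comp
    (DistribSMul.toAddMonoidHom N (monomial (α.filter (· ∈ J)) 1 : MvPolynomial σ R))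

variable {J : Set σ} [DecidablePred (· ∈ J)]

@[simp] theorem evalPart_single (α : σ →₀ ℕ) (n : N) :
    evalPart R N J (Finsupp.single α n) =
      Finsupp.single (α.filter (· ∉ J)) ((monomial (α.filter (· ∈ J)) 1 : MvPolynomial σ R) • n) :=
  Finsupp.liftAddHom_apply_single _ _ _

theorem evalPart_coeffAct (i : σ) (v : (σ →₀ ℕ) →₀ N) :
    evalPart R N J (coeffAct R N i v) = coeffAct R N i (evalPart R N J v) := by
  induction v using Finsupp.induction_linear with
  | zero => simp
  | add v w hv hw => simp [hv, hw]
  | single α n => simp [smul_smul, mul_comm]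

theorem evalPart_coeffShift_of_mem {i : σ} (hi : i ∈ J) (v : (σ →₀ ℕ) →₀ N) :
    evalPart R N J (coeffShift N i v) = coeffAct R N i (evalPart R N J v) := by
  induction v using Finsupp.induction_linear with
  | zero => simp
  | add v w hv hw => simp [hv, hw]
  | single α n =>
    have h1 : (Finsupp.single i 1 : σ →₀ ℕ).filter (· ∉ J) = 0 :=
      Finsupp.filter_single_of_neg _ (by simpa using hi)
    have h2 : (Finsupp.single i 1 : σ →₀ ℕ).filter (· ∈ J) = Finsupp.single i 1 :=
      Finsupp.filter_single_of_pos _ hi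
    simp only [coeffShift_single, evalPart_single, Finsupp.filter_add, h1, h2, add_zero,
      coeffAct_single, smul_smul, X, monomial_mul, one_mul]
    rw [add_comm]

theorem evalPart_coeffShift_of_notMem {i : σ} (hi : i ∉ J) (v : (σ →₀ ℕ) →₀ N) :
    evalPart R N J (coeffShift N i v) = coeffShift N i (evalPart R N J v) := by
  induction v using Finsupp.induction_linear with
  | zero => simp
  | add v w hv hw => simp [hv, hw]
  | single α n =>
    have h1 : (Finsupp.single i 1 : σ →₀ ℕ).filter (· ∈ J) = 0 :=
      Finsupp.filter_single_of_neg _ (by simpa using hi)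
    have h2 : (Finsupp.single i 1 : σ →₀ ℕ).filter (· ∉ J) = Finsupp.single i 1 :=
      Finsupp.filter_single_of_pos _ hi
    simp only [coeffShift_single, evalPart_single, Finsupp.filter_add, h1, h2, add_zero]

theorem coeffShift_apply_add (i : σ) (v : (σ →₀ ℕ) →₀ N) (α : σ →₀ ℕ) :
    coeffShift N i v (α + Finsupp.single i 1) = v α :=
  Finsupp.mapDomain_apply (add_left_injective _) v α

/-- This is injectivity of `X_i - y_i`. Comparing coefficients gives `v α = y_i • v (α + e_i)`,
hence `v α = y_i ^ m • v (α + m e_i)` for every `m`, which vanishes once the index has left the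
finite support of `v`. -/
theorem coeffShift_eq_coeffAct {i : σ} {v : (σ →₀ ℕ) →₀ N}
    (h : coeffShift N i v = coeffAct R N i v) : v = 0 := by
  have h1 : ∀ α, v α = (X i : MvPolynomial σ R) • v (α + Finsupp.single i 1) := fun α => by
    rw [← coeffShift_apply_add i v α, h]
    rfl
  have h2 : ∀ (m : ℕ) α, v α = (X i ^ m : MvPolynomial σ R) • v (α + Finsupp.single i m) := by
    intro m
    induction m with
    | zero => simp
    | succ m ih =>
      intro α
      rw [ih α, h1 (α + _), smul_smul, ← pow_succ, add_assoc, ← Finsupp.single_add]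
  ext α
  obtain ⟨m, hm⟩ : ∃ m : ℕ, ∀ β ∈ v.support, β i < m :=
    ⟨v.support.sup (fun β => β i) + 1, fun β hβ =>
      Nat.lt_succ_of_le (Finset.le_sup (f := fun β : σ →₀ ℕ => β i) hβ)⟩
  rw [h2 m α, Finsupp.notMem_support_iff.1 fun hβ => ?_, smul_zero, Finsupp.zero_apply]
  have := hm _ hβ
  simp at this

variable {Λ V : Type*} [CommRing Λ] [AddCommGroup V] [Module Λ V] {x y : σ → Λ}
  (Φ : V ≃+ ((σ →₀ ℕ) →₀ N))

/-- Under `Φ`, `x_i` is a variable and `y_i` acts on coefficients. Substituting `y_i` for `x_i`, `i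
∈ l`, kills the submodule generated by the differences; conversely every polynomial is congruent to
its substitution modulo that submodule. -/
theorem mem_ofList_smul_top_iff (hx : ∀ i v, Φ (x i • v) = coeffShift N i (Φ v))
    (hy : ∀ i v, Φ (y i • v) = coeffAct R N i (Φ v)) (l : List σ)
    [DecidablePred (· ∈ {i | i ∈ l})] (v : V) :
    v ∈ Ideal.ofList (l.map fun i => x i - y i) • (⊤ : Submodule Λ V) ↔
      evalPart R N {i | i ∈ l} (Φ v) = 0 := by
  constructor
  · intro h
    have h0 : ∀ i ∈ l, ∀ v, evalPart R N {i | i ∈ l} (Φ ((x i - y i) • v)) = 0 := fun i hi v => by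
      rw [sub_smul, map_sub, map_sub, hx, hy, evalPart_coeffShift_of_mem (J := {i | i ∈ l}) hi,
        evalPart_coeffAct, sub_self]
    refine Submodule.smul_induction_on h (fun r hr v _ => ?_) (fun v w hv hw => by
      rw [map_add, map_add, hv, hw, add_zero])
    induction hr using Submodule.span_induction generalizing v with
    | mem r hr =>
      obtain ⟨i, hi, rfl⟩ := List.mem_map.1 hr
      exact h0 i hi v
    | zero => simp
    | add r s _ _ hr hs => rw [add_smul, map_add, map_add, hr v trivial, hs v trivial, add_zero]
    | smul c r _ hr =>
      rw [smul_eq_mul, mul_comm, mul_smul]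
      exact hr _ trivial
  · intro h
    set I := Ideal.ofList (l.map fun i => x i - y i) • (⊤ : Submodule Λ V)
    let P : ((σ →₀ ℕ) →₀ N) → Prop := fun w => Φ.symm w - Φ.symm (evalPart R N {i | i ∈ l} w) ∈ I
    have hx' : ∀ i w, Φ.symm (coeffShift N i w) = x i • Φ.symm w := fun i w => by
      rw [Φ.symm_apply_eq, hx, Φ.apply_symm_apply]
    have hy' : ∀ i w, Φ.symm (coeffAct R N i w) = y i • Φ.symm w := fun i w => by
      rw [Φ.symm_apply_eq, hy, Φ.apply_symm_apply]
    -- Congruence to the substitution is preserved by multiplication with any variable: one in `l`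
    -- is traded for its value by a generator, any other commutes with the substitution. Every
    -- monomial is then reached from a constant.
    have step : ∀ i w, P w → P (coeffShift N i w) := fun i w hw => by
      by_cases hi : i ∈ l
      · have h1 : (x i - y i) • Φ.symm w ∈ I := Submodule.smul_mem_smul
          (Ideal.subset_span (List.mem_map.2 ⟨i, hi, rfl⟩)) trivial
        have h2 := add_mem h1 (I.smul_mem (y i) hw)
        change Φ.symm _ - Φ.symm _ ∈ I
        rw [evalPart_coeffShift_of_mem (J := {i | i ∈ l}) hi, hx', hy']
        convert h2 using 1
        rw [smul_sub, sub_smul]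
        abel
      · change Φ.symm _ - Φ.symm _ ∈ I
        rw [evalPart_coeffShift_of_notMem (J := {i | i ∈ l}) hi, hx', hx', ← smul_sub]
        exact I.smul_mem _ hw
    have key : ∀ w : (σ →₀ ℕ) →₀ N, P w := by
      intro w
      induction w using Finsupp.induction_linear with
      | zero => simp [P]
      | add v w hv hw =>
        change Φ.symm _ - Φ.symm _ ∈ I
        rw [map_add, map_add, map_add, add_sub_add_comm]
        exact add_mem hv hw
      | single α n =>
        induction α using Finsupp.induction with
        | zero =>
          change Φ.symm _ - Φ.symm _ ∈ I
          rw [evalPart_single, Finsupp.filter_zero, Finsupp.filter_zero, monomial_zero', C_1,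
            one_smul, sub_self]
          exact zero_mem _
        | single_add i m f _ _ hf =>
          clear * - hf step
          induction m with
          | zero => simpa using hf
          | succ m ih =>
            have := step i _ ih
            rwa [coeffShift_single, add_right_comm, ← Finsupp.single_add] at this
    have : Φ.symm (Φ v) - Φ.symm (evalPart R N {i | i ∈ l} (Φ v)) ∈ I := key (Φ v)
    rwa [h, map_zero, sub_zero, Φ.symm_apply_apply] at this

/-- Dividing by the earlier differences amounts to substituting for their variables. The next
variable is not among them, so it still shifts exponents, and `coeffShift_eq_coeffAct` applies. No
hypothesis on the coefficient module `N` is needed. -/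
theorem isWeaklyRegular_map_sub (hx : ∀ i v, Φ (x i • v) = coeffShift N i (Φ v))
    (hy : ∀ i v, Φ (y i • v) = coeffAct R N i (Φ v)) {l : List σ} (hl : l.Nodup) :
    RingTheory.Sequence.IsWeaklyRegular V (l.map fun i => x i - y i) := by
  classical
  refine ⟨fun k hk => ?_⟩
  have hk' : k < l.length := by simpa using hk
  rw [isSMulRegular_iff_right_eq_zero_of_smul]
  intro v hv
  obtain ⟨v, rfl⟩ := Submodule.mkQ_surjective _ v
  rw [Submodule.mkQ_apply, ← Submodule.Quotient.mk_smul, Submodule.Quotient.mk_eq_zero,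
    ← List.map_take, mem_ofList_smul_top_iff Φ hx hy] at hv
  rw [Submodule.mkQ_apply, Submodule.Quotient.mk_eq_zero, ← List.map_take,
    mem_ofList_smul_top_iff Φ hx hy]
  have hn : l[k] ∉ {i | i ∈ l.take k} := fun h => by
    obtain ⟨j, hj, e⟩ := List.mem_take_iff_getElem.1 h
    have := (List.Nodup.getElem_inj_iff hl).1 e
    omega
  rw [List.getElem_map, sub_smul, map_sub, map_sub, hx, hy, evalPart_coeffShift_of_notMem hn,
    evalPart_coeffAct, sub_eq_zero] at hv
  exact coeffShift_eq_coeffAct hv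

variable (R N) in
/-- Evaluating all variables on the coefficients. -/
def evalCoeff : ((σ →₀ ℕ) →₀ N) →+ N :=
  Finsupp.liftAddHom fun α => DistribSMul.toAddMonoidHom N (monomial α 1 : MvPolynomial σ R)

@[simp] theorem evalCoeff_single (α : σ →₀ ℕ) (n : N) :
    evalCoeff R N (Finsupp.single α n) = (monomial α 1 : MvPolynomial σ R) • n :=
  Finsupp.liftAddHom_apply_single _ _ _

/-- When every variable is in the list, the substitution leaves only a constant term, so the
quotient is `N` itself. -/
theorem mem_ofList_smul_top_iff_evalCoeff (hx : ∀ i v, Φ (x i • v) = coeffShift N i (Φ v))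
    (hy : ∀ i v, Φ (y i • v) = coeffAct R N i (Φ v)) {l : List σ} (hl : ∀ i, i ∈ l) (v : V) :
    v ∈ Ideal.ofList (l.map fun i => x i - y i) • (⊤ : Submodule Λ V) ↔
      evalCoeff R N (Φ v) = 0 := by
  classical
  rw [mem_ofList_smul_top_iff Φ hx hy]
  have : ∀ w, evalPart R N {i | i ∈ l} w = Finsupp.single 0 (evalCoeff R N w) := fun w => by
    induction w using Finsupp.induction_linear with
    | zero => simp
    | add v w hv hw => simp [hv, hw]
    | single α n =>
      have h1 : α.filter (· ∈ {i | i ∈ l}) = α :=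
        Finsupp.filter_eq_self_iff _ _ |>.2 fun i _ => hl i
      have h2 : α.filter (· ∉ {i | i ∈ l}) = 0 :=
        Finsupp.filter_eq_zero_iff _ _ |>.2 fun i hi => absurd (hl i) hi
      rw [evalPart_single, h1, h2, evalCoeff_single]
  rw [this, Finsupp.single_eq_zero]

end MvPolynomial

/-! ### Splitting algebras and flatness of factorization -/

namespace Polynomial

/-- The algebra `L` is the universal algebra over `S` splitting `f` into linear factors, with
roots `x`. -/
structure IsSplittingAlgebra {S : Type u} [CommRing S] (f : S[X]) {n : ℕ} (L : Type u) [CommRing L]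
    [Algebra S L] (x : Fin n → L) : Prop where
  map_eq : f.map (algebraMap S L) = ∏ i, (X - C (x i))
  free : Module.Free S L
  exists_retraction : ∃ r : L →ₗ[S] S, r 1 = 1
  adjoin_eq_top : Algebra.adjoin S (Set.range x) = ⊤
  exists_lift : ∀ (T : Type u) [CommRing T] [Algebra S T] (y : Fin n → T),
    f.map (algebraMap S T) = ∏ i, (X - C (y i)) → ∃ φ : L →ₐ[S] T, ∀ i, φ (x i) = y i

/-- Roots are adjoined one at a time: `AdjoinRoot f` is free with basis the powers of the root, `f`
acquires a monic linear factor there, and the cofactor is split by induction. -/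
theorem exists_isSplittingAlgebra (n : ℕ) {S : Type u} [CommRing S] [Nontrivial S] (f : S[X])
    (hf : f.Monic) (hn : f.natDegree = n) :
    ∃ (L : Type u) (_ : CommRing L) (_ : Algebra S L) (x : Fin n → L),
      IsSplittingAlgebra f L x := by
  induction n generalizing S with
  | zero =>
    have h1 : f = 1 := eq_one_of_monic_natDegree_zero hf hn
    refine ⟨S, inferInstance, inferInstance, Fin.elim0, ?_, inferInstance, ⟨LinearMap.id, rfl⟩, ?_,
      ?_⟩
    · simp [h1]
    · rw [eq_top_iff]
      intro s _
      exact Subalgebra.algebraMap_mem _ s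
    · intro T _ _ y _
      exact ⟨Algebra.ofId S T, fun i => i.elim0⟩
  | succ n ih =>
    let L₁ := AdjoinRoot f
    let r : L₁ := AdjoinRoot.root f
    let pb := AdjoinRoot.powerBasis' hf
    have hdim : 0 < pb.dim := by
      rw [AdjoinRoot.powerBasis'_dim, hn]; omega
    -- The coordinate along the basis element `1` is a retraction onto `S`; it also shows that the
    -- extension is nonzero, as the induction requires.
    have hcoord : pb.basis.coord ⟨0, hdim⟩ 1 = 1 := by
      have : pb.basis ⟨0, hdim⟩ = 1 := by rw [PowerBasis.basis_eq_pow, pow_zero]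
      rw [← this, Module.Basis.coord_apply, Module.Basis.repr_self, Finsupp.single_eq_same]
    have : Nontrivial L₁ := ⟨1, 0, fun h => by
      rw [h, map_zero] at hcoord
      exact zero_ne_one hcoord⟩
    obtain ⟨g, hg⟩ : X - C r ∣ f.map (algebraMap S L₁) := by
      rw [dvd_iff_isRoot]
      exact AdjoinRoot.isRoot_root f
    have hgm : g.Monic := (monic_X_sub_C r).of_mul_monic_left (hg ▸ hf.map _)
    have hgn : g.natDegree = n := by
      have h1 := congrArg natDegree hg
      rw [(monic_X_sub_C r).natDegree_mul hgm, natDegree_X_sub_C, hf.natDegree_map, hn] at h1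
      omega
    obtain ⟨L, _, _, x, hL⟩ := ih g hgm hgn
    let _ : Algebra S L := Algebra.compHom L (algebraMap S L₁)
    have : IsScalarTower S L₁ L := IsScalarTower.of_algebraMap_eq fun _ => rfl
    have hfree : Module.Free S L₁ := Module.Free.of_basis pb.basis
    refine ⟨L, inferInstance, inferInstance, Fin.cons (algebraMap L₁ L r) x, ?_, ?_, ?_, ?_, ?_⟩
    · rw [IsScalarTower.algebraMap_eq S L₁ L, ← map_map, hg, Polynomial.map_mul, hL.map_eq,
        Fin.prod_univ_succ]
      simp
    · have := hL.free
      exact Module.Free.trans (S := L₁)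
    · obtain ⟨ρ, hρ⟩ := hL.exists_retraction
      exact ⟨(pb.basis.coord ⟨0, hdim⟩).comp (ρ.restrictScalars S), by simp [hρ, hcoord]⟩
    · have h1 : ∀ z : L₁, algebraMap L₁ L z ∈
          Algebra.adjoin S (Set.range (Fin.cons (algebraMap L₁ L r) x : Fin (n + 1) → L)) := by
        intro z
        induction z using AdjoinRoot.induction_on with
        | ih q =>
          have : algebraMap L₁ L (AdjoinRoot.mk f q) = aeval (algebraMap L₁ L r) q := by
            rw [aeval_algebraMap_apply, AdjoinRoot.aeval_eq]
          rw [this]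
          exact aeval_mem_adjoin_singleton _ _ |> Algebra.adjoin_mono (by
            rw [Set.singleton_subset_iff]
            exact ⟨0, rfl⟩)
      rw [eq_top_iff]
      intro z _
      have hz : z ∈ Algebra.adjoin L₁ (Set.range x) := by rw [hL.adjoin_eq_top]; trivial
      induction hz using Algebra.adjoin_induction with
      | mem z hz =>
        obtain ⟨i, rfl⟩ := hz
        exact Algebra.subset_adjoin ⟨i.succ, by simp⟩
      | algebraMap z => exact h1 z
      | add _ _ _ _ h h' => exact add_mem (h trivial) (h' trivial)
      | mul _ _ _ _ h h' => exact mul_mem (h trivial) (h' trivial)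
    · intro T _ _ y hy
      let φ₁ : L₁ →ₐ[S] T := AdjoinRoot.liftAlgHom f (Algebra.ofId S T) (y 0) (by
        change eval₂ (algebraMap S T) (y 0) f = 0
        rw [← eval_map, hy, Fin.prod_univ_succ]
        simp)
      have hφ₁ : φ₁ r = y 0 := AdjoinRoot.liftAlgHom_root f _ _ _
      let _ : Algebra L₁ T := φ₁.toRingHom.toAlgebra
      have : IsScalarTower S L₁ T := IsScalarTower.of_algebraMap_eq fun s => (φ₁.commutes s).symm
      have hr : algebraMap L₁ T r = y 0 := hφ₁
      -- Cancelling the regular factor `X - C (y 0)` shows that the image of `g` splits with the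
      -- remaining roots.
      obtain ⟨φ, hφ⟩ := hL.exists_lift T (fun i => y i.succ) (by
        have h1 := congrArg (Polynomial.map (algebraMap L₁ T)) hg
        rw [map_map, ← IsScalarTower.algebraMap_eq S L₁ T, hy, Fin.prod_univ_succ,
          Polynomial.map_mul, Polynomial.map_sub, map_X, map_C, hr] at h1
        exact ((monic_X_sub_C (y 0)).isRegular.left h1).symm)
      refine ⟨φ.restrictScalars S, fun i => ?_⟩
      refine Fin.cases ?_ (fun i => ?_) i
      · simp [hr]
      · simpa using hφ i

/-- The universal algebra factoring a monic polynomial into two monic factors is flat. -/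
theorem flat_of_universal_factorization {S R : Type u} [CommRing S] [CommRing R] [Algebra S R]
    [Nontrivial R] {a b : ℕ} (f : S[X]) (g h : R[X]) (hf : f.Monic) (hg : g.Monic) (hh : h.Monic)
    (hga : g.natDegree = a) (hhb : h.natDegree = b) (hfg : f.map (algebraMap S R) = g * h)
    (hgen : Algebra.adjoin S (Set.range g.coeff ∪ Set.range h.coeff) = ⊤)
    (hlift : ∀ (T : Type u) [CommRing T] [Algebra S T] (g' h' : T[X]), g'.Monic → h'.Monic →
      g'.natDegree = a → h'.natDegree = b → f.map (algebraMap S T) = g' * h' →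
      ∃ φ : R →ₐ[S] T, g.map φ.toRingHom = g' ∧ h.map φ.toRingHom = h') :
    Module.Flat S R := by
  have : Nontrivial S := (algebraMap S R).domain_nontrivial
  have hfn : f.natDegree = a + b := by
    rw [← hf.natDegree_map (algebraMap S R), hfg, hg.natDegree_mul hh, hga, hhb]
  -- Two ways of splitting `f`: at once over `S`, giving the free algebra `L`, or over `R` by
  -- splitting `g` in `E` and then `h` in `F`. The goal is to exhibit `F` as a retract of `L`, and
  -- `R` as a retract of `F`.
  obtain ⟨L, _, _, x, hL⟩ := exists_isSplittingAlgebra (a + b) f hf hfn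
  obtain ⟨E, _, _, y, hE⟩ := exists_isSplittingAlgebra a g hg hga
  obtain ⟨ρ, hρ⟩ := hE.exists_retraction
  have : Nontrivial E := ⟨1, 0, fun h => by
    rw [h, map_zero] at hρ
    exact zero_ne_one hρ⟩
  obtain ⟨F, _, _, z, hF⟩ := exists_isSplittingAlgebra b (h.map (algebraMap R E)) (hh.map _)
    (by rw [hh.natDegree_map, hhb])
  obtain ⟨τ, hτ⟩ := hF.exists_retraction
  have : Nontrivial F := ⟨1, 0, fun h => by
    rw [h, map_zero] at hτ
    exact zero_ne_one hτ⟩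
  let _ : Algebra R F := Algebra.compHom F (algebraMap R E)
  have : IsScalarTower R E F := IsScalarTower.of_algebraMap_eq fun _ => rfl
  let _ : Algebra S E := Algebra.compHom E (algebraMap S R)
  have : IsScalarTower S R E := IsScalarTower.of_algebraMap_eq fun _ => rfl
  let _ : Algebra S F := Algebra.compHom F (algebraMap S R)
  have : IsScalarTower S R F := IsScalarTower.of_algebraMap_eq fun _ => rfl
  have : IsScalarTower S E F := IsScalarTower.of_algebraMap_eq fun _ => rfl
  have hgF : g.map (algebraMap R F) = ∏ i, (X - C (algebraMap E F (y i))) := by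
    rw [IsScalarTower.algebraMap_eq R E F, ← map_map, hE.map_eq, Polynomial.map_prod]
    simp
  have hhF : h.map (algebraMap R F) = ∏ i, (X - C (z i)) := by
    rw [IsScalarTower.algebraMap_eq R E F, ← map_map, hF.map_eq]
  obtain ⟨j, hj⟩ := hL.exists_lift F (Fin.append (fun i => algebraMap E F (y i)) z) (by
    rw [IsScalarTower.algebraMap_eq S R F, ← map_map, hfg, Polynomial.map_mul, hgF, hhF,
      Fin.prod_univ_add]
    simp)
  have : Nontrivial L := by
    obtain ⟨π, hπ⟩ := hL.exists_retraction
    exact ⟨1, 0, fun h => by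
      rw [h, map_zero] at hπ
      exact zero_ne_one hπ⟩
  -- Grouping the first `a` and the last `b` roots factors `f` in `L`, so the universal property
  -- gives `R → L`. The two groups of roots then extend this map to `E` and to `F`.
  obtain ⟨φ, hφg, hφh⟩ := hlift L (∏ i : Fin a, (X - C (x (Fin.castAdd b i))))
    (∏ i : Fin b, (X - C (x (Fin.natAdd a i)))) (monic_prod_X_sub_C _ _) (monic_prod_X_sub_C _ _)
    (by simp) (by simp)
    (by rw [hL.map_eq, Fin.prod_univ_add])
  let _ : Algebra R L := φ.toRingHom.toAlgebra
  have : IsScalarTower S R L := IsScalarTower.of_algebraMap_eq fun s => (φ.commutes s).symm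
  obtain ⟨φE, hφE⟩ := hE.exists_lift L (fun i => x (Fin.castAdd b i)) hφg
  let _ : Algebra E L := φE.toRingHom.toAlgebra
  have : IsScalarTower R E L := IsScalarTower.of_algebraMap_eq fun s => (φE.commutes s).symm
  obtain ⟨φF, hφF⟩ := hF.exists_lift L (fun i => x (Fin.natAdd a i)) (by
    rw [map_map, ← IsScalarTower.algebraMap_eq R E L]
    exact hφh)
  have hEL : ∀ e : E, φF (algebraMap E F e) = φE e := fun e => φF.commutes e
  have hRL : ∀ e : R, φF (algebraMap R F e) = φ e := fun e => by
    rw [IsScalarTower.algebraMap_apply R E F, hEL]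
    exact φE.commutes e
  have hSL : ∀ e : S, φF (algebraMap S F e) = algebraMap S L e := fun e => by
    rw [IsScalarTower.algebraMap_apply S R F, hRL]
    exact φ.commutes e
  let φFS : F →ₐ[S] L := { φF.toRingHom with commutes' := hSL }
  -- This is the composite `F → L → F`. It fixes all the roots, and the rest of the argument shows
  -- that it is the identity.
  let c : F →ₐ[S] F := j.comp φFS
  have hcy : ∀ i, c (algebraMap E F (y i)) = algebraMap E F (y i) := fun i => by
    change j (φF (algebraMap E F (y i))) = _
    rw [hEL, hφE, hj, Fin.append_left]
  have hcz : ∀ i, c (z i) = z i := fun i => by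
    change j (φF (z i)) = _
    rw [hφF, hj, Fin.append_right]
  have hcoeff : ∀ (q : R[X]), (q.map (algebraMap R F)).map c.toRingHom = q.map (algebraMap R F) →
      ∀ n, c (algebraMap R F (q.coeff n)) = algebraMap R F (q.coeff n) := fun q hq n => by
    have := congrArg (fun q => coeff q n) hq
    rw [coeff_map, coeff_map] at this
    exact this
  -- The coefficients of `g` and `h` are polynomials in the fixed roots, and they generate `R` over
  -- `S`.
  have hcR : ∀ r : R, c (algebraMap R F r) = algebraMap R F r := by
    intro r
    have hr : r ∈ Algebra.adjoin S (Set.range g.coeff ∪ Set.range h.coeff) := by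
      rw [hgen]; trivial
    induction hr using Algebra.adjoin_induction with
    | mem r hr =>
      rcases hr with ⟨n, rfl⟩ | ⟨n, rfl⟩
      · refine hcoeff g ?_ n
        rw [hgF, Polynomial.map_prod]
        refine Finset.prod_congr rfl fun i _ => ?_
        rw [Polynomial.map_sub, map_X, map_C]
        exact congrArg (fun t => X - C t) (hcy i)
      · refine hcoeff h ?_ n
        rw [hhF, Polynomial.map_prod]
        refine Finset.prod_congr rfl fun i _ => ?_
        rw [Polynomial.map_sub, map_X, map_C]
        exact congrArg (fun t => X - C t) (hcz i)
    | algebraMap s => rw [← IsScalarTower.algebraMap_apply S R F]; exact c.commutes s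
    | add _ _ _ _ h h' => simp only [map_add, h, h']
    | mul _ _ _ _ h h' => simp only [map_mul, h, h']
  have hcE : ∀ e : E, c (algebraMap E F e) = algebraMap E F e := by
    intro e
    have he : e ∈ Algebra.adjoin R (Set.range y) := by rw [hE.adjoin_eq_top]; trivial
    induction he using Algebra.adjoin_induction with
    | mem r hr => obtain ⟨i, rfl⟩ := hr; exact hcy i
    | algebraMap s => rw [← IsScalarTower.algebraMap_apply R E F]; exact hcR s
    | add _ _ _ _ h h' => simp only [map_add, h, h']
    | mul _ _ _ _ h h' => simp only [map_mul, h, h']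
  have hc : ∀ e : F, c e = e := by
    intro e
    have he : e ∈ Algebra.adjoin E (Set.range z) := by rw [hF.adjoin_eq_top]; trivial
    induction he using Algebra.adjoin_induction with
    | mem r hr => obtain ⟨i, rfl⟩ := hr; exact hcz i
    | algebraMap s => exact hcE s
    | add _ _ _ _ h h' => simp only [map_add, h, h']
    | mul _ _ _ _ h h' => simp only [map_mul, h, h']
  have := hL.free
  -- The retract is `R → F → L` followed by `L → F → E → R`, the last two arrows being the module
  -- retractions of the splitting algebras `F` and `E`.
  refine Module.Flat.of_retract (M := L)
    (φFS.toLinearMap.comp (IsScalarTower.toAlgHom S R F).toLinearMap)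
    (((ρ.restrictScalars S).comp (τ.restrictScalars S)).comp j.toLinearMap) ?_
  refine LinearMap.ext fun r => ?_
  change ρ (τ (c (algebraMap R F r))) = r
  rw [hcR, IsScalarTower.algebraMap_apply R E F, Algebra.algebraMap_eq_smul_one, map_smul, hτ,
    smul_eq_mul, mul_one, Algebra.algebraMap_eq_smul_one, map_smul, hρ, smul_eq_mul, mul_one]

end Polynomial

/-! ### The coefficients of a product of two generic monic polynomials -/

namespace MvPolynomial

section
variable {σ R N : Type*} [CommRing R] [AddCommGroup N] [Module R N]

variable (σ R N) in
/-- Polynomials with coefficients in a module. -/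
def tensorEquivFinsupp : MvPolynomial σ R ⊗[R] N ≃ₗ[R] ((σ →₀ ℕ) →₀ N) :=
  open Classical in TensorProduct.equivFinsuppOfBasisLeft (basisMonomials σ R)

@[simp] theorem tensorEquivFinsupp_monomial (α : σ →₀ ℕ) (r : R) (n : N) :
    tensorEquivFinsupp σ R N (monomial α r ⊗ₜ n) = Finsupp.single α (r • n) := by
  rw [← mul_one r, ← smul_eq_mul, ← smul_monomial, ← TensorProduct.smul_tmul', map_smul,
    smul_eq_mul, mul_one, ← Finsupp.smul_single]
  congr 1
  rw [← LinearEquiv.eq_symm_apply]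
  simp [tensorEquivFinsupp]

theorem tensor_monomial_induction {P : MvPolynomial σ R ⊗[R] N → Prop}
    (h : ∀ α n, P (monomial α 1 ⊗ₜ n)) (h0 : P 0) (hadd : ∀ v w, P v → P w → P (v + w))
    (v : MvPolynomial σ R ⊗[R] N) : P v := by
  obtain ⟨w, rfl⟩ := (tensorEquivFinsupp σ R N).symm.surjective v
  induction w using Finsupp.induction_linear with
  | zero => rwa [map_zero]
  | add v w hv hw => rw [map_add]; exact hadd _ _ hv hw
  | single α n =>
    have : (tensorEquivFinsupp σ R N).symm (Finsupp.single α n) = monomial α 1 ⊗ₜ n := by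
      rw [LinearEquiv.symm_apply_eq, tensorEquivFinsupp_monomial, one_smul]
    rw [this]
    exact h α n

theorem tensorEquivFinsupp_X_smul (i : σ) (v : MvPolynomial σ R ⊗[R] N) :
    tensorEquivFinsupp σ R N ((X i : MvPolynomial σ R) • v) =
      coeffShift N i (tensorEquivFinsupp σ R N v) := by
  induction v using tensor_monomial_induction with
  | h0 => simp
  | hadd v w hv hw => simp only [smul_add, map_add, hv, hw]
  | h α n =>
    rw [TensorProduct.smul_tmul', smul_eq_mul, X, monomial_mul, one_mul,
      tensorEquivFinsupp_monomial, tensorEquivFinsupp_monomial, coeffShift_single, add_comm]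

/-- This is an instance of `isWeaklyRegular_map_sub`, with the variables acting on the coefficients
`N` through their values `c i`. -/
theorem isWeaklyRegular_X_sub_C (c : σ → R) {l : List σ} (hl : l.Nodup) :
    RingTheory.Sequence.IsWeaklyRegular (MvPolynomial σ R ⊗[R] N)
      (l.map fun i => (X i - C (c i) : MvPolynomial σ R)) := by
  let _ : Module (MvPolynomial σ R) N := Module.compHom N (aeval c : MvPolynomial σ R →ₐ[R]
      R).toRingHom
  have hX : ∀ i (n : N), (X i : MvPolynomial σ R) • n = c i • n := fun i n => by
    change aeval c (X i : MvPolynomial σ R) • n = _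
    rw [aeval_X]
  refine isWeaklyRegular_map_sub (R := R) (N := N) (tensorEquivFinsupp σ R N).toAddEquiv
    tensorEquivFinsupp_X_smul (fun i v => ?_) hl
  change tensorEquivFinsupp σ R N _ = coeffAct R N i (tensorEquivFinsupp σ R N v)
  induction v using tensor_monomial_induction with
  | h0 => simp
  | hadd v w hv hw => simp only [smul_add, map_add, hv, hw]
  | h α n =>
    rw [TensorProduct.smul_tmul', smul_eq_mul, C_mul_monomial, mul_one,
      tensorEquivFinsupp_monomial, tensorEquivFinsupp_monomial, one_smul, coeffAct_single, hX]
end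

variable (R : Type u) [CommRing R] (a b : ℕ)

/-- The generic monic polynomial of degree `a` in the first set of variables. -/
def freeMonicLeft : Polynomial (MvPolynomial (Fin a ⊕ Fin b) R) :=
  (Polynomial.freeMonic R a).map (rename (R := R) Sum.inl).toRingHom

/-- The generic monic polynomial of degree `b` in the second set of variables. -/
def freeMonicRight : Polynomial (MvPolynomial (Fin a ⊕ Fin b) R) :=
  (Polynomial.freeMonic R b).map (rename (R := R) Sum.inr).toRingHom

/-- The coefficients of the product of two generic monic polynomials. -/
def coeffMul (k : Fin (a + b)) : MvPolynomial (Fin a ⊕ Fin b) R :=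
  (freeMonicLeft R a b * freeMonicRight R a b).coeff k

theorem monic_freeMonicLeft : (freeMonicLeft R a b).Monic := (Polynomial.monic_freeMonic R a).map _
theorem monic_freeMonicRight : (freeMonicRight R a b).Monic :=
  (Polynomial.monic_freeMonic R b).map _

theorem natDegree_freeMonicLeft [Nontrivial R] : (freeMonicLeft R a b).natDegree = a := by
  rw [freeMonicLeft, (Polynomial.monic_freeMonic R a).natDegree_map, Polynomial.natDegree_freeMonic]
theorem natDegree_freeMonicRight [Nontrivial R] : (freeMonicRight R a b).natDegree = b := by
  rw [freeMonicRight, (Polynomial.monic_freeMonic R b).natDegree_map,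
    Polynomial.natDegree_freeMonic]

theorem coeff_freeMonicLeft (i : Fin a) : (freeMonicLeft R a b).coeff i = X (Sum.inl i) := by
  rw [freeMonicLeft, Polynomial.coeff_map, Polynomial.coeff_freeMonic, dif_pos i.2]
  exact rename_X _ _
theorem coeff_freeMonicRight (i : Fin b) : (freeMonicRight R a b).coeff i = X (Sum.inr i) := by
  rw [freeMonicRight, Polynomial.coeff_map, Polynomial.coeff_freeMonic, dif_pos i.2]
  exact rename_X _ _

/-- A monic polynomial is obtained from the generic one by substituting its coefficients. -/
theorem _root_.Polynomial.map_freeMonic_eq {S T : Type*} [CommRing S] [CommRing T] {n : ℕ}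
    (φ : MvPolynomial (Fin n) S →+* T) (q : Polynomial T) (hq : q.Monic) (hn : q.natDegree = n)
    (h : ∀ i : Fin n, φ (X i) = q.coeff i) : (Polynomial.freeMonic S n).map φ = q := by
  ext k
  rw [Polynomial.coeff_map, Polynomial.coeff_freeMonic]
  split_ifs with h1 h2
  · exact h ⟨k, h1⟩
  · subst hn
    rw [h2, map_one, hq.coeff_natDegree]
  · rw [map_zero, Polynomial.coeff_eq_zero_of_natDegree_lt (by omega)]

theorem map_freeMonic_coeffMul [Nontrivial R] :
    (Polynomial.freeMonic R (a + b)).map (aeval (coeffMul R a b)).toRingHom =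
      freeMonicLeft R a b * freeMonicRight R a b := by
  refine Polynomial.map_freeMonic_eq _ _
    ((monic_freeMonicLeft R a b).mul (monic_freeMonicRight R a b)) ?_ fun i => ?_
  · rw [(monic_freeMonicLeft R a b).natDegree_mul (monic_freeMonicRight R a b),
      natDegree_freeMonicLeft, natDegree_freeMonicRight]
  · exact aeval_X _ _

/-- The coefficients of two generic monic polynomials are free variables, so the target is the
universal algebra in which the generic monic polynomial of degree `a + b` factors with degrees `a`
and `b`. -/
theorem flat_coeffMul [Nontrivial R] :
    (aeval (coeffMul R a b) : MvPolynomial (Fin (a + b)) R →ₐ[R] _).toRingHom.Flat := by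
  let S := MvPolynomial (Fin (a + b)) R
  let G := MvPolynomial (Fin a ⊕ Fin b) R
  let _ : Algebra S G := (aeval (coeffMul R a b) : S →ₐ[R] G).toRingHom.toAlgebra
  have : IsScalarTower R S G := IsScalarTower.of_algebraMap_eq fun r =>
    ((aeval (coeffMul R a b) : S →ₐ[R] G).commutes r).symm
  change Module.Flat S G
  refine Polynomial.flat_of_universal_factorization (a := a) (b := b)
    (Polynomial.freeMonic R (a + b)) (freeMonicLeft R a b) (freeMonicRight R a b)
    (Polynomial.monic_freeMonic R _) (monic_freeMonicLeft R a b) (monic_freeMonicRight R a b)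
    (natDegree_freeMonicLeft R a b) (natDegree_freeMonicRight R a b) (map_freeMonic_coeffMul R a b)
    ?_ ?_
  · rw [eq_top_iff]
    intro g _
    induction g using MvPolynomial.induction_on with
    | C r =>
      have : (C r : G) = algebraMap S G (C r) := IsScalarTower.algebraMap_apply R S G r
      rw [this]
      exact Subalgebra.algebraMap_mem _ _
    | add p q hp hq => exact add_mem (hp trivial) (hq trivial)
    | mul_X p i hp =>
      refine mul_mem (hp trivial) (Algebra.subset_adjoin ?_)
      rcases i with i | i
      · exact Or.inl ⟨i, coeff_freeMonicLeft R a b i⟩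
      · exact Or.inr ⟨i, coeff_freeMonicRight R a b i⟩
  · intro T _ _ g' h' hg hh hga hhb hfgh
    let _ : Algebra R T := Algebra.compHom T (algebraMap R S)
    have : IsScalarTower R S T := IsScalarTower.of_algebraMap_eq fun _ => rfl
    let φ : G →ₐ[R] T := aeval (Sum.elim (fun i => g'.coeff i) fun i => h'.coeff i)
    have h1 : (freeMonicLeft R a b).map φ.toRingHom = g' := by
      rw [freeMonicLeft, Polynomial.map_map]
      refine Polynomial.map_freeMonic_eq _ _ hg hga fun i => ?_
      change φ (rename Sum.inl (X i)) = _
      rw [rename_X, aeval_X, Sum.elim_inl]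
    have h2 : (freeMonicRight R a b).map φ.toRingHom = h' := by
      rw [freeMonicRight, Polynomial.map_map]
      refine Polynomial.map_freeMonic_eq _ _ hh hhb fun i => ?_
      change φ (rename Sum.inr (X i)) = _
      rw [rename_X, aeval_X, Sum.elim_inr]
    -- Linearity over `S` is exactly the identity `f = g' * h'`, read coefficient by coefficient.
    have h3 : φ.comp (IsScalarTower.toAlgHom R S G) = IsScalarTower.toAlgHom R S T := by
      refine algHom_ext fun k => ?_
      change φ (aeval (coeffMul R a b) (X k)) = algebraMap S T (X k)
      rw [aeval_X, coeffMul]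
      change φ.toRingHom _ = _
      rw [← Polynomial.coeff_map, Polynomial.map_mul, h1, h2, ← hfgh, Polynomial.coeff_map,
        Polynomial.coeff_freeMonic, dif_pos k.2]
    exact ⟨{ φ.toRingHom with commutes' := fun s => DFunLike.congr_fun h3 s }, h1, h2⟩

/-- The sequence `X_k - c_k` is weakly regular on polynomials with coefficients in `N`, and flat
base change along `X_k ↦ coeffMul R a b k` preserves this. The base change `G ⊗[S] (S ⊗[R] N)` is `G
⊗[R] N`. Arbitrary `N` is allowed, as the terms of the complex `B` are arbitrary `D`-modules. -/
theorem isWeaklyRegular_coeffMul_sub [Nontrivial R] {N : Type*} [AddCommGroup N] [Module R N]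
    (c : Fin (a + b) → R) {l : List (Fin (a + b))} (hl : l.Nodup) :
    RingTheory.Sequence.IsWeaklyRegular (MvPolynomial (Fin a ⊕ Fin b) R ⊗[R] N)
      (l.map fun k => coeffMul R a b k - C (c k)) := by
  let S := MvPolynomial (Fin (a + b)) R
  let G := MvPolynomial (Fin a ⊕ Fin b) R
  let _ : Algebra S G := (aeval (coeffMul R a b) : S →ₐ[R] G).toRingHom.toAlgebra
  have : IsScalarTower R S G := IsScalarTower.of_algebraMap_eq fun r =>
    ((aeval (coeffMul R a b) : S →ₐ[R] G).commutes r).symm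
  have : Module.Flat S G := flat_coeffMul R a b
  have h := (isWeaklyRegular_X_sub_C (N := N) c hl).isWeaklyRegular_lTensor (M₂ := G)
  have hst : IsScalarTower S G (G ⊗[S] (S ⊗[R] N)) := TensorProduct.isScalarTower_left
  let e := TensorProduct.AlgebraTensorModule.cancelBaseChange R S G G N
  refine (AddEquiv.isWeaklyRegular_congr (e := e.toAddEquiv) ?_).1 h
  rw [List.forall₂_map_left_iff, List.forall₂_map_right_iff, List.forall₂_same]
  intro k _ x
  have hk : algebraMap S G (X k - C (c k)) = coeffMul R a b k - C (c k) := by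
    change aeval (coeffMul R a b) (X k - C (c k)) = _
    rw [map_sub, aeval_X, algHom_C]
    rfl
  change e _ = _ • e x
  rw [← hk, ← map_smul, algebraMap_smul]

end MvPolynomial

/-! ### Relations in towers of polynomial rings, and elementary symmetric polynomials -/

namespace MvPolynomial

theorem map_coeffMul {R S : Type u} [CommRing R] [CommRing S] (f : R →+* S) (a b : ℕ)
    (k : Fin (a + b)) : map f (coeffMul R a b k) = coeffMul S a b k := by
  rw [coeffMul, ← Polynomial.coeff_map, Polynomial.map_mul, coeffMul]
  congr 2
  · rw [freeMonicLeft, Polynomial.map_map, freeMonicLeft, ← Polynomial.map_map_freeMonic (f := f),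
      Polynomial.map_map]
    congr 1
    refine ringHom_ext (fun r => ?_) fun i => ?_ <;> simp
  · rw [freeMonicRight, Polynomial.map_map, freeMonicRight,
      ← Polynomial.map_map_freeMonic (f := f), Polynomial.map_map]
    congr 1
    refine ringHom_ext (fun r => ?_) fun i => ?_ <;> simp

/-- The relations between generators of an algebra which is also a polynomial algebra over a
smaller ring. -/
theorem ker_eval₂Hom_eq_span {P D A : Type*} {σ ι : Type*} [CommRing P] [CommRing D] [CommRing A]
    (i : P →+* D) (f : D →+* A) (c : ι → D) (t : σ → A) (x : ι → MvPolynomial σ P)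
    (hc : Function.Surjective (eval₂Hom i c)) (ht : Function.Injective (eval₂Hom (f.comp i) t))
    (hx : ∀ k, f (c k) = eval₂Hom (f.comp i) t (x k)) :
    RingHom.ker (eval₂Hom f t) = Ideal.span (Set.range fun k => map i (x k) - C (c k)) := by
  have hmap : ∀ q, eval₂Hom f t (map i q) = eval₂Hom (f.comp i) t q := fun q =>
      eval₂Hom_map_hom _ _ _ _
  apply le_antisymm
  · set I := Ideal.span (Set.range fun k => map i (x k) - C (c k))
    let π := Ideal.Quotient.mk I
    -- Modulo the relations each generator `c k` of `D` over `P` becomes the polynomial `x k`, so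
    -- all constants, and then all polynomials, are represented with coefficients in `P`.
    have hC : ∀ d, ∃ q : MvPolynomial σ P, π (C d) = π (map i q) := by
      intro d
      obtain ⟨q, rfl⟩ := hc d
      induction q using MvPolynomial.induction_on with
      | C r => exact ⟨C r, by rw [eval₂Hom_C, map_C]⟩
      | add p q hp hq =>
        obtain ⟨p', hp⟩ := hp
        obtain ⟨q', hq⟩ := hq
        exact ⟨p' + q', by simp only [map_add, hp, hq]⟩
      | mul_X p k hp =>
        obtain ⟨p', hp⟩ := hp
        refine ⟨p' * x k, ?_⟩
        have : π (map i (x k)) = π (C (c k)) := Ideal.Quotient.eq.2 (Ideal.subset_span ⟨k, rfl⟩)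
        simp only [map_mul, hp, this, eval₂Hom_X']
    have h : ∀ g : MvPolynomial σ D, ∃ q : MvPolynomial σ P, π g = π (map i q) := by
      intro g
      induction g using MvPolynomial.induction_on with
      | C d => exact hC d
      | add p q hp hq =>
        obtain ⟨p', hp⟩ := hp
        obtain ⟨q', hq⟩ := hq
        exact ⟨p' + q', by simp only [map_add, hp, hq]⟩
      | mul_X p k hp =>
        obtain ⟨p', hp⟩ := hp
        exact ⟨p' * X k, by simp only [map_mul, hp, map_X]⟩
    intro g hg
    have hI : I ≤ RingHom.ker (eval₂Hom f t) := by
      rw [Ideal.span_le]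
      rintro _ ⟨k, rfl⟩
      rw [SetLike.mem_coe, RingHom.mem_ker, map_sub, hmap, eval₂Hom_C, hx, sub_self]
    obtain ⟨q, hq⟩ := h g
    have h1 := hI (Ideal.Quotient.eq.1 hq)
    rw [RingHom.mem_ker, map_sub, hg, zero_sub, neg_eq_zero, hmap] at h1
    -- The elements `t` are algebraically independent over `P`, so a representative with
    -- coefficients in `P` that evaluates to zero is zero.
    have h2 : q = 0 := ht (h1.trans (map_zero _).symm)
    rw [h2, map_zero, map_zero] at hq
    exact Ideal.Quotient.eq_zero_iff_mem.1 hq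
  · rw [Ideal.span_le]
    rintro _ ⟨k, rfl⟩
    rw [SetLike.mem_coe, RingHom.mem_ker, map_sub, hmap, eval₂Hom_C, hx, sub_self]

/-- A polynomial ring over a polynomial ring is a polynomial ring in the union of the variables. -/
theorem bijective_eval₂Hom_sumElim {P Q A α β : Type*} [CommRing P] [CommRing Q] [CommRing A]
    (i : P →+* Q) (j : Q →+* A) (s : α → Q) (t : β → A)
    (hs : Function.Bijective (eval₂Hom i s)) (ht : Function.Bijective (eval₂Hom j t)) :
    Function.Bijective (eval₂Hom (j.comp i) (Sum.elim (j ∘ s) t)) := by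
  have h : eval₂Hom (j.comp i) (Sum.elim (j ∘ s) t) =
      (eval₂Hom j t).comp ((map (eval₂Hom i s)).comp
        ((sumAlgEquiv P β α).toRingEquiv.toRingHom.comp
          (renameEquiv P (Equiv.sumComm α β)).toRingEquiv.toRingHom)) := by
    refine ringHom_ext (fun r => ?_) fun k => ?_
    · simp
    · rcases k with k | k <;> simp
  rw [h]
  have h1 : Function.Bijective (map (σ := β) (eval₂Hom i s)) :=
    ⟨map_injective _ hs.1, map_surjective _ hs.2⟩
  exact ht.comp (h1.comp ((sumAlgEquiv P β α).bijective.comp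
    (renameEquiv P (Equiv.sumComm α β)).bijective))

/-- The elementary symmetric polynomials, as an algebra homomorphism. -/
def esymmHom (R : Type*) [CommRing R] (k : ℕ) : MvPolynomial (Fin k) R →ₐ[R] MvPolynomial
    (Fin k) R :=
  -- The index is `k - i` because this is the coefficient of `T ^ i` in `∏ (T + x_j)`; the same
  -- convention is used for all blocks.
  aeval fun i : Fin k => esymm (Fin k) R (k - i)

/-- `esymmAlgHom` sends variable `i` to the elementary symmetric polynomial of degree `i + 1`;
reversing the variables turns this into degree `k - i`. The comparison imports the fundamental
theorem. -/
theorem esymmHom_eq (R : Type*) [CommRing R] (k : ℕ) (q : MvPolynomial (Fin k) R) :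
    esymmHom R k q = (esymmAlgHom (Fin k) R k (rename Fin.rev q)).1 := by
  have : esymmHom R k = ((symmetricSubalgebra (Fin k) R).val.comp (esymmAlgHom (Fin k) R k)).comp
      (rename Fin.rev) := by
    refine algHom_ext fun i => ?_
    simp [esymmHom, esymmAlgHom]
    congr 1
    omega
  exact DFunLike.congr_fun this q

theorem esymmHom_injective (R : Type*) [CommRing R] (k : ℕ) : Function.Injective (esymmHom
    R k) := by
  intro p q h
  rw [esymmHom_eq, esymmHom_eq] at h
  exact rename_injective _ Fin.rev_injective
    ((esymmAlgHom_fin_bijective R k).1 (Subtype.ext h))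

theorem exists_esymmHom_eq {R : Type*} [CommRing R] {k : ℕ} {f : MvPolynomial (Fin k) R}
    (hf : f.IsSymmetric) : ∃ q, esymmHom R k q = f := by
  obtain ⟨q, hq⟩ := (esymmAlgHom_fin_bijective R k).2 ⟨f, hf⟩
  refine ⟨rename Fin.rev q, ?_⟩
  rw [esymmHom_eq, rename_rename, Fin.rev_involutive.comp_self, rename_id, AlgHom.id_apply, hq]

theorem map_esymmHom {R S : Type*} [CommRing R] [CommRing S] (g : R →+* S) {k : ℕ}
    (q : MvPolynomial (Fin k) R) : map g (esymmHom R k q) = esymmHom S k (map g q) := by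
  have : (map g).comp (esymmHom R k).toRingHom = (esymmHom S k).toRingHom.comp (map g) := by
    refine ringHom_ext (fun r => ?_) fun i => ?_ <;> simp [esymmHom, map_esymm]
  exact DFunLike.congr_fun this q

end MvPolynomial

/-! ### The ring of `p ++ [k]` as a polynomial ring over the ring of `p` -/

namespace Web
open MvPolynomial
variable {K : Type u} [Field K]

/-- Separating the variables of the last block. -/
def sepBlock (K : Type u) [Field K] (N k : ℕ) : MvPolynomial ℕ K →ₐ[K] MvPolynomial (Fin k)
    (MvPolynomial ℕ K) :=
  aeval fun j => if h : N ≤ j ∧ j < N + k then X ⟨j - N, by omega⟩ else C (X j)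

/-- Putting the variables of the last block back. -/
def joinBlock (K : Type u) [Field K] (N k : ℕ) : MvPolynomial (Fin k) (MvPolynomial ℕ K)
    →ₐ[MvPolynomial ℕ K] MvPolynomial ℕ K :=
  aeval fun i : Fin k => X (N + i)

theorem joinBlock_sepBlock (N k : ℕ) (f : MvPolynomial ℕ K) :
    joinBlock K N k (sepBlock K N k f) = f := by
  have : ((joinBlock K N k).restrictScalars K).comp (sepBlock K N k) = AlgHom.id K _ := by
    refine algHom_ext fun j => ?_
    simp only [sepBlock, AlgHom.comp_apply, aeval_X, AlgHom.restrictScalars_apply, AlgHom.id_apply]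
    split_ifs with h
    · simp [joinBlock, h.1]
    · simp [joinBlock]
  exact DFunLike.congr_fun this f

theorem sepBlock_X_add (N k : ℕ) (i : Fin k) : sepBlock K N k (X (N + i)) = X i := by
  rw [sepBlock, aeval_X, dif_pos ⟨by omega, by omega⟩]
  congr 1
  ext
  simp

theorem sepBlock_X_of_lt {N k j : ℕ} (h : j < N) : sepBlock K N k (X j) = C (X j) := by
  rw [sepBlock, aeval_X, dif_neg (by omega)]

/-- Two algebra homomorphisms agreeing on the variables in `s` agree on `supported K s`. -/
theorem eq_of_mem_supported {B : Type*} [CommRing B] [Algebra K B] {s : Set ℕ}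
    {f g : MvPolynomial ℕ K →ₐ[K] B} (h : ∀ j ∈ s, f (X j) = g (X j)) {q : MvPolynomial ℕ K}
    (hq : q ∈ supported K s) : f q = g q := by
  rw [supported_eq_range_rename] at hq
  obtain ⟨q, rfl⟩ := hq
  have : f.comp (rename (↑)) = g.comp (rename ((↑) : s → ℕ)) := by
    refine algHom_ext fun j => ?_
    simp [h j j.2]
  exact DFunLike.congr_fun this q

theorem sepBlock_of_mem_supported {N k : ℕ} {q : MvPolynomial ℕ K}
    (hq : q ∈ supported K {j | j < N}) : sepBlock K N k q = C q :=
  eq_of_mem_supported (f := sepBlock K N k)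
    (g := IsScalarTower.toAlgHom K (MvPolynomial ℕ K) (MvPolynomial (Fin k) (MvPolynomial ℕ K)))
    (fun _ hj => sepBlock_X_of_lt hj) hq

/-- The inclusion of the last block of variables. -/
def blockEmb (N k : ℕ) : Fin k ↪ ℕ := ⟨fun i => N + i, fun _ _ h => Fin.ext (Nat.add_left_cancel h)⟩

theorem lastBlock_eq_map (p : List ℕ) (k : ℕ) :
    lastBlock p k = (Finset.univ : Finset (Fin k)).map (blockEmb p.sum k) := by
  ext j
  have hb : ∀ i, blockEmb p.sum k i = p.sum + i := fun _ => rfl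
  simp only [lastBlock, Finset.mem_Ico, Finset.mem_map, Finset.mem_univ, true_and, hb]
  constructor
  · rintro ⟨h1, h2⟩
    exact ⟨⟨j - p.sum, by omega⟩, by simp; omega⟩
  · rintro ⟨i, rfl⟩
    omega

theorem sepBlock_elemSymm (p : List ℕ) (k i : ℕ) :
    sepBlock K p.sum k (elemSymm (lastBlock p k) i) = esymm (Fin k) (MvPolynomial ℕ K) i := by
  rw [elemSymm, lastBlock_eq_map, esymm, Finset.powersetCard_map, Finset.sum_map, map_sum]
  refine Finset.sum_congr rfl fun t _ => ?_
  rw [map_prod]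
  refine (Finset.prod_map _ _ _).trans (Finset.prod_congr rfl fun j _ => ?_)
  exact sepBlock_X_add _ _ _

/-- A permutation of the last block, extended by the identity, lies in the parabolic subgroup and
permutes just the separated variables. -/
theorem isSymmetric_sepBlock {p : List ℕ} {k : ℕ} {f : MvPolynomial ℕ K}
    (hf : f ∈ invariants K (p ++ [k])) : (sepBlock K p.sum k f).IsSymmetric := by
  intro σ
  let e : Fin k ≃ {j // p.sum ≤ j ∧ j < p.sum + k} :=
    { toFun := fun i => ⟨p.sum + i, by omega, by omega⟩
      invFun := fun j => ⟨j - p.sum, by have := j.2; omega⟩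
      left_inv := fun i => Fin.ext (by simp)
      right_inv := fun j => Subtype.ext (by have := j.2; simp; omega) }
  let τ := σ.extendDomain e
  have h1 : ∀ i : Fin k, τ (p.sum + i) = p.sum + σ i := fun i =>
    Equiv.Perm.extendDomain_apply_image σ e i
  have h2 : ∀ j, ¬ (p.sum ≤ j ∧ j < p.sum + k) → τ j = j := fun j hj =>
    Equiv.Perm.extendDomain_apply_not_subtype σ e hj
  have h3 : ∀ j, (p.sum ≤ j ∧ j < p.sum + k) → p.sum ≤ τ j ∧ τ j < p.sum + k := fun j hj => by
    obtain ⟨i, rfl⟩ : ∃ i : Fin k, j = p.sum + i := ⟨⟨j - p.sum, by omega⟩, by simp; omega⟩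
    rw [h1]
    omega
  have hτ : τ ∈ parabolic (p ++ [k]) := by
    refine ⟨fun i x => ?_, fun x hx => h2 x (by simp at hx; omega)⟩
    by_cases hx : p.sum ≤ x ∧ x < p.sum + k
    · have := h3 x hx
      by_cases hi : i ≤ p.length
      · rw [List.take_append_of_le_length hi]
        have : (p.take i).sum ≤ p.sum := (List.take_sublist i p).sum_le_sum (by simp)
        omega
      · rw [List.take_of_length_le (by simp; omega)]
        simp only [List.sum_append, List.sum_singleton]
        omega
    · rw [h2 x hx]
  have key : ((rename σ).restrictScalars K).comp (sepBlock K p.sum k) =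
      (sepBlock K p.sum k).comp (rename τ) := by
    refine algHom_ext fun j => ?_
    change rename σ (sepBlock K p.sum k (X j)) = sepBlock K p.sum k (rename τ (X j))
    rw [rename_X]
    by_cases hj : p.sum ≤ j ∧ j < p.sum + k
    · obtain ⟨i, rfl⟩ : ∃ i : Fin k, j = p.sum + i := ⟨⟨j - p.sum, by omega⟩, by simp; omega⟩
      rw [h1, sepBlock_X_add, sepBlock_X_add, rename_X]
    · rw [h2 j hj, sepBlock, aeval_X, dif_neg hj, rename_C]
  have := DFunLike.congr_fun key f
  refine this.trans ?_
  change sepBlock K p.sum k (rename τ f) = _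
  rw [hf.2 τ hτ]

theorem parabolic_le_concat (p : List ℕ) (k : ℕ) : parabolic p ≤ parabolic (p ++ [k]) := by
  refine fun τ hτ => ⟨fun i x => ?_, fun x hx => hτ.2 x (by simp at hx; omega)⟩
  by_cases hi : i ≤ p.length
  · rw [List.take_append_of_le_length hi]
    exact hτ.1 i x
  · rw [List.take_of_length_le (by simp; omega)]
    have h1 := hτ.1 p.length x
    rw [List.take_length] at h1
    simp only [List.sum_append, List.sum_singleton]
    by_cases hx : x < p.sum
    · have := h1.2 hx
      omega
    · rw [hτ.2 x (by omega)]

/-- A permutation in the parabolic subgroup of `p` fixes the last block, so it acts only on the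
coefficients once the block is separated. -/
theorem map_rename_sepBlock {p : List ℕ} {k : ℕ} {f : MvPolynomial ℕ K}
    (hf : f ∈ invariants K (p ++ [k])) {τ : Equiv.Perm ℕ} (hτ : τ ∈ parabolic p) :
    map (rename (R := K) τ).toRingHom (sepBlock K p.sum k f) = sepBlock K p.sum k f := by
  have key : ((mapAlgHom (R := K) (rename (R := K) τ)).comp (sepBlock K p.sum k)) =
      (sepBlock K p.sum k).comp (rename τ) := by
    refine algHom_ext fun j => ?_
    change map (rename (R := K) τ).toRingHom (sepBlock K p.sum k (X j)) =
      sepBlock K p.sum k (rename τ (X j))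
    rw [rename_X]
    by_cases hj : p.sum ≤ j
    · rw [hτ.2 j hj, sepBlock, aeval_X]
      split_ifs with h
      · rw [map_X]
      · rw [map_C]
        change C (rename (R := K) τ (X j)) = _
        rw [rename_X, hτ.2 j hj]
    · have h1 := hτ.1 p.length j
      rw [List.take_length] at h1
      rw [sepBlock_X_of_lt (by omega), sepBlock_X_of_lt (h1.2 (by omega)), map_C]
      change C (rename (R := K) τ (X j)) = _
      rw [rename_X]
  have := DFunLike.congr_fun key f
  refine this.trans ?_
  change sepBlock K p.sum k (rename τ f) = _
  rw [hf.2 τ (parabolic_le_concat p k hτ)]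

/-- Setting all variables `X j`, `j ≥ N`, to zero. -/
def truncVars (K : Type u) [Field K] (N : ℕ) : MvPolynomial ℕ K →ₐ[K] MvPolynomial ℕ K :=
  aeval fun j => if j < N then X j else 0

theorem truncVars_mem_supported (N : ℕ) (f : MvPolynomial ℕ K) :
    truncVars K N f ∈ supported K {j | j < N} := by
  induction f using MvPolynomial.induction_on with
  | C r => rw [algHom_C]; exact Subalgebra.algebraMap_mem _ _
  | add p q hp hq => rw [map_add]; exact add_mem hp hq
  | mul_X p j hp =>
    rw [map_mul]
    refine mul_mem hp ?_
    rw [truncVars, aeval_X]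
    split_ifs with h
    · exact X_mem_supported.2 h
    · exact zero_mem _

/-- Involving only the first `N` variables is phrased as being fixed by a homomorphism, like
invariance under permutations, so that both conditions can be transferred to coefficients by the
same argument. -/
theorem map_truncVars_sepBlock {N k : ℕ} {f : MvPolynomial ℕ K}
    (hf : f ∈ supported K {j | j < N + k}) :
    map (truncVars K N).toRingHom (sepBlock K N k f) = sepBlock K N k f := by
  refine eq_of_mem_supported (f := (mapAlgHom (R := K) (truncVars K N)).comp (sepBlock K N k))
    (g := sepBlock K N k) (fun j hj => ?_) hf
  change map (truncVars K N).toRingHom (sepBlock K N k (X j)) = _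
  have hj : j < N + k := hj
  rw [sepBlock, aeval_X]
  split_ifs with h
  · rw [map_X]
  · rw [map_C]
    change C (truncVars K N (X j)) = _
    rw [truncVars, aeval_X, if_pos (by omega)]

/-- The inclusion of the ring of invariants in the polynomial ring. -/
def invVal (K : Type u) [Field K] (I : List ℕ) : invRing K I →+* MvPolynomial ℕ K :=
  (invariants K I).val.toRingHom

theorem invVal_injective (I : List ℕ) : Function.Injective (invVal K I) := Subtype.val_injective

/-- The fundamental theorem expresses the separated polynomial through elementary symmetric
polynomials. The expression is unique, so its coefficients are fixed by every homomorphism that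
fixes the separated polynomial; this places them in the invariants of `p`. -/
theorem exists_esymmHom_eq_sepBlock {p : List ℕ} {k : ℕ} {f : MvPolynomial ℕ K}
    (hf : f ∈ invariants K (p ++ [k])) :
    ∃ q : MvPolynomial (Fin k) (invRing K p),
      esymmHom _ k (map (invVal K p) q) = sepBlock K p.sum k f := by
  obtain ⟨q, hq⟩ := exists_esymmHom_eq (isSymmetric_sepBlock hf)
  have hfix : ∀ ω : MvPolynomial ℕ K →ₐ[K] MvPolynomial ℕ K,
      map ω.toRingHom (sepBlock K p.sum k f) = sepBlock K p.sum k f →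
      ∀ α, ω (q.coeff α) = q.coeff α := by
    intro ω hω α
    rw [← hq, map_esymmHom] at hω
    have := congrArg (coeff α) (esymmHom_injective _ k hω)
    rw [coeff_map] at this
    exact this
  have hcoeff : ∀ α, q.coeff α ∈ invariants K p := by
    intro α
    refine ⟨?_, fun τ hτ => hfix (rename τ) (map_rename_sepBlock hf hτ) α⟩
    rw [← hfix (truncVars K p.sum) (map_truncVars_sepBlock (by simpa using hf.1)) α]
    exact truncVars_mem_supported _ _
  obtain ⟨q', rfl⟩ : ∃ q', map (invVal K p) q' = q := by
    have hc : ∀ α, ∃ r, invVal K p r = q.coeff α := fun α => ⟨⟨_, hcoeff α⟩, rfl⟩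
    choose r hr using hc
    refine ⟨∑ α ∈ q.support, monomial α (r α), ?_⟩
    rw [map_sum]
    refine Eq.trans ?_ q.support_sum_monomial_coeff
    refine Finset.sum_congr rfl fun α _ => ?_
    rw [map_monomial, hr]
  exact ⟨q', hq⟩

end Web

namespace Web
open MvPolynomial
variable {K : Type u} [Field K]

/-- Polynomials in the elementary symmetric polynomials of the last block of variables. -/
def lastElemHom (K : Type u) [Field K] (p : List ℕ) (k : ℕ) :
    MvPolynomial (Fin k) (invRing K p) →+* invRing K (p ++ [k]) :=
  eval₂Hom (inclHom (K := K) (invariants_le_concat p k)).toAlgHom.toRingHom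
    fun i : Fin k => lastElem p k (k - i)

theorem lastElemHom_C (p : List ℕ) (k : ℕ) (r : invRing K p) :
    lastElemHom K p k (C r) = (inclHom (K := K) (invariants_le_concat p k)).toAlgHom r :=
  eval₂Hom_C _ _ _

theorem lastElemHom_X (p : List ℕ) (k : ℕ) (i : Fin k) :
    lastElemHom K p k (X i) = lastElem p k (k - i) := eval₂Hom_X' _ _ _

theorem invVal_apply {I : List ℕ} (r : invariants K I) : invVal K I r = r.1 := rfl

theorem invVal_inclHom {I J : List ℕ} (h : invariants K J ≤ invariants K I) (r : invRing K J) :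
    invVal K I ((inclHom h).toAlgHom r) = invVal K J r :=
  (invVal_apply (Subalgebra.inclusion h r)).trans
    ((Subalgebra.coe_inclusion h r).trans (invVal_apply (I := J) r).symm)

theorem invVal_lastElem (p : List ℕ) (k i : ℕ) :
    invVal K (p ++ [k]) (lastElem p k i) = elemSymm (lastBlock p k) i :=
  invVal_apply _

theorem sepBlock_invVal (p : List ℕ) (k : ℕ) (r : invRing K p) :
    sepBlock K p.sum k (invVal K p r) = C (invVal K p r) :=
  sepBlock_of_mem_supported r.2.1

theorem sepBlock_lastElemHom_C (p : List ℕ) (k : ℕ) (r : invRing K p) :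
    sepBlock K p.sum k (invVal K (p ++ [k]) (lastElemHom K p k (C r))) =
      esymmHom _ k (map (invVal K p) (C r)) := by
  rw [lastElemHom_C, invVal_inclHom, sepBlock_invVal, map_C, algHom_C]
  rfl

theorem sepBlock_lastElemHom_X (p : List ℕ) (k : ℕ) (i : Fin k) :
    sepBlock K p.sum k (invVal K (p ++ [k]) (lastElemHom K p k (X i))) =
      esymmHom _ k (map (invVal K p) (X i)) := by
  rw [lastElemHom_X, invVal_lastElem, sepBlock_elemSymm, map_X, esymmHom, aeval_X]

theorem sepBlock_lastElemHom (p : List ℕ) (k : ℕ) (q : MvPolynomial (Fin k) (invRing K p)) :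
    sepBlock K p.sum k (invVal K (p ++ [k]) (lastElemHom K p k q)) =
      esymmHom _ k (map (invVal K p) q) := by
  induction q using MvPolynomial.induction_on with
  | C r => exact sepBlock_lastElemHom_C p k r
  | add q q' hq hq' => rw [map_add, map_add, map_add, map_add, map_add, hq, hq']
  | mul_X q i hq =>
    rw [map_mul, map_mul, map_mul, map_mul, map_mul, hq, sepBlock_lastElemHom_X]

/-- The fundamental theorem on symmetric polynomials in the last block of variables. -/
theorem bijective_lastElemHom (p : List ℕ) (k : ℕ) : Function.Bijective (lastElemHom K p k) := by
  constructor
  · intro q q' h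
    have h1 := sepBlock_lastElemHom p k q
    rw [h, sepBlock_lastElemHom] at h1
    exact (map_injective _ (invVal_injective p) (esymmHom_injective _ k h1)).symm
  · intro f
    obtain ⟨q, hq⟩ := exists_esymmHom_eq_sepBlock f.2
    refine ⟨q, invVal_injective _ ?_⟩
    have h2 := congrArg (joinBlock K p.sum k) ((sepBlock_lastElemHom p k q).trans hq)
    rw [joinBlock_sepBlock, joinBlock_sepBlock] at h2
    exact h2

end Web

/-! ### Two adjacent blocks: presentation of the refined ring over the merged ring -/

namespace Web
open MvPolynomial
variable {K : Type u} [Field K]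

/-- The polynomial `∏ (T + x_j)` over the alphabet `s`. -/
def blockPoly (K : Type u) [Field K] (s : Finset ℕ) : Polynomial (MvPolynomial ℕ K) :=
  ∏ j ∈ s, (Polynomial.X + Polynomial.C (X j))

theorem coeff_blockPoly {s : Finset ℕ} {k : ℕ} (h : k ≤ s.card) :
    (blockPoly K s).coeff k = elemSymm s (s.card - k) :=
  Finset.prod_X_add_C_coeff s _ h

theorem monic_blockPoly (s : Finset ℕ) : (blockPoly K s).Monic :=
  Polynomial.monic_prod_of_monic _ _ fun _ _ => Polynomial.monic_X_add_C _

theorem natDegree_blockPoly (s : Finset ℕ) : (blockPoly K s).natDegree = s.card := by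
  rw [blockPoly, Polynomial.natDegree_prod_of_monic _ _ fun _ _ => Polynomial.monic_X_add_C _]
  simp

theorem card_lastBlock (p : List ℕ) (k : ℕ) : (lastBlock p k).card = k := by
  simp [lastBlock]

theorem blockPoly_lastBlock_add (p : List ℕ) (a b : ℕ) :
    blockPoly K (lastBlock p (a + b)) =
      blockPoly K (lastBlock p a) * blockPoly K (lastBlock (p ++ [a]) b) := by
  rw [blockPoly, blockPoly, blockPoly, lastBlock, lastBlock, lastBlock, List.sum_append,
    List.sum_singleton, ← add_assoc]
  exact (Finset.prod_Ico_consecutive _ (by omega) (by omega)).symm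

/-- The elementary symmetric polynomials of the two last blocks. -/
def twoBlockElem (K : Type u) [Field K] (p : List ℕ) (a b : ℕ) :
    Fin a ⊕ Fin b → invRing K (p ++ [a] ++ [b]) :=
  Sum.elim (fun i => (inclHom (K := K) (invariants_le_concat (p ++ [a]) b)).toAlgHom
    (lastElem p a (a - i))) fun i => lastElem (p ++ [a]) b (b - i)

/-- The inclusion of the invariants of the first blocks. -/
def inclTwo (K : Type u) [Field K] (p : List ℕ) (a b : ℕ) :
    GrAlg.Hom (invRing K p) (invRing K (p ++ [a] ++ [b])) :=
  inclHom ((invariants_le_concat p a).trans (invariants_le_concat (p ++ [a]) b))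

theorem invVal_twoBlockElem_inl (p : List ℕ) (a b : ℕ) (i : Fin a) :
    invVal K _ (twoBlockElem K p a b (Sum.inl i)) = elemSymm (lastBlock p a) (a - i) := by
  rw [twoBlockElem, Sum.elim_inl, invVal_inclHom, invVal_lastElem]

theorem invVal_twoBlockElem_inr (p : List ℕ) (a b : ℕ) (i : Fin b) :
    invVal K _ (twoBlockElem K p a b (Sum.inr i)) = elemSymm (lastBlock (p ++ [a]) b) (b - i) := by
  rw [twoBlockElem, Sum.elim_inr, invVal_lastElem]

/-- Polynomials in the elementary symmetric polynomials of the last two blocks. -/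
def twoBlockHom (K : Type u) [Field K] (p : List ℕ) (a b : ℕ) :
    MvPolynomial (Fin a ⊕ Fin b) (invRing K p) →+* invRing K (p ++ [a] ++ [b]) :=
  eval₂Hom (inclTwo K p a b).toAlgHom.toRingHom (twoBlockElem K p a b)

theorem inclHom_inclHom {I J L : List ℕ} (h : invariants K J ≤ invariants K I)
    (h' : invariants K L ≤ invariants K J) (h'' : invariants K L ≤ invariants K I)
    (r : invRing K L) : (inclHom h).toAlgHom ((inclHom h').toAlgHom r) = (inclHom
        h'').toAlgHom r := by
  apply invVal_injective
  rw [invVal_inclHom, invVal_inclHom, invVal_inclHom]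

theorem inclTwo_eq (p : List ℕ) (a b : ℕ) : (inclTwo K p a b).toAlgHom.toRingHom =
    (inclHom (K := K) (invariants_le_concat (p ++ [a]) b)).toAlgHom.toRingHom.comp
      (inclHom (K := K) (invariants_le_concat p a)).toAlgHom.toRingHom := by
  exact RingHom.ext fun r => (inclHom_inclHom (invariants_le_concat (p ++ [a]) b)
    (invariants_le_concat p a) _ r).symm

theorem inclTwo_eq' (p : List ℕ) (a b : ℕ) : (inclTwo K p a b).toAlgHom.toRingHom =
    (inclHom (K := K) (refines_concat p a b).invariants_le).toAlgHom.toRingHom.comp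
      (inclHom (K := K) (invariants_le_concat p (a + b))).toAlgHom.toRingHom := by
  exact RingHom.ext fun r => (inclHom_inclHom (refines_concat p a b).invariants_le
    (invariants_le_concat p (a + b)) _ r).symm

/-- The fundamental theorem is applied twice, once for each of the last two blocks. -/
theorem bijective_twoBlockHom (p : List ℕ) (a b : ℕ) : Function.Bijective (twoBlockHom K p
    a b) := by
  have h := bijective_eval₂Hom_sumElim _ _ _ _ (bijective_lastElemHom (K := K) p a)
    (bijective_lastElemHom (K := K) (p ++ [a]) b)
  rw [← inclTwo_eq] at h
  exact h

theorem map_freeMonicLeft (p : List ℕ) (a b : ℕ) :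
    (freeMonicLeft (invRing K p) a b).map ((invVal K _).comp (twoBlockHom K p a b)) =
      blockPoly K (lastBlock p a) := by
  rw [freeMonicLeft, Polynomial.map_map]
  refine Polynomial.map_freeMonic_eq _ _ (monic_blockPoly _) (by
    rw [natDegree_blockPoly, card_lastBlock]) fun i => ?_
  rw [coeff_blockPoly (by rw [card_lastBlock]; omega), card_lastBlock, ← invVal_twoBlockElem_inl]
  have h : rename (R := invRing K p) (Sum.inl : Fin a → Fin a ⊕ Fin b) (X i) = X (Sum.inl i) :=
    rename_X _ _
  change invVal K _ (twoBlockHom K p a b (rename Sum.inl (X i))) = _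
  rw [h]
  exact congrArg (invVal K _) (eval₂Hom_X' _ _ _)

theorem map_freeMonicRight (p : List ℕ) (a b : ℕ) :
    (freeMonicRight (invRing K p) a b).map ((invVal K _).comp (twoBlockHom K p a b)) =
      blockPoly K (lastBlock (p ++ [a]) b) := by
  rw [freeMonicRight, Polynomial.map_map]
  refine Polynomial.map_freeMonic_eq _ _ (monic_blockPoly _) (by
    rw [natDegree_blockPoly, card_lastBlock]) fun i => ?_
  rw [coeff_blockPoly (by rw [card_lastBlock]; omega), card_lastBlock, ← invVal_twoBlockElem_inr]
  have h : rename (R := invRing K p) (Sum.inr : Fin b → Fin a ⊕ Fin b) (X i) = X (Sum.inr i) :=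
    rename_X _ _
  change invVal K _ (twoBlockHom K p a b (rename Sum.inr (X i))) = _
  rw [h]
  exact congrArg (invVal K _) (eval₂Hom_X' _ _ _)

/-- The generic monic polynomials specialize to `∏ (T + x_j)` over the two blocks, and the product
of these is the polynomial of the merged block; the identity compares coefficients of `T ^ k`. -/
theorem inclHom_lastElem_eq (p : List ℕ) (a b : ℕ) (k : Fin (a + b)) :
    (inclHom (K := K) (refines_concat p a b).invariants_le).toAlgHom
      (lastElem p (a + b) (a + b - k)) = twoBlockHom K p a b (coeffMul (invRing K p) a b k) := by
  apply invVal_injective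
  rw [invVal_inclHom, invVal_lastElem]
  change _ = ((invVal K _).comp (twoBlockHom K p a b)) _
  rw [coeffMul, ← Polynomial.coeff_map, Polynomial.map_mul, map_freeMonicLeft, map_freeMonicRight,
    ← blockPoly_lastBlock_add, coeff_blockPoly (by rw [card_lastBlock]; omega), card_lastBlock]

theorem eval₂Hom_inclHom_map (p : List ℕ) (a b : ℕ) (q : MvPolynomial (Fin a ⊕ Fin b)
    (invRing K p)) :
    eval₂Hom (inclHom (K := K) (refines_concat p a b).invariants_le).toAlgHom.toRingHom
      (twoBlockElem K p a b) (map (inclHom (K := K)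
        (invariants_le_concat p (a + b))).toAlgHom.toRingHom q) = twoBlockHom K p a b q := by
  rw [eval₂Hom_map_hom, ← inclTwo_eq']
  rfl

theorem surjective_eval₂Hom_twoBlockElem (p : List ℕ) (a b : ℕ) :
    Function.Surjective (eval₂Hom
      (inclHom (K := K) (refines_concat p a b).invariants_le).toAlgHom.toRingHom
      (twoBlockElem K p a b)) := fun x => by
  obtain ⟨q, rfl⟩ := (bijective_twoBlockHom p a b).2 x
  exact ⟨_, eval₂Hom_inclHom_map p a b q⟩

/-- Both rings are generated over the invariants of `p` by elementary symmetric polynomials, those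
of the two blocks being algebraically independent. The only relations over the merged ring are
therefore the ones that express its own generators through those of the two blocks. -/
theorem ker_eval₂Hom_twoBlockElem (p : List ℕ) (a b : ℕ) :
    RingHom.ker (eval₂Hom
      (inclHom (K := K) (refines_concat p a b).invariants_le).toAlgHom.toRingHom
      (twoBlockElem K p a b)) =
    Ideal.span (Set.range fun k : Fin (a + b) => coeffMul (invRing K (p ++ [a + b])) a b k -
      C (lastElem p (a + b) (a + b - k))) := by
  have h := ker_eval₂Hom_eq_span (inclHom (K := K) (invariants_le_concat p (a +
      b))).toAlgHom.toRingHom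
    (inclHom (K := K) (refines_concat p a b).invariants_le).toAlgHom.toRingHom
    (fun k : Fin (a + b) => lastElem p (a + b) (a + b - k)) (twoBlockElem K p a b)
    (fun k => coeffMul (invRing K p) a b k) (bijective_lastElemHom p (a + b)).2
    (by rw [← inclTwo_eq']; exact (bijective_twoBlockHom p a b).1)
    (fun k => by rw [← inclTwo_eq']; exact inclHom_lastElem_eq p a b k)
  simpa only [map_coeffMul] using h

end Web

/-! ### Graded polynomial algebras -/

namespace GrAlg
open MvPolynomial
variable {K : Type u} [Field K] (D : GrAlg K) {σ : Type} (w : σ → ℤ)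

/-- The degree `n` part of the polynomial algebra over `D` in variables of degrees `w`. -/
def polyDeg (n : ℤ) : Submodule K (MvPolynomial σ D) where
  carrier := {f | ∀ α, coeff α f ∈ D.deg (n - Finsupp.weight w α)}
  add_mem' hf hg α := by rw [coeff_add]; exact add_mem (hf α) (hg α)
  zero_mem' α := by rw [coeff_zero]; exact zero_mem _
  smul_mem' k f hf α := by rw [coeff_smul]; exact Submodule.smul_mem _ k (hf α)

variable {D w}

theorem monomial_mem_polyDeg {α : σ →₀ ℕ} {m n : ℤ} {d : D} (hd : d ∈ D.deg m)
    (h : m + Finsupp.weight w α = n) : monomial α d ∈ polyDeg D w n := by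
  classical
  intro β
  rw [coeff_monomial]
  split_ifs with hαβ
  · rw [← hαβ, ← h, add_sub_cancel_right]
    exact hd
  · exact zero_mem _

theorem polyDeg_induction {n : ℤ} {P : MvPolynomial σ D → Prop} (h0 : P 0)
    (hadd : ∀ f g, P f → P g → P (f + g))
    (h : ∀ α m d, d ∈ D.deg m → m + Finsupp.weight w α = n → P (monomial α d))
    {f : MvPolynomial σ D} (hf : f ∈ polyDeg D w n) : P f := by
  rw [← f.support_sum_monomial_coeff]
  exact Finset.sum_induction _ _ hadd h0 fun α _ => h α _ _ (hf α) (by ring)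

theorem X_mem_polyDeg (i : σ) : (X i : MvPolynomial σ D) ∈ polyDeg D w (w i) :=
  monomial_mem_polyDeg (m := 0) SetLike.GradedOne.one_mem (by simp [Finsupp.weight_single])

theorem C_mem_polyDeg {n : ℤ} {d : D} (hd : d ∈ D.deg n) :
    (C d : MvPolynomial σ D) ∈ polyDeg D w n :=
  monomial_mem_polyDeg hd (by simp)

theorem one_mem_polyDeg : (1 : MvPolynomial σ D) ∈ polyDeg D w 0 :=
  C_1 (R := D) (σ := σ) ▸ C_mem_polyDeg SetLike.GradedOne.one_mem

theorem mul_mem_polyDeg {i j : ℤ} {f g : MvPolynomial σ D} (hf : f ∈ polyDeg D w i)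
    (hg : g ∈ polyDeg D w j) : f * g ∈ polyDeg D w (i + j) := by
  refine polyDeg_induction (P := fun f => f * g ∈ polyDeg D w (i + j)) ?_ ?_ ?_ hf
  · rw [zero_mul]; exact zero_mem _
  · intro f f' hf hf'; rw [add_mul]; exact add_mem hf hf'
  · intro α m d hd hα
    refine polyDeg_induction (P := fun g => monomial α d * g ∈ polyDeg D w (i + j)) ?_ ?_ ?_ hg
    · rw [mul_zero]; exact zero_mem _
    · intro f f' hf hf'; rw [mul_add]; exact add_mem hf hf'
    · intro β l e he hβ
      rw [monomial_mul]
      exact monomial_mem_polyDeg (SetLike.GradedMul.mul_mem hd he) (by rw [map_add]; omega)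

variable (D w) in
/-- The projection to the degree `n` part. -/
def polyProj (n : ℤ) : MvPolynomial σ D →+ MvPolynomial σ D :=
  (Finsupp.liftAddHom fun α => (monomial α).toAddMonoidHom.comp
    (GradedRing.proj D.deg (n - Finsupp.weight w α))).comp
      (basisMonomials σ D).repr.toLinearMap.toAddMonoidHom

theorem polyProj_monomial (n : ℤ) (α : σ →₀ ℕ) (d : D) : polyProj D w n (monomial α d) =
    monomial α (GradedRing.proj D.deg (n - Finsupp.weight w α) d) := by
  have : (basisMonomials σ D).repr (monomial α d) = Finsupp.single α d := by
    have h : monomial α 1 = basisMonomials σ D α := by rw [coe_basisMonomials]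
    rw [← mul_one d, ← smul_eq_mul, ← smul_monomial, map_smul, h, Module.Basis.repr_self,
      Finsupp.smul_single]
  change Finsupp.liftAddHom _ ((basisMonomials σ D).repr (monomial α d)) = _
  rw [this, Finsupp.liftAddHom_apply_single]
  rfl

variable (D w) in
theorem polyDeg_isInternal : DirectSum.IsInternal (polyDeg D w) := by
  refine isInternal_of_proj (fun n => (polyDeg D w n).toAddSubgroup) (polyProj D w) ?_ ?_ ?_
  · intro n f (hf : f ∈ polyDeg D w n)
    refine polyDeg_induction (P := fun f => polyProj D w n f = f) ?_ ?_ ?_ hf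
    · rw [map_zero]
    · intro f f' hf hf'; rw [map_add, hf, hf']
    · intro α m d hd hα
      rw [polyProj_monomial, ← hα, add_sub_cancel_right, GradedRing.proj_apply,
        DirectSum.decompose_of_mem_same _ hd]
  · intro m n hmn f (hf : f ∈ polyDeg D w n)
    refine polyDeg_induction (P := fun f => polyProj D w m f = 0) ?_ ?_ ?_ hf
    · rw [map_zero]
    · intro f f' hf hf'; rw [map_add, hf, hf', add_zero]
    · intro α l d hd hα
      rw [polyProj_monomial, GradedRing.proj_apply, DirectSum.decompose_of_mem_ne _ hd (by omega),
        map_zero]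
  · rw [eq_top_iff]
    rintro f -
    induction f using MvPolynomial.induction_on' with
    | add f g hf hg => exact add_mem hf hg
    | monomial α d =>
      induction d using DirectSum.Decomposition.inductionOn D.deg with
      | zero => rw [map_zero]; exact zero_mem _
      | add d e hd he => rw [map_add]; exact add_mem hd he
      | @homogeneous l d =>
        exact AddSubgroup.mem_iSup_of_mem (l + Finsupp.weight w α)
          (monomial_mem_polyDeg d.2 rfl)

variable (D w) in
/-- The graded polynomial algebra over `D` in variables of degrees `w`. -/
def poly : GrAlg K where
  carrier := MvPolynomial σ D
  deg := polyDeg D w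
  graded :=
    { one_mem := one_mem_polyDeg
      mul_mem := fun _ _ _ _ hf hg => mul_mem_polyDeg hf hg
      toDecomposition := (polyDeg_isInternal D w).chooseDecomposition }

variable (D w) in
/-- The inclusion of the coefficients. -/
def polyC : GrAlg.Hom D (poly D w) where
  toAlgHom := IsScalarTower.toAlgHom K D (MvPolynomial σ D)
  map_deg hx := C_mem_polyDeg hx

theorem weight_prod_mem {S : Type*} [CommRing S] {𝒮 : ℤ → AddSubgroup S} (h1 : (1 : S) ∈ 𝒮 0)
    (hmul : ∀ {i j x y}, x ∈ 𝒮 i → y ∈ 𝒮 j → x * y ∈ 𝒮 (i + j)) {t : σ → S}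
    (ht : ∀ i, t i ∈ 𝒮 (w i)) (α : σ →₀ ℕ) :
    (α.prod fun i k => t i ^ k) ∈ 𝒮 (Finsupp.weight w α) := by
  classical
  induction α using Finsupp.induction_linear with
  | zero => simpa using h1
  | add α β hα hβ =>
    rw [Finsupp.prod_add_index' (fun _ => pow_zero _) fun _ _ _ => pow_add _ _ _, map_add]
    exact hmul hα hβ
  | single i k =>
    rw [Finsupp.prod_single_index (h := fun i k => t i ^ k) (pow_zero _), Finsupp.weight_single]
    induction k with
    | zero => simpa using h1
    | succ k ih => rw [pow_succ, succ_nsmul]; exact hmul ih (ht i)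

theorem eval₂Hom_mem_of_mem_polyDeg {S : Type*} [CommRing S] {𝒮 : ℤ → AddSubgroup S}
    (h1 : (1 : S) ∈ 𝒮 0) (hmul : ∀ {i j x y}, x ∈ 𝒮 i → y ∈ 𝒮 j → x * y ∈ 𝒮 (i + j)) {t : σ → S}
    (ht : ∀ i, t i ∈ 𝒮 (w i)) (f : D →+* S) (hf : ∀ {n d}, d ∈ D.deg n → f d ∈ 𝒮 n) {n : ℤ}
    {g : MvPolynomial σ D} (hg : g ∈ polyDeg D w n) : eval₂Hom f t g ∈ 𝒮 n := by
  refine polyDeg_induction (P := fun g => eval₂Hom f t g ∈ 𝒮 n) ?_ ?_ ?_ hg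
  · rw [map_zero]; exact zero_mem _
  · intro f f' hf hf'; rw [map_add]; exact add_mem hf hf'
  · intro α m d hd hα
    rw [eval₂Hom_monomial, ← hα]
    exact hmul (hf hd) (weight_prod_mem h1 hmul ht α)

variable {A : GrAlg K}

/-- Evaluation of polynomials. -/
def polyEval (f : GrAlg.Hom D A) (t : σ → A) (ht : ∀ i, t i ∈ A.deg (w i)) :
    GrAlg.Hom (poly D w) A where
  toAlgHom :=
    { eval₂Hom f.toAlgHom.toRingHom t with
      commutes' := fun k => (eval₂Hom_C _ _ _).trans (f.toAlgHom.commutes k) }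
  map_deg hx := eval₂Hom_mem_of_mem_polyDeg (𝒮 := fun n => (A.deg n).toAddSubgroup)
    (SetLike.GradedOne.one_mem (A := A.deg)) (fun hx hy => SetLike.GradedMul.mul_mem (A :=
        A.deg) hx hy) ht _
    (fun hd => f.map_deg hd) hx

end GrAlg

/-! ### The bimodule of polynomials with coefficients in a bimodule -/

namespace GrBimod
variable {K : Type u} [Field K] {A B C D : GrAlg K}

theorem map_tensorAct_of_tmul {M : GrBimod A B} {N : GrBimod B C} {Z : GrBimod A C}
    (g : TensorCarrier M N →+ Z)
    (hsmul : ∀ (a : A) (c : C) (x : M.RightMod) (y : N.LeftMod),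
      g ((show M.RightMod from (a ⊗ₜ[K] (1 : B)) • x) ⊗ₜ[B]
        (show N.LeftMod from ((1 : B) ⊗ₜ[K] c) • y)) = (a ⊗ₜ[K] c) • g (x ⊗ₜ[B] y))
    (e : A ⊗[K] C) (t : TensorCarrier M N) : g (tensorAct M N e t) = e • g t := by
  induction e using TensorProduct.induction_on with
  | zero => rw [map_zero, LinearMap.zero_apply, map_zero, zero_smul]
  | add e e' he he' => rw [map_add, LinearMap.add_apply, map_add, he, he', add_smul]
  | tmul a c =>
    induction t using TensorProduct.induction_on with
    | zero => rw [map_zero, map_zero, smul_zero]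
    | add s t hs ht => rw [map_add, map_add, hs, ht, map_add, smul_add]
    | tmul x y => exact hsmul a c x y

theorem map_mem_of_tmul {M : GrBimod A B} {N : GrBimod B C} {Z : GrBimod A C}
    (g : TensorCarrier M N →+ Z)
    (hdeg : ∀ {i j : ℤ} {x : M.RightMod} {y : N.LeftMod}, x ∈ M.deg i → y ∈ N.deg j →
      g (x ⊗ₜ[B] y) ∈ Z.deg (i + j)) {n : ℤ} {t : TensorCarrier M N} (ht : t ∈ tensorDeg M N n) :
    g t ∈ Z.deg n := by
  induction ht using AddSubgroup.closure_induction with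
  | mem t ht =>
    obtain ⟨k, l, x, y, hx, hy, rfl, rfl⟩ := ht
    exact hdeg hx hy
  | zero => rw [map_zero]; exact zero_mem _
  | add s t _ _ hs ht => rw [map_add]; exact add_mem hs ht
  | neg t _ ht => rw [map_neg]; exact neg_mem ht

/-- Maps out of a tensor product. -/
def tensorDesc {M : GrBimod A B} {N : GrBimod B C} {Z : GrBimod A C} (g : TensorCarrier M N →+ Z)
    (hsmul : ∀ (a : A) (c : C) (x : M.RightMod) (y : N.LeftMod),
      g ((show M.RightMod from (a ⊗ₜ[K] (1 : B)) • x) ⊗ₜ[B]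
        (show N.LeftMod from ((1 : B) ⊗ₜ[K] c) • y)) = (a ⊗ₜ[K] c) • g (x ⊗ₜ[B] y))
    (hdeg : ∀ {i j : ℤ} {x : M.RightMod} {y : N.LeftMod}, x ∈ M.deg i → y ∈ N.deg j →
      g (x ⊗ₜ[B] y) ∈ Z.deg (i + j)) : tensorObj M N ⟶ Z where
  lin :=
    { toFun := g
      map_add' := map_add g
      map_smul' := map_tensorAct_of_tmul g hsmul }
  map_deg := map_mem_of_tmul g hdeg

/-- `A` as an `A`-`D`-bimodule, for a homomorphism `f : D → A`. -/
def leftReg (f : GrAlg.Hom D A) : GrBimod A D :=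
  (restrict (GrAlg.Hom.id A) f).obj (diag A)

theorem leftReg_smul (f : GrAlg.Hom D A) (a : A) (d : D) (x : A) :
    (a ⊗ₜ[K] d) • (show (leftReg f).carrier from x) =
      (show (leftReg f).carrier from a * f.toAlgHom d * x) := by
  change Algebra.TensorProduct.lmul' K (a ⊗ₜ[K] f.toAlgHom d) * x = _
  rw [Algebra.TensorProduct.lmul'_apply_tmul]

section PolyBimodule
open MvPolynomial GrAlg
variable {σ : Type} {w : σ → ℤ}

variable (D w) in
/-- The right `D`-module underlying the bimodule of polynomials. -/
def polyRight : (leftReg (polyC D w)).RightMod ≃ₗ[D] MvPolynomial σ D where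
  toFun x := x
  invFun x := x
  left_inv _ := rfl
  right_inv _ := rfl
  map_add' _ _ := rfl
  map_smul' d x := by
    refine (leftReg_smul (polyC D w) (1 : MvPolynomial σ D) d x).trans ?_
    have h (x : MvPolynomial σ D) : 1 * MvPolynomial.C d * x = d • x := by
      rw [one_mul, smul_eq_C_mul]
    exact h x

variable (w) in
/-- The tensor product with the bimodule of polynomials. -/
def polyTensor (B : GrBimod D A) :
    tensorObj (leftReg (polyC D w)) B ≃+ MvPolynomial σ D ⊗[D] B.LeftMod :=
  (TensorProduct.congr (polyRight D w) (LinearEquiv.refl D B.LeftMod)).toAddEquiv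

theorem polyTensor_smul_left {B : GrBimod D A} (g : MvPolynomial σ D)
    (v : tensorObj (leftReg (polyC D w)) B) :
    polyTensor w B (((show poly D w from g) ⊗ₜ[K] (1 : A)) • v) = g • polyTensor w B v := by
  obtain ⟨v, rfl⟩ := (polyTensor w B).symm.surjective v
  rw [AddEquiv.apply_symm_apply]
  induction v using TensorProduct.induction_on with
  | zero => simp
  | add v v' hv hv' => simp only [map_add, smul_add, hv, hv']
  | tmul h n =>
    have h1 := leftReg_smul (polyC D w) g 1 h
    have h2 : g * MvPolynomial.C 1 * h = g * h := by rw [map_one, mul_one]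
    exact congrArg₂ (fun (x : MvPolynomial σ D) (y : B.LeftMod) => x ⊗ₜ[D] y) (h1.trans h2)
      (one_smul (D ⊗[K] A) n)

theorem polyTensor_smul_right {B : GrBimod D A} (a : A) (v : tensorObj (leftReg (polyC D w)) B) :
    polyTensor w B (((1 : poly D w) ⊗ₜ[K] a) • v) =
      TensorProduct.map LinearMap.id (LeftMod.actR B a) (polyTensor w B v) := by
  obtain ⟨v, rfl⟩ := (polyTensor w B).symm.surjective v
  rw [AddEquiv.apply_symm_apply]
  induction v using TensorProduct.induction_on with
  | zero => simp
  | add v v' hv hv' => simp only [map_add, smul_add, hv, hv']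
  | tmul h n =>
    have h1 : (1 ⊗ₜ[K] 1 : poly D w ⊗[K] D) • (show (leftReg (polyC D w)).carrier from h) = h :=
      one_smul _ _
    exact congrArg (fun (x : MvPolynomial σ D) => x ⊗ₜ[D] (LeftMod.actR B a n : B.LeftMod)) h1

end PolyBimodule

end GrBimod

/-! ### Recovering `B` from `D[t] ⊗_D B` by evaluating the variables on the right -/

namespace GrBimod
open MvPolynomial GrAlg
variable {K : Type u} [Field K] {A D : GrAlg K} {σ : Type} {w : σ → ℤ}

section Eval
variable (t : σ → A)

variable (D) in
/-- The homomorphism `D[σ] → D ⊗ A` with `X_i ↦ 1 ⊗ t_i`. -/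
def actEval : MvPolynomial σ D →ₐ[K] D ⊗[K] A :=
  { eval₂Hom (Algebra.TensorProduct.includeLeft : D →ₐ[K] D ⊗[K] A).toRingHom
      fun i => (1 : D) ⊗ₜ[K] t i with
    commutes' := fun k => (eval₂Hom_C _ _ _).trans
      ((Algebra.TensorProduct.includeLeft : D →ₐ[K] D ⊗[K] A).commutes k) }

theorem actEval_C (d : D) : actEval D t (MvPolynomial.C d) = d ⊗ₜ[K] (1 : A) := eval₂Hom_C _ _ _

theorem actEval_X (i : σ) : actEval D t (X i) = (1 : D) ⊗ₜ[K] t i := eval₂Hom_X' _ _ _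

/-- The elements `t_i`, acting on the right, as an action of a polynomial ring. -/
def rightEval : MvPolynomial σ K →ₐ[K] D ⊗[K] A :=
  (Algebra.TensorProduct.includeRight : A →ₐ[K] D ⊗[K] A).comp (aeval t)

/-- A monomial with coefficient `1` involves only the right action, so it can be evaluated over `K`.
This matches the bimodule action with the coefficient action of `evalCoeff`. -/
theorem actEval_monomial (α : σ →₀ ℕ) :
    actEval D t (monomial α 1) = rightEval (D := D) t (monomial α 1) := by
  have h : ((actEval D t).comp (mapAlgHom (Algebra.ofId K D))) = rightEval t := by
    refine algHom_ext fun i => ?_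
    change actEval D t (MvPolynomial.map _ (X i)) = _
    rw [map_X, actEval_X, rightEval, AlgHom.comp_apply, aeval_X]
    rfl
  rw [← h]
  change _ = actEval D t (MvPolynomial.map _ _)
  rw [map_monomial]
  exact congrArg (fun d => actEval D t (monomial α d)) (map_one (algebraMap K D)).symm

variable (B : GrBimod D A)

/-- The right action of the elements `t_i`. -/
abbrev rightEvalModule : Module (MvPolynomial σ K) B.LeftMod :=
  Module.compHom B.LeftMod (rightEval (D := D) t).toRingHom

variable (w) in
/-- Polynomials with coefficients in a bimodule. -/
def polyTensorFinsupp : tensorObj (leftReg (polyC D w)) B ≃+ ((σ →₀ ℕ) →₀ B.LeftMod) :=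
  (polyTensor w B).trans (tensorEquivFinsupp σ D B.LeftMod).toAddEquiv

theorem polyTensorFinsupp_X_smul (i : σ) (v : tensorObj (leftReg (polyC D w)) B) :
    polyTensorFinsupp w B (((show poly D w from (X i : MvPolynomial σ D)) ⊗ₜ[K] (1 : A)) • v) =
      coeffShift B.LeftMod i (polyTensorFinsupp w B v) :=
  (congrArg (tensorEquivFinsupp σ D B.LeftMod) (polyTensor_smul_left _ v)).trans
    (tensorEquivFinsupp_X_smul _ _)

theorem polyTensorFinsupp_smul_right (i : σ) (v : tensorObj (leftReg (polyC D w)) B) :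
    letI := rightEvalModule t B
    polyTensorFinsupp w B (((1 : poly D w) ⊗ₜ[K] t i) • v) =
      coeffAct K B.LeftMod i (polyTensorFinsupp w B v) := by
  let _ := rightEvalModule t B
  refine (congrArg (tensorEquivFinsupp σ D B.LeftMod) (polyTensor_smul_right _ v)).trans ?_
  change _ = coeffAct K B.LeftMod i (tensorEquivFinsupp σ D B.LeftMod (polyTensor w B v))
  generalize polyTensor w B v = v
  induction v using tensor_monomial_induction with
  | h0 => simp
  | hadd v w hv hw => simp only [map_add, hv, hw]
  | h α n =>
    rw [TensorProduct.map_tmul, LinearMap.id_apply, tensorEquivFinsupp_monomial,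
      tensorEquivFinsupp_monomial, coeffAct_single, one_smul, one_smul]
    congr 1
    change _ = rightEval (D := D) t (X i) • n
    rw [rightEval, AlgHom.comp_apply, aeval_X]
    rfl

variable {t} (ht : ∀ i, t i ∈ A.deg (w i))

/-- The homogeneous element `X_i ⊗ 1 - 1 ⊗ t_i`. -/
def polyOp (i : σ) : Op (poly D w) A where
  elt := (show poly D w from (X i : MvPolynomial σ D)) ⊗ₜ[K] 1 - 1 ⊗ₜ[K] t i
  deg := w i
  mem := sub_mem (tmul_mem_actDeg (A := poly D w) (X_mem_polyDeg i) SetLike.GradedOne.one_mem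
      (add_zero (w i)))
    (tmul_mem_actDeg (A := poly D w) SetLike.GradedOne.one_mem (ht i) (zero_add (w i)))

/-- On polynomials with coefficients in `B`, left multiplication by `X_i` shifts exponents and right
multiplication by `t_i` acts on coefficients, so the sequence is regular for formal reasons. -/
theorem isWeaklyRegular_polyOp {l : List σ} (hl : l.Nodup) :
    RingTheory.Sequence.IsWeaklyRegular (tensorObj (leftReg (polyC D w)) B)
      ((l.map (polyOp (D := D) ht)).map Op.elt) := by
  let _ := rightEvalModule t B
  rw [List.map_map]
  exact isWeaklyRegular_map_sub (R := K) (N := B.LeftMod) (polyTensorFinsupp w B)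
    (polyTensorFinsupp_X_smul B) (polyTensorFinsupp_smul_right t B) hl

include ht in
theorem actEval_mem {n : ℤ} {g : MvPolynomial σ D} (hg : g ∈ polyDeg D w n) :
    actEval D t g ∈ actDeg D A n :=
  eval₂Hom_mem_of_mem_polyDeg one_mem_actDeg mul_mem_actDeg
    (fun i => tmul_mem_actDeg SetLike.GradedOne.one_mem (ht i) (zero_add _)) _
    (fun hd => tmul_mem_actDeg hd SetLike.GradedOne.one_mem (add_zero _)) hg

/-- The homomorphism `D[σ] ⊗ A → D ⊗ A` with `X_i ⊗ 1 ↦ 1 ⊗ t_i`. -/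
def evalActHom : ActHom D A (poly D w) A where
  toAlgHom := Algebra.TensorProduct.lift (show poly D w →ₐ[K] D ⊗[K] A from actEval D t)
    Algebra.TensorProduct.includeRight fun _ _ => Commute.all _ _
  tmul_mem {i j g a} hg ha := by
    have h : actEval D t g * ((1 : D) ⊗ₜ[K] a) ∈ actDeg D A (i + j) := by
      have h1 := tmul_mem_actDeg (SetLike.GradedOne.one_mem (A := D.deg)) ha (zero_add j)
      exact mul_mem_actDeg (actEval_mem ht hg) h1
    exact h

theorem evalActHom_tmul (g : MvPolynomial σ D) (a : A) :
    (evalActHom ht).toAlgHom ((show poly D w from g) ⊗ₜ[K] a) = actEval D t g * ((1 : D) ⊗ₜ[K] a) :=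
  rfl

/-- The action of polynomials on a bimodule. -/
def polyBilin : MvPolynomial σ D →ₗ[D] B.LeftMod →ₗ[D] B.LeftMod :=
  LinearMap.mk₂ D (fun g n => actEval D t g • n)
    (fun g g' n => by rw [map_add, add_smul])
    (fun d g n => by
      rw [smul_eq_C_mul, map_mul, mul_smul, actEval_C]
      rfl)
    (fun g n n' => smul_add _ _ _)
    (fun d g n => by
      rw [LeftMod.smul_def, LeftMod.smul_def, smul_smul, smul_smul, mul_comm])

/-- The action map from polynomials with coefficients in a bimodule to the bimodule. -/
def evalMap : tensorObj (leftReg (polyC D w)) B ⟶ (pull (evalActHom ht)).obj B :=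
  tensorDesc (M := leftReg (polyC D w)) (N := B) (Z := (pull (evalActHom ht)).obj B)
    ((TensorProduct.lift (polyBilin (t := t) B)).toAddMonoidHom.comp
      (polyTensor w B).toAddMonoidHom)
    (fun g a x n => by
      have h1 := leftReg_smul (polyC D w) g 1 (show poly D w from x)
      have h2 (g x : MvPolynomial σ D) : g * MvPolynomial.C 1 * x = g * x := by
        rw [map_one, mul_one]
      have h3 : actEval D t ((show MvPolynomial σ D from g) * (show MvPolynomial σ D from
          x)) • ((1 : D) ⊗ₜ[K] a) • n =
          (actEval D t (show MvPolynomial σ D from g) * ((1 : D) ⊗ₜ[K] a)) •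
            actEval D t (show MvPolynomial σ D from x) • n := by
        rw [map_mul, smul_smul, smul_smul, mul_right_comm]
      exact (congrArg (fun y : MvPolynomial σ D => actEval D t y • (show B.LeftMod from
        ((1 : D) ⊗ₜ[K] a) • n)) (h1.trans (h2 _ _))).trans h3)
    (fun {i j x n} hx hn => by
      exact B.actDeg_smul_mem (actEval_mem ht hx) hn)

theorem evalMap_tmul (g : MvPolynomial σ D) (n : B.LeftMod) :
    (evalMap B ht).lin (show TensorCarrier (leftReg (polyC D w)) B from
      (show (leftReg (polyC D w)).RightMod from g) ⊗ₜ[D] n) =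
      (actEval D t g • n : B.LeftMod) := rfl

theorem evalMap_surjective : Function.Surjective (evalMap B ht).lin := fun n => by
  have h (n : B.LeftMod) : actEval D t 1 • n = n := by rw [map_one, one_smul]
  exact ⟨_, (evalMap_tmul B ht 1 n).trans (h n)⟩

theorem evalMap_eq (v : tensorObj (leftReg (polyC D w)) B) :
    letI := rightEvalModule t B
    (evalMap B ht).lin v = (evalCoeff K B.LeftMod (polyTensorFinsupp w B v) : B.LeftMod) := by
  let _ := rightEvalModule t B
  change TensorProduct.lift (polyBilin (t := t) B) (polyTensor w B v) =
    evalCoeff K B.LeftMod (tensorEquivFinsupp σ D B.LeftMod (polyTensor w B v))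
  generalize polyTensor w B v = v
  induction v using tensor_monomial_induction with
  | h0 => simp
  | hadd v w hv hw => simp only [map_add, hv, hw]
  | h α n =>
    rw [tensorEquivFinsupp_monomial, evalCoeff_single, one_smul, TensorProduct.lift.tmul]
    change actEval D t (monomial α 1) • n = rightEval (D := D) t (monomial α 1) • n
    rw [actEval_monomial]

/-- Evaluation is the substitution of the right actions for all the variables. Together with
surjectivity this identifies `B` as the quotient of `D[t] ⊗_D B` by the first family of operators.
-/
theorem ker_evalMap {l : List σ} (hl : ∀ i, i ∈ l) : LinearMap.ker (evalMap B ht).lin =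
    Ideal.ofList ((l.map (polyOp (D := D) ht)).map Op.elt) • ⊤ := by
  let _ := rightEvalModule t B
  ext v
  rw [List.map_map, LinearMap.mem_ker, evalMap_eq]
  exact (mem_ofList_smul_top_iff_evalCoeff (R := K) (N := B.LeftMod) (polyTensorFinsupp w B)
    (polyTensorFinsupp_X_smul B) (polyTensorFinsupp_smul_right t B) hl v).symm

/-- The action map is natural. -/
def evalNat : tensorLeft (C := A) (leftReg (polyC D w)) ⟶ pull (evalActHom ht) where
  app B := evalMap B ht
  naturality B B' φ := tensor_hom_ext fun x n => by
    exact (LinearMap.map_smul φ.lin (actEval D t (x : MvPolynomial σ D)) n).symm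

end Eval

end GrBimod

/-! ### Recovering `A ⊗_D B` from `D[t] ⊗_D B` by imposing the relations -/

namespace GrBimod
open MvPolynomial GrAlg
variable {K : Type u} [Field K] {A D : GrAlg K} {σ : Type} {w : σ → ℤ}

section Quotient
variable {ι : Type} {x : ι → MvPolynomial σ D} {v : ι → ℤ} (hx : ∀ k, x k ∈ polyDeg D w (v k))

variable (A) in
/-- The homogeneous element `x_k ⊗ 1`. -/
def relOp (k : ι) : Op (poly D w) A where
  elt := (show poly D w from x k) ⊗ₜ[K] 1
  deg := v k
  mem := tmul_mem_actDeg (A := poly D w) (hx k) SetLike.GradedOne.one_mem (add_zero (v k))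

theorem isWeaklyRegular_relOp (B : GrBimod D A) {l : List ι}
    (h : RingTheory.Sequence.IsWeaklyRegular (MvPolynomial σ D ⊗[D] B.LeftMod) (l.map x)) :
    RingTheory.Sequence.IsWeaklyRegular (tensorObj (leftReg (polyC D w)) B)
      ((l.map (relOp A hx)).map Op.elt) := by
  rw [List.map_map]
  refine (AddEquiv.isWeaklyRegular_congr (e := polyTensor w B) ?_).2 h
  rw [List.forall₂_map_left_iff, List.forall₂_map_right_iff, List.forall₂_same]
  exact fun k _ y => polyTensor_smul_left (x k) y

variable (f : GrAlg.Hom D A) {t : σ → A} (ht : ∀ i, t i ∈ A.deg (w i))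

theorem polyEval_C (d : D) :
    (polyEval f t ht).toAlgHom (show poly D w from MvPolynomial.C d) = f.toAlgHom d :=
  eval₂Hom_C _ _ _

theorem polyEval_X (i : σ) :
    (polyEval f t ht).toAlgHom (show poly D w from (X i : MvPolynomial σ D)) = t i :=
  eval₂Hom_X' _ _ _

/-- Evaluation as a map of right modules. -/
def evalRight : MvPolynomial σ D →ₗ[D] (leftReg f).RightMod where
  toFun g := (polyEval f t ht).toAlgHom (show poly D w from g)
  map_add' g h := map_add (polyEval f t ht).toAlgHom (show poly D w from g) h
  map_smul' d g := by
    refine Eq.trans ?_ (leftReg_smul f 1 d ((polyEval f t ht).toAlgHom (show poly D w from g))).symm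
    have h : (polyEval f t ht).toAlgHom (show poly D w from d • g) =
        (polyEval f t ht).toAlgHom ((show poly D w from MvPolynomial.C d) * (show poly D w
            from g)) :=
      congrArg _ (smul_eq_C_mul g d)
    rw [one_mul]
    exact h.trans ((map_mul _ _ _).trans (congrArg (· * _) (polyEval_C f ht d)))

/-- The homomorphism `D[σ] ⊗ A → A ⊗ A`. -/
abbrev quotActHom : ActHom A A (poly D w) A := ActHom.ofHoms (polyEval f t ht) (GrAlg.Hom.id A)

variable (B : GrBimod D A)

/-- The projection from polynomials with coefficients in a bimodule to the induced bimodule. -/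
def quotMap : tensorObj (leftReg (polyC D w)) B ⟶
    (pull (quotActHom f ht)).obj (tensorObj (leftReg f) B) :=
  tensorDesc (M := leftReg (polyC D w)) (N := B)
    (Z := (pull (quotActHom f ht)).obj (tensorObj (leftReg f) B))
    ((LinearMap.rTensor B.LeftMod (evalRight f ht)).toAddMonoidHom.comp
      (polyTensor w B).toAddMonoidHom)
    (fun g a y n => by
      have h1 := leftReg_smul (polyC D w) g 1 (show poly D w from y)
      have h2 (g y : MvPolynomial σ D) : g * MvPolynomial.C 1 * y = g * y := by
        rw [map_one, mul_one]
      let ρ := (polyEval f t ht).toAlgHom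
      have h3 := leftReg_smul f (ρ g) 1 (ρ y)
      have h4 : ρ (g * (show poly D w from y)) = ρ g * f.toAlgHom 1 * ρ y := by
        rw [map_one, mul_one, map_mul]
      exact congrArg (fun z : (leftReg f).RightMod => z ⊗ₜ[D] (show B.LeftMod from
        ((1 : D) ⊗ₜ[K] a) • n)) ((congrArg ρ (h1.trans (h2 _ _))).trans (h4.trans h3.symm)))
    (fun {i j y n} hy hn => by
      exact tmul_mem_tensorDeg (M := leftReg f) (N := B) ((polyEval f t ht).map_deg hy) hn rfl)

theorem quotMap_eq (y : tensorObj (leftReg (polyC D w)) B) : (quotMap f ht B).lin y =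
    LinearMap.rTensor B.LeftMod (evalRight f ht) (polyTensor w B y) := rfl

variable {f} (hf : Function.Surjective (eval₂Hom f.toAlgHom.toRingHom t))

include hf in
theorem evalRight_surjective : Function.Surjective (evalRight f ht) := hf

include hf in
theorem quotMap_surjective : Function.Surjective (quotMap f ht B).lin := fun z => by
  obtain ⟨y, hy⟩ := LinearMap.rTensor_surjective B.LeftMod (evalRight_surjective ht hf) z
  obtain ⟨y, rfl⟩ := (polyTensor w B).surjective y
  exact ⟨y, hy⟩

variable (hker : RingHom.ker (eval₂Hom f.toAlgHom.toRingHom t) = Ideal.span (Set.range x))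

theorem tmul_one_mem_ofList {l : List ι} (hl : ∀ k, k ∈ l) {g : MvPolynomial σ D}
    (hg : g ∈ Ideal.span (Set.range x)) :
    (show poly D w from g) ⊗ₜ[K] (1 : A) ∈ Ideal.ofList ((l.map (relOp A hx)).map Op.elt) := by
  have : Ideal.span (Set.range x) ≤ (Ideal.ofList ((l.map (relOp A hx)).map Op.elt)).comap
      (Algebra.TensorProduct.includeLeft : poly D w →ₐ[K] poly D w ⊗[K] A) := by
    refine Ideal.span_le.2 ?_
    rintro _ ⟨k, rfl⟩
    exact Ideal.subset_span (List.mem_map.2 ⟨_, List.mem_map.2 ⟨k, hl k, rfl⟩, rfl⟩)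
  exact this hg

include hf hker in
-- By right exactness of the tensor product, the kernel is the image of the tensor product of `B`
-- with the ideal of relations.
theorem ker_quotMap {l : List ι} (hl : ∀ k, k ∈ l) : LinearMap.ker (quotMap f ht B).lin =
    Ideal.ofList ((l.map (relOp A hx)).map Op.elt) • ⊤ := by
  apply le_antisymm
  · intro y hy
    rw [LinearMap.mem_ker, quotMap_eq] at hy
    have hex : Function.Exact (LinearMap.ker (evalRight f ht)).subtype (evalRight f ht) :=
      LinearMap.exact_subtype_ker_map _
    obtain ⟨z, hz⟩ := (rTensor_exact B.LeftMod hex (evalRight_surjective ht hf) _).1 hy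
    rw [← AddEquiv.symm_apply_eq] at hz
    rw [← hz]
    clear hz hy
    induction z using TensorProduct.induction_on with
    | zero => rw [map_zero, map_zero]; exact zero_mem _
    | add z z' hz hz' => rw [map_add, map_add]; exact add_mem hz hz'
    | tmul g n =>
      have hg : g.1 ∈ Ideal.span (Set.range x) := by
        rw [← hker]
        exact g.2
      have h : (polyTensor w B).symm (g.1 ⊗ₜ[D] n) = ((show poly D w from g.1) ⊗ₜ[K] (1 : A)) •
          (polyTensor w B).symm (1 ⊗ₜ[D] n) := by
        rw [AddEquiv.symm_apply_eq, polyTensor_smul_left, AddEquiv.apply_symm_apply,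
          TensorProduct.smul_tmul', smul_eq_mul, mul_one]
      rw [LinearMap.rTensor_tmul]
      exact h ▸ Submodule.smul_mem_smul (tmul_one_mem_ofList hx hl hg) trivial
  · rw [Submodule.smul_le]
    intro r hr y _
    have h : Ideal.ofList ((l.map (relOp A hx)).map Op.elt) ≤
        RingHom.ker (quotActHom f ht).toAlgHom := by
      refine Ideal.span_le.2 ?_
      intro z hz
      obtain ⟨o, ho, rfl⟩ := List.mem_map.1 hz
      obtain ⟨k, -, rfl⟩ := List.mem_map.1 ho
      have h1 : x k ∈ RingHom.ker (eval₂Hom f.toAlgHom.toRingHom t) := by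
        rw [hker]
        exact Ideal.subset_span ⟨k, rfl⟩
      change (polyEval f t ht).toAlgHom (show poly D w from x k) ⊗ₜ[K] (1 : A) = 0
      have h2 : (polyEval f t ht).toAlgHom (show poly D w from x k) = 0 := h1
      rw [h2, TensorProduct.zero_tmul]
    have h0 (s : A ⊗[K] A) (hs : s = 0) (u : tensorObj (leftReg f) B) : s • u = 0 := by
      rw [hs, zero_smul]
    rw [LinearMap.mem_ker, map_smul]
    exact h0 _ (h hr) _

/-- The projection is natural. -/
def quotNat (f : GrAlg.Hom D A) : tensorLeft (C := A) (leftReg (polyC D w)) ⟶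
    tensorLeft (leftReg f) ⋙ pull (quotActHom f ht) where
  app B := quotMap f ht B
  naturality _ _ _ := tensor_hom_ext fun _ _ => rfl

end Quotient

end GrBimod

/-! ### Comparing the two quotients -/

namespace GrBimod
open MvPolynomial GrAlg
variable {K : Type u} [Field K] {A B C D A' B' A'' B'' : GrAlg K}

theorem coneList_append (zs ws : List (Op A B)) (X : CochainComplex (GrBimod A B) ℤ) :
    coneList (zs ++ ws) X = coneList ws (coneList zs X) := List.foldl_append

theorem coneList_qC (zs : List (Op A B)) (s : ℤ) (X : CochainComplex (GrBimod A B) ℤ) :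
    Nonempty ((qC A B s).obj (coneList zs X) ≅ coneList zs ((qC A B s).obj X)) :=
  Intertwines.coneList (List.forall₂_same.2 fun z _ => intertwines_qShift s z) X

theorem coneList_pullC (ψ : ActHom A B A' B') (zs : List (Op A' B'))
    (X : CochainComplex (GrBimod A B) ℤ) :
    Nonempty ((pullC ψ).obj (coneList (zs.map (Op.push ψ)) X) ≅
      coneList zs ((pullC ψ).obj X)) :=
  Intertwines.coneList (List.forall₂_map_left_iff.2 (List.forall₂_same.2 fun z _ =>
    intertwines_pull ψ z)) X

theorem coneList_qC_pullC (ψ : ActHom A B A' B') (zs : List (Op A' B')) (s : ℤ)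
    (X : CochainComplex (GrBimod A B) ℤ) :
    Nonempty ((qC A' B' s).obj ((pullC ψ).obj (coneList (zs.map (Op.push ψ)) X)) ≅
      coneList zs ((qC A' B' s).obj ((pullC ψ).obj X))) :=
  ⟨(qC A' B' s).mapIso (coneList_pullC ψ zs X).some ≪≫ (coneList_qC zs s _).some⟩

/-- Tensoring a complex with a bimodule on the left. -/
abbrev tensorLeftCx (M : GrBimod A B) :
    CochainComplex (GrBimod B C) ℤ ⥤ CochainComplex (GrBimod A C) ℤ :=
  (tensorLeft M).mapHomologicalComplex (ComplexShape.up ℤ)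

section
variable {σ ι : Type} {w : σ → ℤ} {x : ι → MvPolynomial σ D} {v : ι → ℤ}

/-- If `A = D[t] / (x)`, then closing the variables `t` on `A ⊗ B` amounts to imposing the
relations `x` on `B`. -/
theorem coneList_leftReg_qEquiv (hx : ∀ k, x k ∈ polyDeg D w (v k)) {f : GrAlg.Hom D A}
    {t : σ → A} (ht : ∀ i, t i ∈ A.deg (w i))
    (hf : Function.Surjective (eval₂Hom f.toAlgHom.toRingHom t))
    (hker : RingHom.ker (eval₂Hom f.toAlgHom.toRingHom t) = Ideal.span (Set.range x))
    {l : List ι} (hl : ∀ k, k ∈ l) {m : List σ} (hm : ∀ i, i ∈ m) (hm' : m.Nodup)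
    (hreg : ∀ B : GrBimod D A,
      RingTheory.Sequence.IsWeaklyRegular (MvPolynomial σ D ⊗[D] B.LeftMod) (l.map x))
    (B : CochainComplex (GrBimod D A) ℤ) :
    QEquiv ((qC (poly D w) A (-(l.map v).sum)).obj ((pullC (quotActHom f ht)).obj
        (coneList ((m.map (polyOp ht)).map (Op.push (quotActHom f ht)))
          ((tensorLeftCx (leftReg f)).obj B))))
      ((qC (poly D w) A (-(m.map w).sum)).obj ((pullC (evalActHom ht)).obj
        (coneList ((l.map (relOp A hx)).map (Op.push (evalActHom ht))) B))) := by
  have e1 := coneList_qEquiv_of_isWeaklyRegular (m.map (polyOp ht))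
    ((NatTrans.mapHomologicalComplex (evalNat ht) (ComplexShape.up ℤ)).app B)
    (fun i => isWeaklyRegular_polyOp (B.X i) ht hm') (fun i => evalMap_surjective (B.X i) ht)
    (fun i => ker_evalMap (B.X i) ht hm)
  have e2 := coneList_qEquiv_of_isWeaklyRegular (l.map (relOp A hx))
    ((NatTrans.mapHomologicalComplex (quotNat ht f) (ComplexShape.up ℤ)).app B)
    (fun i => isWeaklyRegular_relOp hx (B.X i) (hreg (B.X i)))
    (fun i => quotMap_surjective ht (B.X i) hf)
    (fun i => ker_quotMap hx ht (B.X i) hf hker hl)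
  have hd1 : (m.map (polyOp (D := D) ht)).map Op.deg = m.map w := by
    rw [List.map_map]; rfl
  have hd2 : (l.map (relOp A hx)).map Op.deg = l.map v := by
    rw [List.map_map]; rfl
  rw [hd1] at e1
  rw [hd2] at e2
  -- Both sides are compared with the cone of `D[t] ⊗_D B` over both families: `e2` replaces the
  -- cone over the relations by `A ⊗_D B`, `e1` replaces the cone over the variables by `B`, and the
  -- two families of cones are interchanged in between.
  refine (QEquiv.of_nonempty_iso (coneList_qC_pullC _ _ _ _)).trans ?_
  refine (coneList_qEquiv _ e2.symm).trans ?_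
  refine (QEquiv.of_nonempty_iso (coneList_coneList _ _ _)).trans ?_
  refine (coneList_qEquiv _ e1).trans ?_
  exact (QEquiv.of_nonempty_iso (coneList_qC_pullC _ _ _ _)).symm

end

/-- The right unitor `B ⊗_A A ≅ B`, with the right action restricted along `D → A`. -/
def tensorLeftRegMap (f : GrAlg.Hom D A) (B : GrBimod C A) :
    tensorObj B (leftReg f) ⟶ (pull (ActHom.ofHoms (GrAlg.Hom.id C) f)).obj B :=
  tensorDesc (M := B) (N := leftReg f) (Z := (pull (ActHom.ofHoms (GrAlg.Hom.id C) f)).obj B)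
    (TensorProduct.lift (LinearMap.mk₂ A (fun (y : B.RightMod) (a : (leftReg f).LeftMod) =>
        (show A from a) • y)
      (fun y y' a => smul_add _ y y')
      (fun c y a => by rw [smul_smul, smul_smul, mul_comm])
      (fun y a a' => add_smul (show A from a) (show A from a') y)
      (fun c y a => by
        have h := leftReg_smul f c 1 (show A from a)
        rw [map_one, mul_one] at h
        rw [smul_smul]
        exact congrArg (fun c : A => c • y) h))).toAddMonoidHom
    (fun c d y a => by
      have h := leftReg_smul f 1 d (show A from a)
      rw [one_mul] at h
      refine (congrArg (fun e : A => e • (show B.RightMod from (c ⊗ₜ[K] (1 : A)) • y)) h).trans ?_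
      change ((1 : C) ⊗ₜ[K] (f.toAlgHom d * (show A from a))) • (c ⊗ₜ[K] (1 : A)) • y =
        (c ⊗ₜ[K] f.toAlgHom d) • ((1 : C) ⊗ₜ[K] (show A from a)) • y
      rw [smul_smul, smul_smul, Algebra.TensorProduct.tmul_mul_tmul,
        Algebra.TensorProduct.tmul_mul_tmul, one_mul, mul_one, mul_one])
    (fun {i j y a} hy ha => by
      have := RightMod.smul_mem B ha hy
      rwa [add_comm] at this)

/-- The inverse is `y ↦ y ⊗ 1`. -/
theorem tensorLeftRegMap_bijective (f : GrAlg.Hom D A) (B : GrBimod C A) :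
    Function.Bijective (tensorLeftRegMap f B).lin := by
  have h1 : ∀ (y : B.RightMod) (a : A), (tensorLeftRegMap f B).lin
      (show TensorCarrier B (leftReg f) from y ⊗ₜ[A] (show (leftReg f).LeftMod from a)) =
      (show B.RightMod from a • y) := fun _ _ => rfl
  let s : B.RightMod →+ TensorCarrier B (leftReg f) :=
    (tmulHom B (leftReg f)).flip (show (leftReg f).LeftMod from (1 : A))
  let g : TensorCarrier B (leftReg f) →+ B.RightMod :=
    (tensorLeftRegMap f B).lin.toAddMonoidHom
  have h2 : ∀ z : TensorCarrier B (leftReg f), s (g z) = z := by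
    intro z
    induction z using TensorProduct.induction_on with
    | zero => rw [map_zero, map_zero]
    | add z z' hz hz' => rw [map_add, map_add, hz, hz']
    | tmul y a =>
      refine (TensorProduct.smul_tmul (show A from a) y _).trans ?_
      have h := leftReg_smul f (show A from a) 1 1
      rw [map_one, mul_one, mul_one] at h
      exact congrArg (fun c : (leftReg f).LeftMod => y ⊗ₜ[A] c) h
  constructor
  · intro z z' h
    exact (h2 z).symm.trans ((congrArg s h).trans (h2 z'))
  · intro y
    exact ⟨_, (h1 y 1).trans (one_smul A (show B.RightMod from y))⟩

/-- The right unitor as a natural isomorphism. -/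
def tensorRightLeftReg (f : GrAlg.Hom D A) :
    tensorRight (A := C) (leftReg f) ≅ pull (ActHom.ofHoms (GrAlg.Hom.id C) f) :=
  NatIso.ofComponents (fun B => isoOfBijective (tensorLeftRegMap f B)
    (tensorLeftRegMap_bijective f B)) fun φ => tensor_hom_ext fun y a =>
      (RightMod.lin φ).map_smul (show A from a) y |>.symm

end GrBimod

/-! ### Partial traces as iterated cones -/

namespace GrBimod
variable {K : Type u} [Field K] {A B A' B' A'' B'' : GrAlg K}

/-- The iterated mapping cone, shifted and restricted along a homomorphism. -/
abbrev closing (ψ : ActHom A B A' B') (zs : List (Op A B)) (n : ℤ)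
    (X : CochainComplex (GrBimod A B) ℤ) : CochainComplex (GrBimod A' B') ℤ :=
  ((pullC ψ).obj (coneList zs X))⟦n⟧

theorem closing_iso (ψ : ActHom A B A' B') (zs : List (Op A B)) (n : ℤ)
    {X Y : CochainComplex (GrBimod A B) ℤ} (e : Nonempty (X ≅ Y)) :
    Nonempty (closing ψ zs n X ≅ closing ψ zs n Y) :=
  ⟨(shiftFunctor _ n).mapIso ((pullC ψ).mapIso (coneList_iso zs e).some)⟩

/-- The outer operators act through `ψ`, so they can be applied before restriction; the two closings
then form a single one, with cohomological shifts added. -/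
theorem closing_closing (ψ : ActHom A B A' B') (φ : ActHom A' B' A'' B'') (zs : List (Op A B))
    (ws : List (Op A' B')) {m n r : ℤ} (h : m + n = r) (X : CochainComplex (GrBimod A B) ℤ) :
    Nonempty (closing φ ws n (closing ψ zs m X) ≅
      closing (ψ.comp φ) (zs ++ ws.map (Op.push ψ)) r X) := by
  let F := pullC φ
  let Y := coneList zs X
  have h3 := (coneList_shift ws ((pullC ψ).obj Y) m).some
  have h4 := (coneList_pullC ψ ws Y).some
  rw [show closing (ψ.comp φ) (zs ++ ws.map (Op.push ψ)) r X =
    ((pullC (ψ.comp φ)).obj (coneList (ws.map (Op.push ψ)) Y))⟦r⟧ by rw [closing, coneList_append]]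
  exact ⟨(shiftFunctor _ n).mapIso (F.mapIso h3 ≪≫ (F.commShiftIso m).app _ ≪≫
    (shiftFunctor _ m).mapIso (F.mapIso h4.symm)) ≪≫
    ((shiftFunctorAdd' _ m n r h).app ((pullC (ψ.comp φ)).obj _)).symm⟩

end GrBimod

namespace Web
open GrBimod
variable {K : Type u} [Field K]

variable (K) in
/-- The operator `e_i ⊗ 1 - 1 ⊗ e_i`. -/
def blockOp (p : List ℕ) (k i : ℕ) : Op (invRing K (p ++ [k])) (invRing K (p ++ [k])) :=
  Op.comm (lastElem_mem p k i)

variable (K) in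
/-- The operators `e_i ⊗ 1 - 1 ⊗ e_i` which close the last strand. -/
def blockOps (p : List ℕ) (k : ℕ) : List (Op (invRing K (p ++ [k])) (invRing K (p ++ [k]))) :=
  (List.finRange k).map fun j : Fin k => blockOp K p k (k - j.val)

variable (K) in
/-- Restriction to the ring of invariants of the tuple with its last entry removed. -/
def restrictLast (p : List ℕ) (k : ℕ) :
    ActHom (invRing K (p ++ [k])) (invRing K (p ++ [k])) (invRing K p) (invRing K p) :=
  ActHom.ofHoms (inclHom (invariants_le_concat p k)) (inclHom (invariants_le_concat p k))

theorem length_blockOps (p : List ℕ) (k : ℕ) : (blockOps K p k).length = k := by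
  rw [blockOps, List.length_map, List.length_finRange]

/-- `blockOps` lists the operators of `e_k, …, e_1` because `coneList` starts with the innermost
cone, whereas `partialTrace` is a right fold over `e_1, …, e_k` with `e_k` innermost. -/
theorem reverse_blockOps (p : List ℕ) (k : ℕ) : (blockOps K p k).reverse =
    (List.range k).map fun i => blockOp K p k (i + 1) := by
  refine List.ext_getElem (by simp [length_blockOps]) fun i h1 h2 => ?_
  have hi : i < k := by simpa [length_blockOps] using h1
  have hk : k - (k - 1 - i) = i + 1 := by omega
  simp [blockOps, hk]

/-- The partial trace as an iterated mapping cone. -/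
theorem partialTrace_iso (p : List ℕ) (k : ℕ)
    (M : CochainComplex (GrBimod (invRing K (p ++ [k])) (invRing K (p ++ [k]))) ℤ) :
    Nonempty (partialTrace p k M ≅
      closing (restrictLast K p k) (blockOps K p k) (-(k : ℤ)) M) := by
  have h := foldr_mappingCocone (blockOps K p k).reverse M
  rw [List.reverse_reverse, List.length_reverse, length_blockOps, reverse_blockOps,
    List.foldr_map] at h
  exact ⟨(pullC (restrictLast K p k)).mapIso h.some ≪≫
    ((pullC (restrictLast K p k)).commShiftIso (-(k : ℤ))).app _⟩

theorem partialTrace_partialTrace_iso (p : List ℕ) (a b : ℕ)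
    (X : CochainComplex
      (GrBimod (invRing K (p ++ [a] ++ [b])) (invRing K (p ++ [a] ++ [b]))) ℤ) :
    Nonempty (partialTrace p a (partialTrace (p ++ [a]) b X) ≅
      closing ((restrictLast K (p ++ [a]) b).comp (restrictLast K p a))
        (blockOps K (p ++ [a]) b ++ (blockOps K p a).map (Op.push (restrictLast K (p ++ [a]) b)))
        (-((a + b : ℕ) : ℤ)) X) :=
  ⟨(partialTrace_iso p a (partialTrace (p ++ [a]) b X)).some ≪≫
    (closing_iso _ _ _ (partialTrace_iso (p ++ [a]) b X)).some ≪≫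
    (closing_closing _ _ _ _ (by push_cast; ring) X).some⟩

end Web

/-! ### The trace comparison for an algebra given by generators and relations -/

namespace GrAlg
variable {K : Type u} [Field K] {A B C : GrAlg K}

/-- Composition of homomorphisms. -/
def Hom.comp (g : Hom B C) (f : Hom A B) : Hom A C where
  toAlgHom := g.toAlgHom.comp f.toAlgHom
  map_deg hx := g.map_deg (f.map_deg hx)

end GrAlg

namespace GrBimod
open MvPolynomial GrAlg
variable {K : Type u} [Field K] {A B C D P A' B' A'' B'' : GrAlg K}

theorem ActHom.ext_tmul {ψ φ : ActHom A B A' B'}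
    (h : ∀ a b, ψ.toAlgHom (a ⊗ₜ[K] b) = φ.toAlgHom (a ⊗ₜ[K] b)) : ψ = φ := by
  obtain ⟨e, he⟩ := ψ
  obtain ⟨e', he'⟩ := φ
  obtain rfl : e = e' := Algebra.TensorProduct.ext' h
  rfl

theorem Op.ext_elt {z z' : Op A B} (h : z.elt = z'.elt) (hd : z.deg = z'.deg) : z = z' := by
  obtain ⟨e, d, hz⟩ := z
  obtain ⟨e', d', hz'⟩ := z'
  dsimp only at h hd
  subst h hd
  rfl

/-- Tensoring a complex with a bimodule on the right. -/
abbrev tensorRightCx (N : GrBimod B C) :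
    CochainComplex (GrBimod A B) ℤ ⥤ CochainComplex (GrBimod A C) ℤ :=
  (tensorRight N).mapHomologicalComplex (ComplexShape.up ℤ)

/-- Composition of grading shifts of complexes. -/
def qCAdd {s t r : ℤ} (h : s + t = r) : qC A B s ⋙ qC A B t ≅ qC A B r :=
  NatIso.mapHomologicalComplex (qShiftAdd h) (ComplexShape.up ℤ)

/-- The trivial grading shift of complexes. -/
def qCZero (X : CochainComplex (GrBimod A B) ℤ) : (qC A B 0).obj X ≅ X :=
  HomologicalComplex.Hom.isoOfComponents (fun i => qShiftZero.app (X.X i)) fun i j _ =>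
    (qShiftZero.hom.naturality (X.d i j)).symm

theorem qEquiv_of_qC {s t : ℤ} {X Y : CochainComplex (GrBimod A B) ℤ}
    (h : QEquiv ((qC A B (-s)).obj X) ((qC A B (-t)).obj Y)) :
    QEquiv X ((qC A B (s - t)).obj Y) := by
  refine (QEquiv.of_iso ?_).trans ((h.map (qShift A B s)).trans (QEquiv.of_iso ?_))
  · exact (qCZero X).symm ≪≫ (qCAdd (neg_add_cancel s)).symm.app X
  · exact (qCAdd (show -t + s = s - t by ring)).app Y

section
variable {σ ι : Type} {w : σ → ℤ} {x : ι → MvPolynomial σ D} {v : ι → ℤ}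

/-- This restricts `coneList_leftReg_qEquiv` to `P` on both sides. The hypothesis `hxc` says that on
`B` the `k`-th relation acts as the difference of the two actions of `c k`, so imposing the
relations closes `B` as a `D`-`D`-bimodule. The grading shift is the total degree of the relations
minus that of the variables. -/
theorem closing_leftReg_qEquiv (hx : ∀ k, x k ∈ polyDeg D w (v k)) {f : GrAlg.Hom D A}
    {t : σ → A} (ht : ∀ i, t i ∈ A.deg (w i))
    (hf : Function.Surjective (eval₂Hom f.toAlgHom.toRingHom t))
    (hker : RingHom.ker (eval₂Hom f.toAlgHom.toRingHom t) = Ideal.span (Set.range x))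
    {l : List ι} (hl : ∀ k, k ∈ l) {m : List σ} (hm : ∀ i, i ∈ m) (hm' : m.Nodup)
    (hreg : ∀ B : GrBimod D A,
      RingTheory.Sequence.IsWeaklyRegular (MvPolynomial σ D ⊗[D] B.LeftMod) (l.map x))
    {c : ι → D} (hc : ∀ k, c k ∈ D.deg (v k))
    (hxc : ∀ k, actEval D t (x k) = (1 : D) ⊗ₜ[K] f.toAlgHom (c k) - c k ⊗ₜ[K] (1 : A))
    (g : GrAlg.Hom P D) (n : ℤ) (B : CochainComplex (GrBimod D A) ℤ) :
    QEquiv (closing (ActHom.ofHoms (f.comp g) (f.comp g)) (m.map fun i => Op.comm (ht i)) n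
        ((tensorLeftCx (leftReg f)).obj B))
      ((qC P P ((l.map v).sum - (m.map w).sum)).obj
        (closing (ActHom.ofHoms g g) (l.map fun k => Op.comm (hc k)) n
          ((tensorRightCx (leftReg f)).obj B))) := by
  -- The comparison lives over `D[t]` and `A`. Pulled back along `η`, the actions agree on one side
  -- with restriction from `A`-`A`-bimodules, and on the other with restriction from
  -- `D`-`D`-bimodules.
  let η : ActHom (poly D w) A P P := ActHom.ofHoms ((polyC D w).comp g) (f.comp g)
  have hη1 : (quotActHom f ht).comp η = ActHom.ofHoms (f.comp g) (f.comp g) :=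
    ActHom.ext_tmul fun y z => congrArg (fun y : A => y ⊗ₜ[K] f.toAlgHom (g.toAlgHom z))
      (polyEval_C f ht (g.toAlgHom y))
  have hη2 : (evalActHom ht).comp η =
      (ActHom.ofHoms (GrAlg.Hom.id D) f).comp (ActHom.ofHoms g g) :=
    ActHom.ext_tmul fun y z => by
      have h : actEval D t (MvPolynomial.C (g.toAlgHom y)) *
          ((1 : D) ⊗ₜ[K] f.toAlgHom (g.toAlgHom z)) =
          g.toAlgHom y ⊗ₜ[K] f.toAlgHom (g.toAlgHom z) := by
        rw [actEval_C, Algebra.TensorProduct.tmul_mul_tmul, one_mul, mul_one]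
      exact h
  have hops : (m.map (polyOp ht)).map (Op.push (quotActHom f ht)) = m.map fun i => Op.comm
      (ht i) := by
    rw [List.map_map]
    refine List.map_congr_left fun i _ => Op.ext_elt ?_ rfl
    refine (map_sub (quotActHom f ht).toAlgHom _ _).trans (congrArg₂ (· - ·) ?_ ?_)
    · exact congrArg₂ (fun y z : A => y ⊗ₜ[K] z) (polyEval_X f ht i) (map_one (AlgHom.id K A))
    · exact congrArg (fun y : A => y ⊗ₜ[K] t i) (map_one (polyEval f t ht).toAlgHom)
  have hrel : Nonempty (closing (ActHom.ofHoms g g) (l.map fun k => Op.comm (hc k)) n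
      ((tensorRightCx (leftReg f)).obj B) ≅ closing ((evalActHom ht).comp η)
        ((l.map (relOp A hx)).map (Op.push (evalActHom ht))) n B) := by
    have e1 := Intertwines.coneList (F := pull (ActHom.ofHoms (GrAlg.Hom.id D) f))
      (zs := (l.map (relOp A hx)).map (Op.push (evalActHom ht)))
      (zs' := l.map fun k => Op.comm (hc k)) (by
        rw [List.map_map, List.forall₂_map_left_iff, List.forall₂_map_right_iff, List.forall₂_same]
        intro k _
        -- The relation acts as `1 ⊗ f(c_k) - c_k ⊗ 1`, the negative of the closing operator.
        refine intertwines_pull_of_eq_neg _ _ _ ?_ rfl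
        have h1 : (evalActHom ht).toAlgHom ((show poly D w from x k) ⊗ₜ[K] (1 : A)) =
            (1 : D) ⊗ₜ[K] f.toAlgHom (c k) - c k ⊗ₜ[K] (1 : A) := by
          rw [evalActHom_tmul, hxc]
          exact mul_one _
        refine (map_sub (ActHom.ofHoms (GrAlg.Hom.id D) f).toAlgHom _ _).trans ?_
        refine Eq.trans ?_ (congrArg Neg.neg h1).symm
        refine Eq.trans ?_ (neg_sub _ _).symm
        exact congrArg (fun y : A => c k ⊗ₜ[K] y - (1 : D) ⊗ₜ[K] f.toAlgHom (c k))
          (map_one f.toAlgHom)) B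
    rw [hη2]
    exact ⟨(closing_iso _ _ n ⟨(NatIso.mapHomologicalComplex (tensorRightLeftReg f)
        (ComplexShape.up ℤ)).app B⟩).some ≪≫
      (shiftFunctor _ n).mapIso ((pullC (ActHom.ofHoms g g)).mapIso e1.some.symm)⟩
  have h := (coneList_leftReg_qEquiv hx ht hf hker hl hm hm' hreg B).map (pull η)
  rw [hops] at h
  have h' := (qEquiv_of_qC (X := (pullC ((quotActHom f ht).comp η)).obj (coneList (m.map
      fun i => Op.comm (ht i))
    ((tensorLeftCx (leftReg f)).obj B))) (Y := (pullC ((evalActHom ht).comp η)).obj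
      (coneList ((l.map (relOp A hx)).map (Op.push (evalActHom ht))) B)) h).shift n
  rw [hη1] at h'
  refine h'.trans (QEquiv.of_iso ?_)
  exact (((qC P P _).commShiftIso n).app _).symm ≪≫ (qC P P _).mapIso hrel.some.symm
end

end GrBimod

/-! ### Degrees of the generators and relations for two blocks -/

namespace GrBimod
open MvPolynomial GrAlg
variable {K : Type u} [Field K] (D : GrAlg K) (a b : ℕ)

/-- The degrees of the elementary symmetric polynomials of two blocks. -/
def blockWeight (a b : ℕ) : Fin a ⊕ Fin b → ℤ :=
  Sum.elim (fun i => 2 * ((a - i.val : ℕ) : ℤ)) fun i => 2 * ((b - i.val : ℕ) : ℤ)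

/-- With `T` in degree `2` the weights make the generic monic polynomial homogeneous of degree `2n`.
All indices are allowed: the leading coefficient `1` has degree `0`, and beyond it the coefficients
vanish. -/
theorem coeff_freeMonic_map_mem {n : ℕ} {σ : Type} {w : σ → ℤ} (e : Fin n → σ)
    (he : ∀ i, w (e i) = 2 * ((n - i.val : ℕ) : ℤ)) (i : ℕ) :
    ((Polynomial.freeMonic D n).map (rename (R := D) e).toRingHom).coeff i ∈
      polyDeg D w (2 * ((n : ℤ) - i)) := by
  rw [Polynomial.coeff_map, Polynomial.coeff_freeMonic]
  split_ifs with h h'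
  · have h1 := X_mem_polyDeg (D := D) (w := w) (e ⟨i, h⟩)
    rw [he, Nat.cast_sub h.le] at h1
    have h2 : (rename (R := D) e).toRingHom (X ⟨i, h⟩) = X (e ⟨i, h⟩) := rename_X _ _
    rw [h2]
    exact h1
  · subst h'
    rw [map_one, sub_self, mul_zero]
    exact one_mem_polyDeg
  · rw [map_zero]
    exact zero_mem _

theorem coeffMul_mem_polyDeg (k : Fin (a + b)) :
    coeffMul D a b k ∈ polyDeg D (blockWeight a b) (2 * ((a + b - k.val : ℕ) : ℤ)) := by
  rw [coeffMul, Polynomial.coeff_mul]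
  refine sum_mem fun ij hij => ?_
  have h := mul_mem_polyDeg
    (coeff_freeMonic_map_mem D (w := blockWeight a b) Sum.inl (fun _ => rfl) ij.1)
    (coeff_freeMonic_map_mem D (w := blockWeight a b) Sum.inr (fun _ => rfl) ij.2)
  have hk := Finset.HasAntidiagonal.mem_antidiagonal.1 hij
  rwa [show 2 * ((a : ℤ) - ij.1) + 2 * ((b : ℤ) - ij.2) = 2 * ((a + b - k.val : ℕ) : ℤ) by
    omega] at h

/-- `coeffMul` has coefficients coming from `K`, so evaluating its variables on the right leaves
nothing in the left factor. -/
theorem actEval_coeffMul {A : GrAlg K} (t : Fin a ⊕ Fin b → A) (k : Fin (a + b)) :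
    actEval D t (coeffMul D a b k) = (1 : D) ⊗ₜ[K] aeval t (coeffMul K a b k) := by
  rw [← map_coeffMul (algebraMap K D)]
  have h : ((actEval D t).comp (mapAlgHom (Algebra.ofId K D))) = rightEval t := by
    refine algHom_ext fun i => ?_
    change actEval D t (MvPolynomial.map _ (X i)) = _
    rw [map_X, actEval_X, rightEval, AlgHom.comp_apply, aeval_X]
    rfl
  exact DFunLike.congr_fun h _

theorem sum_finRange_two_mul_sub (n : ℕ) :
    ((List.finRange n).map fun i : Fin n => 2 * ((n - i.val : ℕ) : ℤ)).sum = n * (n + 1) := by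
  rw [← List.ofFn_eq_map, List.sum_ofFn]
  have h : ∀ n : ℕ, ∑ i ∈ Finset.range n, 2 * ((n : ℤ) - i) = n * (n + 1) := fun n => by
    induction n with
    | zero => simp
    | succ n ih =>
      rw [Finset.sum_range_succ]
      have : ∑ i ∈ Finset.range n, 2 * (((n + 1 : ℕ) : ℤ) - i) =
          ∑ i ∈ Finset.range n, (2 * ((n : ℤ) - i) + 2) :=
        Finset.sum_congr rfl fun i _ => by push_cast; ring
      rw [this, Finset.sum_add_distrib, ih]
      simp
      ring
  rw [← h, Finset.sum_range]
  exact Finset.sum_congr rfl fun i _ => by rw [Nat.cast_sub i.2.le]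

end GrBimod

/-! ### The split isomorphism -/

namespace Web
open GrBimod MvPolynomial GrAlg
variable {K : Type u} [Field K]

theorem twoBlockElem_mem (p : List ℕ) (a b : ℕ) (i : Fin a ⊕ Fin b) :
    twoBlockElem K p a b i ∈ (invRing K (p ++ [a] ++ [b])).deg (blockWeight a b i) := by
  cases i with
  | inl i =>
    exact (inclHom (K := K) (invariants_le_concat (p ++ [a]) b)).map_deg
      (lastElem_mem p a (a - i))
  | inr i => exact lastElem_mem (p ++ [a]) b (b - i)

theorem aeval_twoBlockElem (p : List ℕ) (a b : ℕ) (k : Fin (a + b)) :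
    aeval (twoBlockElem K p a b) (coeffMul K a b k) =
      (inclHom (K := K) (refines_concat p a b).invariants_le).toAlgHom
        (lastElem p (a + b) (a + b - k)) := by
  rw [inclHom_lastElem_eq, ← map_coeffMul (algebraMap K (invRing K p)), twoBlockHom,
    eval₂Hom_map_hom, aeval_def, coe_eval₂Hom]
  congr 1

instance (p : List ℕ) : Nontrivial (invRing K p) := 
  inferInstanceAs (Nontrivial (invariants K p))

theorem restrictLast_comp_restrictLast (p : List ℕ) (a b : ℕ) :
    (restrictLast K (p ++ [a]) b).comp (restrictLast K p a) =
      ActHom.ofHoms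
        ((inclHom (refines_concat p a b).invariants_le).comp
          (inclHom (invariants_le_concat p (a + b))))
        ((inclHom (refines_concat p a b).invariants_le).comp
          (inclHom (invariants_le_concat p (a + b)))) := by
  have h (r : invRing K p) := (inclHom_inclHom (invariants_le_concat (p ++ [a]) b)
    (invariants_le_concat p a)
    ((invariants_le_concat p a).trans (invariants_le_concat (p ++ [a]) b)) r).trans
        (inclHom_inclHom (refines_concat p a b).invariants_le
      (invariants_le_concat p (a + b)) _ r).symm
  exact ActHom.ext_tmul fun y z => congrArg₂
    (fun y z : invRing K (p ++ [a] ++ [b]) => y ⊗ₜ[K] z) (h y) (h z)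

theorem push_ofHoms_comm {A B : GrAlg K} (f : GrAlg.Hom A B) {r : A} {d : ℤ}
    (hr : r ∈ A.deg d) :
    (Op.comm hr).push (ActHom.ofHoms f f) = Op.comm (f.map_deg hr) := by
  refine Op.ext_elt ?_ rfl
  refine (map_sub (ActHom.ofHoms f f).toAlgHom _ _).trans (congrArg₂ (· - ·) ?_ ?_)
  · exact congrArg (fun y : B => f.toAlgHom r ⊗ₜ[K] y) (map_one f.toAlgHom)
  · exact congrArg (fun y : B => y ⊗ₜ[K] f.toAlgHom r) (map_one f.toAlgHom)

/-- The strand colored `b` is closed first, so its operators come first; those of the strand colored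
`a` act through the inclusion of rings. -/
theorem blockOps_append (p : List ℕ) (a b : ℕ) :
    blockOps K (p ++ [a]) b ++ (blockOps K p a).map (Op.push (restrictLast K (p ++ [a]) b)) =
      ((List.finRange b).map Sum.inr ++ (List.finRange a).map Sum.inl).map
        fun i => Op.comm (twoBlockElem_mem (K := K) p a b i) := by
  rw [List.map_append, List.map_map, List.map_map, blockOps, blockOps, List.map_map]
  exact congrArg₂ (· ++ ·) rfl (List.map_congr_left fun i _ => push_ofHoms_comm _ _)

/-- The grading shift of the theorem arises here: the generators of a block of size `n` have total
degree `n (n + 1)`, and `(a + b)(a + b + 1) - a (a + 1) - b (b + 1) = 2ab`. -/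
theorem sum_blockWeight (a b : ℕ) :
    ((List.finRange (a + b)).map fun k : Fin (a + b) => 2 * ((a + b - k.val : ℕ) : ℤ)).sum -
      (((List.finRange b).map Sum.inr ++ (List.finRange a).map Sum.inl).map
        (blockWeight a b)).sum = 2 * a * b := by
  rw [List.map_append, List.map_map, List.map_map, List.sum_append]
  have h1 : blockWeight a b ∘ Sum.inr = fun i : Fin b => 2 * ((b - i.val : ℕ) : ℤ) := rfl
  have h2 : blockWeight a b ∘ Sum.inl = fun i : Fin a => 2 * ((a - i.val : ℕ) : ℤ) := rfl
  rw [h1, h2, sum_finRange_two_mul_sub, sum_finRange_two_mul_sub, sum_finRange_two_mul_sub]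
  push_cast
  ring

/-- The general comparison is applied to the presentation of the refined ring by the elementary
symmetric polynomials of its last two blocks. Closing these variables is the double trace, and
closing the `a + b` generators of the merged block is the single trace, with the same cohomological
shift. -/
theorem partialTrace_split_qEquiv (p : List ℕ) (a b : ℕ) (B : CochainComplex
        (GrBimod (invRing K (p ++ [a + b])) (invRing K (p ++ [a] ++ [b]))) ℤ) :
    QEquiv (partialTrace p a (partialTrace (p ++ [a]) b
        (tensorLeftC (split (refines_concat p a b)) B)))
      (qShiftC (2 * a * b) (partialTrace p (a + b)
        (tensorRightC B (split (refines_concat p a b))))) := by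
  have h := closing_leftReg_qEquiv (D := invRing K (p ++ [a + b])) (w := blockWeight a b)
    (x := fun k : Fin (a + b) => coeffMul (invRing K (p ++ [a + b])) a b k -
      C (lastElem p (a + b) (a + b - k)))
    (v := fun k => 2 * ((a + b - k.val : ℕ) : ℤ))
    (fun k => sub_mem (coeffMul_mem_polyDeg _ a b k) (C_mem_polyDeg (lastElem_mem p (a + b) _)))
    (twoBlockElem_mem p a b) (surjective_eval₂Hom_twoBlockElem p a b)
    (ker_eval₂Hom_twoBlockElem p a b) (l := List.finRange (a + b)) List.mem_finRange
    (m := (List.finRange b).map Sum.inr ++ (List.finRange a).map Sum.inl)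
    (by rintro (i | i) <;> simp)
    (by
      refine List.Nodup.append ((List.nodup_finRange b).map Sum.inr_injective)
        ((List.nodup_finRange a).map Sum.inl_injective) ?_
      simp [List.disjoint_left])
    (fun B => isWeaklyRegular_coeffMul_sub _ a b _ (List.nodup_finRange _))
    (fun k => lastElem_mem p (a + b) (a + b - k.val))
    (fun k => by
      -- Evaluated on the right, the coefficient of the product becomes the image of the elementary
      -- symmetric polynomial of the merged block, while its prescribed value keeps acting on the
      -- left.
      rw [map_sub, actEval_C, actEval_coeffMul, aeval_twoBlockElem])
    (inclHom (invariants_le_concat p (a + b))) (-((a + b : ℕ) : ℤ)) B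
  rw [sum_blockWeight, ← restrictLast_comp_restrictLast, ← blockOps_append] at h
  refine (QEquiv.of_nonempty_iso (partialTrace_partialTrace_iso p a b _)).trans (h.trans ?_)
  exact QEquiv.of_iso ((qC _ _ _).mapIso (partialTrace_iso p (a + b) _).some.symm)

end Web

/-! ### Interchanging left and right actions -/

namespace GrBimod
open GrAlg
variable {K : Type u} [Field K] {A B C D A' B' : GrAlg K}

/-- An anti-isomorphism of degree `s` of graded bimodules: it interchanges the two actions. -/
structure FlipEquiv (M : GrBimod A B) (M' : GrBimod B A) (s : ℤ) where
  /-- the underlying additive equivalence -/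
  equiv : M ≃+ M'
  map_smul (a : A) (b : B) (x : M) : equiv ((a ⊗ₜ[K] b) • x) = (b ⊗ₜ[K] a) • equiv x
  map_deg {n : ℤ} {x : M} : x ∈ M.deg n → equiv x ∈ M'.deg (n - s)

theorem FlipEquiv.symm_map_smul {M : GrBimod A B} {M' : GrBimod B A} {s : ℤ}
    (e : FlipEquiv M M' s) (a : A) (b : B) (x : M') :
    e.equiv.symm ((b ⊗ₜ[K] a) • x) = (a ⊗ₜ[K] b) • e.equiv.symm x := by
  rw [AddEquiv.symm_apply_eq, e.map_smul, AddEquiv.apply_symm_apply]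

/-- The flip of a bimodule. -/
abbrev flipFunctor (A B : GrAlg K) : GrBimod A B ⥤ GrBimod B A := pull (ActHom.flip A B)

/-- A bimodule and its flip. -/
def FlipEquiv.flip (M : GrBimod A B) : FlipEquiv M ((flipFunctor A B).obj M) 0 where
  equiv := AddEquiv.refl M
  map_smul _ _ _ := rfl
  map_deg {n x} hx := by
    rw [sub_zero]
    exact hx

section TensorFlip
variable {M : GrBimod A B} {N : GrBimod B C} {M' : GrBimod B A} {N' : GrBimod C B} {s t r : ℤ}
  (e : FlipEquiv M M' s) (e' : FlipEquiv N N' t)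

/-- The map `x ⊗ y ↦ y ⊗ x`. -/
def tensorFlipHom : TensorCarrier M N →+ TensorCarrier N' M' :=
  TensorProduct.liftAddHom
    (((tmulHom N' M').flip.comp e.equiv.toAddMonoidHom).compl₂ e'.equiv.toAddMonoidHom)
    fun b x y => by
      have h1 : e.equiv (show M.RightMod from b • x) =
          (show M'.LeftMod from b • (show M'.LeftMod from e.equiv x)) := e.map_smul 1 b x
      have h2 : e'.equiv (show N.LeftMod from b • y) =
          (show N'.RightMod from b • (show N'.RightMod from e'.equiv y)) := e'.map_smul b 1 y
      refine (congrArg (fun z : M'.LeftMod => tmulHom N' M' (e'.equiv y) z) h1).trans ?_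
      refine Eq.trans ?_ (congrArg (fun z : N'.RightMod => tmulHom N' M' z (e.equiv x)) h2).symm
      exact (TensorProduct.smul_tmul b (show N'.RightMod from e'.equiv y)
        (show M'.LeftMod from e.equiv x)).symm

/-- The map `y ⊗ x ↦ x ⊗ y`. -/
def tensorFlipInv : TensorCarrier N' M' →+ TensorCarrier M N :=
  TensorProduct.liftAddHom
    (((tmulHom M N).flip.comp e'.equiv.symm.toAddMonoidHom).compl₂ e.equiv.symm.toAddMonoidHom)
    fun b y x => by
      have h1 : e.equiv.symm (show M'.LeftMod from b • x) =
          (show M.RightMod from b • (show M.RightMod from e.equiv.symm x)) := e.symm_map_smul 1 b x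
      have h2 : e'.equiv.symm (show N'.RightMod from b • y) =
          (show N.LeftMod from b • (show N.LeftMod from e'.equiv.symm y)) :=
        e'.symm_map_smul b 1 y
      refine (congrArg (fun z : N.LeftMod => tmulHom M N (e.equiv.symm x) z) h2).trans ?_
      refine Eq.trans ?_ (congrArg (fun z : M.RightMod => tmulHom M N z (e'.equiv.symm y)) h1).symm
      exact (TensorProduct.smul_tmul b (show M.RightMod from e.equiv.symm x)
        (show N.LeftMod from e'.equiv.symm y)).symm

theorem tensorFlipHom_bijective : Function.Bijective (tensorFlipHom e e') := by
  refine Function.bijective_iff_has_inverse.2 ⟨tensorFlipInv e e', fun z => ?_, fun z => ?_⟩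
  · induction z using TensorProduct.induction_on with
    | zero => rw [map_zero, map_zero]
    | add z z' hz hz' => rw [map_add, map_add, hz, hz']
    | tmul x y =>
      exact congrArg₂ (fun (x : M.RightMod) (y : N.LeftMod) => x ⊗ₜ[B] y)
        (e.equiv.symm_apply_apply x) (e'.equiv.symm_apply_apply y)
  · induction z using TensorProduct.induction_on with
    | zero => rw [map_zero, map_zero]
    | add z z' hz hz' => rw [map_add, map_add, hz, hz']
    | tmul y x =>
      exact congrArg₂ (fun (y : N'.RightMod) (x : M'.LeftMod) => y ⊗ₜ[B] x)
        (e'.equiv.apply_symm_apply y) (e.equiv.apply_symm_apply x)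

/-- Flipping interchanges the factors of a tensor product. -/
def tensorFlip (h : s + t = r) : tensorObj M N ≅
    (qShift A C r).obj ((flipFunctor C A).obj (tensorObj N' M')) :=
  isoOfBijective (tensorDesc (M := M) (N := N)
    (Z := (qShift A C r).obj ((flipFunctor C A).obj (tensorObj N' M'))) (tensorFlipHom e e')
    (fun a c x y => congrArg₂ (fun (y : N'.RightMod) (x : M'.LeftMod) => y ⊗ₜ[B] x)
      (e'.map_smul 1 c y) (e.map_smul a 1 x))
    (fun {i j x y} hx hy => tmul_mem_tensorDeg (e'.map_deg hy) (e.map_deg hx) (by rw [← h]; ring)))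
    (tensorFlipHom_bijective e e')

end TensorFlip

/-- The flip of `leftReg`, up to a shift. -/
def rightReg (f : GrAlg.Hom D A) (s : ℤ) : GrBimod D A :=
  (qShift D A s).obj ((restrict f (GrAlg.Hom.id A)).obj (diag A))

/-- `rightReg` is the flip of `leftReg`, up to a shift. -/
def FlipEquiv.rightReg (f : GrAlg.Hom D A) (s : ℤ) :
    FlipEquiv (rightReg f s) (leftReg f) s where
  equiv := AddEquiv.refl A
  map_smul d a x := by
    refine Eq.trans ?_ (leftReg_smul f a d x).symm
    have h (x : A) : Algebra.TensorProduct.lmul' K (f.toAlgHom d ⊗ₜ[K] a) * x =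
        a * f.toAlgHom d * x := by
      rw [Algebra.TensorProduct.lmul'_apply_tmul, mul_comm (f.toAlgHom d)]
    exact h x
  map_deg hx := hx

/-- Tensoring with `rightReg` on the right. -/
def tensorRightRightReg (f : GrAlg.Hom D A) (s : ℤ) : tensorRight (A := C) (rightReg f s) ≅
    flipFunctor C D ⋙ tensorLeft (leftReg f) ⋙ flipFunctor A C ⋙ qShift C A s :=
  NatIso.ofComponents (fun M => tensorFlip (FlipEquiv.flip M) (FlipEquiv.rightReg f s) (zero_add s))
    fun _ => tensor_hom_ext fun _ _ => rfl

/-- Tensoring with `rightReg` on the left. -/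
def tensorLeftRightReg (f : GrAlg.Hom D A) (s : ℤ) : tensorLeft (C := C) (rightReg f s) ≅
    flipFunctor A C ⋙ tensorRight (leftReg f) ⋙ flipFunctor C D ⋙ qShift D C s :=
  NatIso.ofComponents (fun M => tensorFlip (FlipEquiv.rightReg f s) (FlipEquiv.flip M) (add_zero s))
    fun _ => tensor_hom_ext fun _ _ => rfl

/-- The flip of a complex, up to a shift. -/
abbrev flipC (A B : GrAlg K) (s : ℤ) :
    CochainComplex (GrBimod A B) ℤ ⥤ CochainComplex (GrBimod B A) ℤ :=
  pullC (ActHom.flip A B) ⋙ qC B A s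

theorem qEquiv_flipC (s : ℤ) {X Y : CochainComplex (GrBimod A B) ℤ} (h : QEquiv X Y) :
    QEquiv ((flipC A B s).obj X) ((flipC A B s).obj Y) :=
  (h.map (flipFunctor A B)).map (qShift B A s)

/-- The flip is compatible with grading shifts. -/
def flipCqC (s t : ℤ) (X : CochainComplex (GrBimod A B) ℤ) :
    (flipC A B s).obj ((qC A B t).obj X) ≅ (qC B A t).obj ((flipC A B s).obj X) :=
  (NatIso.mapHomologicalComplex (qShiftIso (add_comm t s)) (ComplexShape.up ℤ)).app
    ((pullC (ActHom.flip A B)).obj X)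

/-- Tensoring a complex with `rightReg` on the right. -/
def tensorRightCxRightReg (f : GrAlg.Hom D A) (s : ℤ) (X : CochainComplex (GrBimod C D) ℤ) :
    (tensorRightCx (rightReg f s)).obj X ≅ (flipC A C s).obj
      ((tensorLeftCx (leftReg f)).obj ((pullC (ActHom.flip C D)).obj X)) :=
  (NatIso.mapHomologicalComplex (tensorRightRightReg f s) (ComplexShape.up ℤ)).app X

/-- Tensoring a complex with `rightReg` on the left. -/
def tensorLeftCxRightReg (f : GrAlg.Hom D A) (s : ℤ) (X : CochainComplex (GrBimod A C) ℤ) :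
    (tensorLeftCx (rightReg f s)).obj X ≅ (flipC C D s).obj
      ((tensorRightCx (leftReg f)).obj ((pullC (ActHom.flip A C)).obj X)) :=
  (NatIso.mapHomologicalComplex (tensorLeftRightReg f s) (ComplexShape.up ℤ)).app X

/-- The flip carries `r ⊗ 1 - 1 ⊗ r` to its negative, and signs do not affect cones. -/
theorem intertwines_flip_comm {r : A} {d : ℤ} (hr : r ∈ A.deg d) :
    Intertwines (flipFunctor A A) (Op.comm hr) (Op.comm hr) :=
  intertwines_pull_of_eq_neg _ _ _ ((map_sub (ActHom.flip A A).toAlgHom _ _).trans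
    (neg_sub _ _).symm) rfl

/-- Both actions are restricted along the same `f` and every operator is a commutator, so the
closing treats left and right symmetrically. -/
theorem closing_flip {ι : Type*} {x : ι → A} {v : ι → ℤ} (hx : ∀ i, x i ∈ A.deg (v i))
    (f : GrAlg.Hom D A) (l : List ι) (n s : ℤ) (X : CochainComplex (GrBimod A A) ℤ) :
    Nonempty (closing (ActHom.ofHoms f f) (l.map fun i => Op.comm (hx i)) n ((flipC A A s).obj X) ≅
      (flipC D D s).obj (closing (ActHom.ofHoms f f) (l.map fun i => Op.comm (hx i)) n X)) := by
  let zs := l.map fun i => Op.comm (hx i)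
  have e1 := coneList_qC zs s ((pullC (ActHom.flip A A)).obj X)
  have e2 := Intertwines.coneList (F := flipFunctor A A) (zs := zs) (zs' := zs)
    (by
      rw [List.forall₂_map_left_iff, List.forall₂_map_right_iff, List.forall₂_same]
      exact fun i _ => intertwines_flip_comm (hx i)) X
  have h : (ActHom.ofHoms f f).comp (ActHom.flip D D) =
      (ActHom.flip A A).comp (ActHom.ofHoms f f) := ActHom.ext_tmul fun _ _ => rfl
  have e3 : (pullC (ActHom.ofHoms f f)).obj ((flipC A A s).obj (coneList zs X)) =
      (flipC D D s).obj ((pullC (ActHom.ofHoms f f)).obj (coneList zs X)) :=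
    congrArg (fun ψ => (qC D D s).obj ((pullC ψ).obj (coneList zs X))) h.symm
  exact ⟨(shiftFunctor _ n).mapIso ((pullC (ActHom.ofHoms f f)).mapIso
    (e1.some.symm ≪≫ (qC A A s).mapIso e2.some.symm) ≪≫ eqToIso e3) ≪≫
    (((flipFunctor D D ⋙ qShift D D s).mapHomologicalComplex
      (ComplexShape.up ℤ)).commShiftIso n).symm.app _⟩

end GrBimod

/-! ### The merge isomorphism -/

namespace Web
open GrBimod
variable {K : Type u} [Field K]

theorem partialTrace_flip (p : List ℕ) (k : ℕ) (s : ℤ)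
    (X : CochainComplex (GrBimod (invRing K (p ++ [k])) (invRing K (p ++ [k]))) ℤ) :
    Nonempty (partialTrace p k ((flipC _ _ s).obj X) ≅ (flipC _ _ s).obj (partialTrace p k X)) :=
  ⟨(partialTrace_iso p k _).some ≪≫ (closing_flip _ _ _ _ s X).some ≪≫
    (flipC _ _ s).mapIso (partialTrace_iso p k X).some.symm⟩

theorem partialTrace_congr (p : List ℕ) (k : ℕ)
    {X Y : CochainComplex (GrBimod (invRing K (p ++ [k])) (invRing K (p ++ [k]))) ℤ}
    (e : Nonempty (X ≅ Y)) : Nonempty (partialTrace p k X ≅ partialTrace p k Y) :=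
  ⟨(partialTrace_iso p k X).some ≪≫ (closing_iso _ _ _ e).some ≪≫
    (partialTrace_iso p k Y).some.symm⟩

theorem split_eq_leftReg {I J : List ℕ} (h : Refines I J) :
    split (K := K) h = leftReg (inclHom h.invariants_le) := rfl

theorem merge_eq_rightReg {I J : List ℕ} (h : Refines I J) :
    merge (K := K) h = rightReg (inclHom h.invariants_le) (ell I - ell J) := rfl

/-- The merge bimodule is the flip of the split bimodule up to a grading shift, and a flip reverses
tensor products. The split statement for the flip of `C`, flipped back, is therefore the merge
statement for `C`, because partial traces commute with flips. -/
theorem partialTrace_merge_qEquiv (p : List ℕ) (a b : ℕ) (C : CochainComplex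
        (GrBimod (invRing K (p ++ [a] ++ [b])) (invRing K (p ++ [a + b]))) ℤ) :
    QEquiv (partialTrace p a (partialTrace (p ++ [a]) b
        (tensorRightC C (merge (refines_concat p a b)))))
      (qShiftC (2 * a * b) (partialTrace p (a + b)
        (tensorLeftC (merge (refines_concat p a b)) C))) := by
  have h := partialTrace_split_qEquiv p a b ((pullC (ActHom.flip _ _)).obj C)
  rw [split_eq_leftReg] at h
  rw [merge_eq_rightReg]
  -- The shift in the merge bimodule occurs once on each side, so its value plays no role.
  generalize ell (p ++ [a] ++ [b]) - ell (p ++ [a + b]) = s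
  have h1 := partialTrace_congr p a (partialTrace_congr (p ++ [a]) b
    ⟨tensorRightCxRightReg (inclHom (K := K) (refines_concat p a b).invariants_le) s C⟩)
  have h2 := partialTrace_congr p a (partialTrace_flip (p ++ [a]) b s
    ((tensorLeftCx (leftReg (inclHom (K := K) (refines_concat p a b).invariants_le))).obj
      ((pullC (ActHom.flip _ _)).obj C)))
  have h3 := partialTrace_flip p a s (partialTrace (p ++ [a]) b
    ((tensorLeftCx (leftReg (inclHom (K := K) (refines_concat p a b).invariants_le))).obj
      ((pullC (ActHom.flip _ _)).obj C)))
  have h4 := partialTrace_congr p (a + b)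
    ⟨tensorLeftCxRightReg (inclHom (K := K) (refines_concat p a b).invariants_le) s C⟩
  have h5 := partialTrace_flip p (a + b) s
    ((tensorRightCx (leftReg (inclHom (K := K) (refines_concat p a b).invariants_le))).obj
      ((pullC (ActHom.flip _ _)).obj C))
  exact (QEquiv.of_nonempty_iso h1).trans ((QEquiv.of_nonempty_iso h2).trans
    ((QEquiv.of_nonempty_iso h3).trans ((qEquiv_flipC s h).trans
      (QEquiv.of_iso (flipCqC s _ _ ≪≫ (qC _ _ _).mapIso (h5.some.symm ≪≫ h4.some.symm))))))

end Web

end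

theorem lemma4p8 {K : Type u} [Field K] [CharZero K] (p : List ℕ) (a b : ℕ)
    [HasDerivedCategory.{w} (GrBimod (Web.invRing K p) (Web.invRing K p))] :
    (∀ B : CochainComplex
        (GrBimod (Web.invRing K (p ++ [a + b])) (Web.invRing K (p ++ [a] ++ [b]))) ℤ,
      Nonempty
        (DerivedCategory.Q.obj
            (Web.partialTrace p a (Web.partialTrace (p ++ [a]) b
              (Web.tensorLeftC (Web.split (Web.refines_concat p a b)) B))) ≅
          DerivedCategory.Q.obj
            (Web.qShiftC (2 * a * b) (Web.partialTrace p (a + b)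
              (Web.tensorRightC B (Web.split (Web.refines_concat p a b))))))) ∧
    (∀ C : CochainComplex
        (GrBimod (Web.invRing K (p ++ [a] ++ [b])) (Web.invRing K (p ++ [a + b]))) ℤ,
      Nonempty
        (DerivedCategory.Q.obj
            (Web.partialTrace p a (Web.partialTrace (p ++ [a]) b
              (Web.tensorRightC C (Web.merge (Web.refines_concat p a b))))) ≅
          DerivedCategory.Q.obj
            (Web.qShiftC (2 * a * b) (Web.partialTrace p (a + b)
              (Web.tensorLeftC (Web.merge (Web.refines_concat p a b)) C))))) :=
  ⟨fun B => (Web.partialTrace_split_qEquiv p a b B).nonempty_iso,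
    fun C => (Web.partialTrace_merge_qEquiv p a b C).nonempty_iso⟩
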